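/- **Definitions.** An *operator space* is a complex Banach space $X$ with norms $\|\cdot\|_n$ on the matrix spaces $M_n(X)$, $n\ge 0$, extending the norm of $X=M_1(X)$, such that $\|x\oplus y\|_{m+n}=\max(\|x\|_m,\|y\|_n)$ and $\|\alpha x\beta\|_n\le\|\alpha\|\,\|x\|_m\,\|\beta\|$ for $x\in M_m(X)$, $\alpha\in M_{n,m}(\mathbb C)$, $\beta\in M_{m,n}(\mathbb C)$. A linear map $u$ has amplifications $u_n=[u(x_{ij})]$; $\|u\|_{cb}=\sup_n\|u_n\|$; $u$ is a complete contraction if $\|u\|_{cb}\le1$, and a completely isometric isomorphism if it is surjective and every $u_n$ is isometric. $CB(X,Y)$ is the operator space of completely bounded maps, with $M_n(CB(X,Y))=CB(X,M_n(Y))$. $X\widehat\otimes Y$ denotes the completely projective tensor product: the completion of $X\otimes Y$ for the matrix norms $\|v\|_n=\inf\{\|\alpha\|\,\|x\|_p\,\|y\|_q\,\|\beta\| : v=\alpha(x\otimes y)\beta,\ x\in M_p(X),\ y\in M_q(Y),\ \alpha\in M_{n,pq}(\mathbb C),\ \beta\in M_{pq,n}(\mathbb C)\}$. For a complex Hilbert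 space $H$, $B(H)$ is the operator space of bounded operators with $M_n(B(H))=B(H^{\oplus n})$, and $T(H)$ is the space of trace-class operators with the trace norm and the operator space structure that makes $T(H)\to B(H)^*=CB(B(H),\mathbb C)$, $t\mapsto \mathrm{tr}(t\,\cdot)$, completely isometric. The form $(t,b)\mapsto\mathrm{tr}(tb)$ induces a complete contraction $\mathrm{tr}_H\colon T(H)\widehat\otimes B(H)\to\mathbb C$. $H_1\otimes_2H_2$ is the Hilbert space tensor product, and for von Neumann algebras $M\subseteq B(H_1)$, $N\subseteq B(H_2)$, the spatial tensor product $M\bar\otimes N$ is the von Neumann algebra on $H_1\otimes_2H_2$ generated by the operators $a\otimes b$, $a\in M$, $b\in N$ (their double commutant), with the operator space structure of a subspace of $B(H_1\otimes_2H_2)$. $\mathbf Q$ is the Chu category $\mathbf{Chu}(\mathbf{OS},\mathbb C)$ of the category $\mathbf{OS}$ of operator spaces and complete contractions. Its objects are triples $(X,Y,d)$ with $X,Y$ operator spaces and $d\colon X\widehat\otimes Y\to\mathbb C$ a complete contraction. A morphism $(X_1,Y_1,d_1)\to(X_2,Y_2,d_2)$ is a pair of complete contractions $f\colon X_1\to X_2$,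 $g\colon Y_2\to Y_1$ with $d_2\circ(f\otimes\mathrm{id})=d_1\circ(\mathrm{id}\otimes g)$. Its monoidal product is the tensor product of the Chu construction, $$(X_1,Y_1,d_1)\otimes(X_2,Y_2,d_2)=(X_1\widehat\otimes X_2,\;Y,\;d),$$ where $Y$ is the pullback of $CB(X_1,Y_2)$ and $CB(X_2,Y_1)$ over $CB(X_1\widehat\otimes X_2,\mathbb C)$, that is, the closed subspace of the $\ell^\infty$-direct sum $CB(X_1,Y_2)\oplus_\infty CB(X_2,Y_1)$ of the pairs $(f,g)$ with $d_2(x_2\otimes f(x_1))=d_1(x_1\otimes g(x_2))$ for all $x_1,x_2$, and $d((x_1\otimes x_2)\otimes(f,g))$ is this common value. **Proposition.** Let $H_1,H_2$ be complex Hilbert spaces. 1. There is a completely isometric isomorphism $\Phi\colon T(H_1)\widehat\otimes T(H_2)\to T(H_1\otimes_2H_2)$ that sends each elementary tensor of $s\in T(H_1)$ and $t\in T(H_2)$ to the operator $s\otimes t$. 2. The inclusion $\Psi\colon B(H_1)\bar\otimes B(H_2)\to B(H_1\otimes_2H_2)$ is a completely isometric isomorphism. 3. Let $\mathrm{tr}'=\mathrm{tr}_{H_1\otimes_2H_2}\circ(\Phi\otimes\Psi)\colon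 (T(H_1)\widehat\otimes T(H_2))\widehat\otimes(B(H_1)\bar\otimes B(H_2))\to\mathbb C$. Then the monoidal product in $\mathbf Q$ of $(T(H_1),B(H_1),\mathrm{tr}_{H_1})$ and $(T(H_2),B(H_2),\mathrm{tr}_{H_2})$ is $$\bigl(T(H_1)\widehat\otimes T(H_2),\;B(H_1)\bar\otimes B(H_2),\;\mathrm{tr}'\bigr),$$ up to an isomorphism of $\mathbf Q$ whose component on $T(H_1)\widehat\otimes T(H_2)$ is the identity. -/

import Mathlib

open scoped TensorProduct InnerProductSpace

universe u v w

set_option linter.unusedSectionVars false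

noncomputable section

namespace QOS

/-! ## Complex matrices and their operator norm -/

section ScalarNorm

open scoped Matrix.Norms.L2Operator

open scoped Classical in
/-- The norm of a complex matrix as an operator between the Hilbert spaces `ℂⁿ` and `ℂᵐ`. -/
def scalarNorm {m n : Type*} [Fintype m] [Fintype n] (α : Matrix m n ℂ) : ℝ := ‖α‖

variable {m n p q : Type*} [Fintype m] [Fintype n] [Fintype p] [Fintype q]

lemma scalarNorm_nonneg (α : Matrix m n ℂ) : 0 ≤ scalarNorm α := by
  classical
  unfold scalarNorm; exact norm_nonneg α

lemma scalarNorm_mul_le (α : Matrix m n ℂ) (β : Matrix n p ℂ) :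
    scalarNorm (α * β) ≤ scalarNorm α * scalarNorm β := by
  classical
  unfold scalarNorm; exact Matrix.l2_opNorm_mul _ _

lemma scalarNorm_smul (c : ℂ) (α : Matrix m n ℂ) :
    scalarNorm (c • α) = ‖c‖ * scalarNorm α := by
  classical
  unfold scalarNorm; exact norm_smul c α

lemma scalarNorm_zero : scalarNorm (0 : Matrix m n ℂ) = 0 := by
  classical
  unfold scalarNorm; exact norm_zero (E := Matrix m n ℂ)

/-- `∑ᵢ |(α ξ)ᵢ|² ≤ ‖α‖² ∑ⱼ |ξⱼ|²`. -/
lemma sum_sq_mulVec_le (α : Matrix m n ℂ) (ξ : n → ℂ) :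
    ∑ i, ‖α.mulVec ξ i‖ ^ 2 ≤ scalarNorm α ^ 2 * ∑ j, ‖ξ j‖ ^ 2 := by
  classical
  have h := Matrix.l2_opNorm_mulVec α (WithLp.toLp 2 ξ)
  have h2 := pow_le_pow_left₀ (norm_nonneg _) h 2
  rw [mul_pow, EuclideanSpace.norm_sq_eq, EuclideanSpace.norm_sq_eq] at h2
  exact h2

lemma scalarNorm_le_of_sum_sq {α : Matrix m n ℂ} {C : ℝ} (hC : 0 ≤ C)
    (h : ∀ ξ : n → ℂ, ∑ i, ‖α.mulVec ξ i‖ ^ 2 ≤ C ^ 2 * ∑ j, ‖ξ j‖ ^ 2) :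
    scalarNorm α ≤ C := by
  classical
  unfold scalarNorm
  rw [Matrix.l2_opNorm_def]
  refine ContinuousLinearMap.opNorm_le_bound _ hC fun x => ?_
  have h2 := h x.ofLp
  refine le_of_sq_le_sq ?_ (by positivity)
  rw [mul_pow, EuclideanSpace.norm_sq_eq, EuclideanSpace.norm_sq_eq]
  exact h2

/-- Partial injections have norm at most one. -/
lemma scalarNorm_inj_le [DecidableEq n] (f : m → n) (hf : Function.Injective f) :
    scalarNorm ((1 : Matrix n n ℂ).submatrix f id) ≤ 1 := by
  refine scalarNorm_le_of_sum_sq zero_le_one fun ξ => ?_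
  have : ∀ i, ((1 : Matrix n n ℂ).submatrix f id).mulVec ξ i = ξ (f i) := fun i => by
    simp [Matrix.mulVec, dotProduct, Matrix.one_apply]
  simp only [this, one_pow, one_mul]
  classical
  rw [← Finset.sum_image (s := Finset.univ) (g := f) (f := fun j => ‖ξ j‖ ^ 2)
    (fun a _ b _ h => hf h)]
  exact Finset.sum_le_sum_of_subset_of_nonneg (Finset.subset_univ _) fun _ _ _ => by positivity

lemma scalarNorm_inj_le' [DecidableEq n] (f : m → n) (hf : Function.Injective f) :
    scalarNorm ((1 : Matrix n n ℂ).submatrix id f) ≤ 1 := by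
  classical
  have h : (1 : Matrix n n ℂ).submatrix id f
      = ((1 : Matrix n n ℂ).submatrix f id).conjTranspose := by
    ext i j; simp [Matrix.one_apply, Matrix.conjTranspose_apply, eq_comm, apply_ite]
  rw [h]
  have := scalarNorm_inj_le f hf
  unfold scalarNorm at this ⊢
  rwa [Matrix.l2_opNorm_conjTranspose]

lemma scalarNorm_fromBlocks_le (α : Matrix m n ℂ) (β : Matrix p q ℂ) :
    scalarNorm (Matrix.fromBlocks α 0 0 β) ≤ max (scalarNorm α) (scalarNorm β) := by
  refine scalarNorm_le_of_sum_sq (le_max_of_le_left (scalarNorm_nonneg _)) fun ξ => ?_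
  have h1 := sum_sq_mulVec_le α (ξ ∘ Sum.inl)
  have h2 := sum_sq_mulVec_le β (ξ ∘ Sum.inr)
  simp only [Fintype.sum_sum_type, Matrix.fromBlocks_mulVec, Sum.elim_inl, Sum.elim_inr,
    Matrix.zero_mulVec, add_zero, zero_add, mul_add]
  refine add_le_add (h1.trans ?_) (h2.trans ?_)
  · refine mul_le_mul_of_nonneg_right ?_ (by positivity)
    exact pow_le_pow_left₀ (scalarNorm_nonneg _) (le_max_left _ _) 2
  · refine mul_le_mul_of_nonneg_right ?_ (by positivity)
    exact pow_le_pow_left₀ (scalarNorm_nonneg _) (le_max_right _ _) 2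

lemma scalarNorm_fromRows_sq_le (α : Matrix m n ℂ) (β : Matrix p n ℂ) :
    scalarNorm (Matrix.fromRows α β) ≤ √(scalarNorm α ^ 2 + scalarNorm β ^ 2) := by
  refine scalarNorm_le_of_sum_sq (Real.sqrt_nonneg _) fun ξ => ?_
  rw [Real.sq_sqrt (by positivity), add_mul]
  simp only [Fintype.sum_sum_type, Matrix.fromRows_mulVec, Sum.elim_inl, Sum.elim_inr]
  exact add_le_add (sum_sq_mulVec_le α ξ) (sum_sq_mulVec_le β ξ)

lemma scalarNorm_conjTranspose (α : Matrix m n ℂ) :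
    scalarNorm α.conjTranspose = scalarNorm α := by
  classical
  unfold scalarNorm; exact Matrix.l2_opNorm_conjTranspose _

lemma scalarNorm_fromCols_sq_le (α : Matrix m n ℂ) (β : Matrix m p ℂ) :
    scalarNorm (Matrix.fromCols α β) ≤ √(scalarNorm α ^ 2 + scalarNorm β ^ 2) := by
  rw [← scalarNorm_conjTranspose, Matrix.conjTranspose_fromCols_eq_fromRows_conjTranspose]
  refine (scalarNorm_fromRows_sq_le _ _).trans ?_
  rw [scalarNorm_conjTranspose, scalarNorm_conjTranspose]

lemma scalarNorm_smul_one_le [DecidableEq n] (c : ℂ) :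
    scalarNorm (c • (1 : Matrix n n ℂ)) ≤ ‖c‖ := by
  rw [scalarNorm_smul]
  have : scalarNorm (1 : Matrix n n ℂ) ≤ 1 := by
    simpa using scalarNorm_inj_le (n := n) id Function.injective_id
  exact mul_le_of_le_one_right (norm_nonneg _) this

lemma norm_entry_le (α : Matrix m n ℂ) (i : m) (j : n) : ‖α i j‖ ≤ scalarNorm α := by
  classical
  have h := sum_sq_mulVec_le α (Pi.single j 1)
  simp only [Matrix.mulVec_single_one] at h
  have h1 : ∑ k, ‖(Pi.single j (1:ℂ) : n → ℂ) k‖ ^ 2 = 1 := by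
    rw [Finset.sum_eq_single j] <;> simp +contextual
  rw [h1, mul_one] at h
  refine le_of_sq_le_sq (le_trans ?_ h) (scalarNorm_nonneg _)
  exact Finset.single_le_sum (f := fun i => ‖α.col j i‖ ^ 2) (fun _ _ => by positivity)
    (Finset.mem_univ i)

end ScalarNorm

/-! ## Matrix norms on a vector space -/

section MatMul

variable {V : Type*} [AddCommGroup V] [Module ℂ V]
variable {m n p q r s : Type*} [Fintype m] [Fintype n] [Fintype p] [Fintype q] [Fintype r]
  [Fintype s]

/-- The product `α x β` of a matrix `x` over `V` with complex matrices `α` and `β`. -/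
def matMul (α : Matrix m p ℂ) (x : Matrix p q V) (β : Matrix q n ℂ) : Matrix m n V :=
  fun i j => ∑ k, ∑ l, (α i k * β l j) • x k l

lemma matMul_add (α : Matrix m p ℂ) (x y : Matrix p q V) (β : Matrix q n ℂ) :
    matMul α (x + y) β = matMul α x β + matMul α y β := by
  ext i j; simp [matMul, smul_add, Finset.sum_add_distrib]

lemma matMul_sub (α : Matrix m p ℂ) (x y : Matrix p q V) (β : Matrix q n ℂ) :
    matMul α (x - y) β = matMul α x β - matMul α y β := by
  ext i j; simp [matMul, smul_sub, Finset.sum_sub_distrib]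

lemma sum4_comm (F : m → n → p → q → V) :
    ∑ a, ∑ b, ∑ c, ∑ d, F a b c d = ∑ c, ∑ d, ∑ a, ∑ b, F a b c d := by
  have := Finset.sum_comm (s := (Finset.univ : Finset (m × n)))
    (t := (Finset.univ : Finset (p × q))) (f := fun ab cd => F ab.1 ab.2 cd.1 cd.2)
  simpa only [Fintype.sum_prod_type] using this

lemma matMul_matMul (γ : Matrix r m ℂ) (α : Matrix m p ℂ) (x : Matrix p q V) (β : Matrix q n ℂ)
    (δ : Matrix n s ℂ) :
    matMul γ (matMul α x β) δ = matMul (γ * α) x (β * δ) := by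
  ext i j
  simp only [matMul, Matrix.mul_apply, Finset.smul_sum, smul_smul, Finset.sum_mul_sum,
    Finset.sum_smul]
  rw [sum4_comm]
  refine Finset.sum_congr rfl fun c _ => Finset.sum_congr rfl fun d _ => ?_
  refine Finset.sum_congr rfl fun a _ => Finset.sum_congr rfl fun b _ => ?_
  congr 1; ring

lemma matMul_smul_one [DecidableEq p] [DecidableEq q] (c : ℂ) (x : Matrix p q V) :
    matMul (c • (1 : Matrix p p ℂ)) x (1 : Matrix q q ℂ) = c • x := by
  ext i j
  simp [matMul, Matrix.one_apply, ite_smul]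

lemma matMul_inj [DecidableEq p] [DecidableEq q] (f : m → p) (g : n → q) (x : Matrix p q V) :
    matMul ((1 : Matrix p p ℂ).submatrix f id) x ((1 : Matrix q q ℂ).submatrix id g)
      = x.submatrix f g := by
  ext i j
  simp [matMul, Matrix.one_apply, ite_smul]

end MatMul

/-- A family of matrix seminorms on a complex vector space `V`, one for the matrices indexed by
each finite set, that satisfies Ruan's axioms. -/
structure MatNorm (V : Type*) [AddCommGroup V] [Module ℂ V] where
  N : ∀ {ι : Type} [Fintype ι], Matrix ι ι V → ℝ
  add_le : ∀ {ι : Type} [Fintype ι] (x y : Matrix ι ι V), N (x + y) ≤ N x + N y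
  mul_le : ∀ {ι κ : Type} [Fintype ι] [Fintype κ] (α : Matrix κ ι ℂ) (x : Matrix ι ι V)
    (β : Matrix ι κ ℂ), N (matMul α x β) ≤ scalarNorm α * N x * scalarNorm β
  blocks_le : ∀ {ι κ : Type} [Fintype ι] [Fintype κ] (x : Matrix ι ι V) (y : Matrix κ κ V),
    N (Matrix.fromBlocks x 0 0 y) ≤ max (N x) (N y)

namespace MatNorm

variable {V : Type*} [AddCommGroup V] [Module ℂ V] (M : MatNorm V)
variable {ι κ : Type} [Fintype ι] [Fintype κ]

lemma N_smul_le (c : ℂ) (x : Matrix ι ι V) : M.N (c • x) ≤ ‖c‖ * |M.N x| := by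
  classical
  rw [← matMul_smul_one]
  refine (M.mul_le _ _ _).trans ?_
  have h1 := scalarNorm_smul_one_le (n := ι) c
  have h2 := scalarNorm_smul_one_le (n := ι) 1
  rw [one_smul, norm_one] at h2
  calc _ ≤ scalarNorm (c • (1 : Matrix ι ι ℂ)) * |M.N x| * scalarNorm (1 : Matrix ι ι ℂ) := by
        gcongr
        · exact scalarNorm_nonneg _
        · exact scalarNorm_nonneg _
        · exact le_abs_self _
    _ ≤ ‖c‖ * |M.N x| * 1 := by
        gcongr
        exact scalarNorm_nonneg _
    _ = _ := mul_one _

lemma N_zero : M.N (0 : Matrix ι ι V) = 0 := by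
  have h1 := M.N_smul_le 0 (0 : Matrix ι ι V)
  have h2 := M.add_le (0 : Matrix ι ι V) 0
  simp at h1 h2
  exact le_antisymm h1 h2

lemma N_nonneg (x : Matrix ι ι V) : 0 ≤ M.N x := by
  classical
  by_contra h
  push Not at h
  have h2 := M.add_le x ((-1 : ℂ) • x)
  have h3 : x + (-1 : ℂ) • x = 0 := by simp
  rw [h3, N_zero] at h2
  have h9 := M.mul_le ((-1 : ℂ) • (1 : Matrix ι ι ℂ)) x 1
  rw [matMul_smul_one] at h9
  have h10 := mul_nonneg (scalarNorm_nonneg ((-1 : ℂ) • (1 : Matrix ι ι ℂ)))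
    (scalarNorm_nonneg (1 : Matrix ι ι ℂ))
  have : M.N ((-1 : ℂ) • x) ≤ 0 := h9.trans (by nlinarith)
  linarith

lemma N_smul (c : ℂ) (x : Matrix ι ι V) : M.N (c • x) = ‖c‖ * M.N x := by
  refine le_antisymm ((M.N_smul_le c x).trans (by rw [abs_of_nonneg (M.N_nonneg x)])) ?_
  rcases eq_or_ne c 0 with rfl | hc
  · simp [N_zero]
  · have := M.N_smul_le c⁻¹ (c • x)
    rw [smul_smul, inv_mul_cancel₀ hc, one_smul, abs_of_nonneg (M.N_nonneg _), norm_inv] at this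
    have hc' : 0 < ‖c‖ := norm_pos_iff.2 hc
    calc ‖c‖ * M.N x ≤ ‖c‖ * (‖c‖⁻¹ * M.N (c • x)) := by gcongr
      _ = M.N (c • x) := by field_simp

lemma N_neg (x : Matrix ι ι V) : M.N (-x) = M.N x := by
  have := M.N_smul (-1) x
  simpa using this

lemma N_sub_le (x y : Matrix ι ι V) : M.N (x - y) ≤ M.N x + M.N y := by
  rw [sub_eq_add_neg, ← M.N_neg y]; exact M.add_le _ _

lemma N_submatrix_le (f : κ → ι) (hf : Function.Injective f) (x : Matrix ι ι V) :
    M.N (x.submatrix f f) ≤ M.N x := by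
  classical
  rw [← matMul_inj]
  refine (M.mul_le _ _ _).trans ?_
  have h1 := scalarNorm_inj_le f hf
  have h2 := scalarNorm_inj_le' f hf
  calc _ ≤ 1 * M.N x * 1 := by
        gcongr
        · exact scalarNorm_nonneg _
        · exact mul_nonneg zero_le_one (M.N_nonneg x)
        · exact M.N_nonneg x
    _ = _ := by ring

lemma N_submatrix_equiv (e : κ ≃ ι) (x : Matrix ι ι V) : M.N (x.submatrix e e) = M.N x := by
  refine le_antisymm (M.N_submatrix_le e e.injective x) ?_
  have := M.N_submatrix_le e.symm e.symm.injective (x.submatrix e e)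
  simpa using this

lemma N_fromBlocks (x : Matrix ι ι V) (y : Matrix κ κ V) :
    M.N (Matrix.fromBlocks x 0 0 y) = max (M.N x) (M.N y) := by
  refine le_antisymm (M.blocks_le x y) (max_le ?_ ?_)
  · exact M.N_submatrix_le Sum.inl Sum.inl_injective (Matrix.fromBlocks x 0 0 y)
  · exact M.N_submatrix_le Sum.inr Sum.inr_injective (Matrix.fromBlocks x 0 0 y)

/-- The seminorm of a vector, seen as a `1 × 1` matrix. -/
def nrm (v : V) : ℝ := M.N (Matrix.of fun _ _ : Unit => v)

lemma entry_le (x : Matrix ι ι V) (i j : ι) : M.nrm (x i j) ≤ M.N x := by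
  classical
  have h : (Matrix.of fun _ _ : Unit => x i j)
      = matMul ((1 : Matrix ι ι ℂ).submatrix (fun _ : Unit => i) id) x
        ((1 : Matrix ι ι ℂ).submatrix id (fun _ : Unit => j)) := by
    rw [matMul_inj]; rfl
  rw [nrm, h]
  refine (M.mul_le _ _ _).trans ?_
  have h1 := scalarNorm_inj_le (fun _ : Unit => i) (fun _ _ _ => rfl)
  have h2 := scalarNorm_inj_le' (fun _ : Unit => j) (fun _ _ _ => rfl)
  calc _ ≤ 1 * M.N x * 1 := by
        gcongr
        · exact scalarNorm_nonneg _
        · exact mul_nonneg zero_le_one (M.N_nonneg x)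
        · exact M.N_nonneg x
    _ = _ := by ring

lemma N_finset_sum_le {τ : Type*} (s : Finset τ) (x : τ → Matrix ι ι V) :
    M.N (∑ t ∈ s, x t) ≤ ∑ t ∈ s, M.N (x t) := by
  classical
  induction s using Finset.induction_on with
  | empty => simp [N_zero]
  | insert a s ha ih =>
    rw [Finset.sum_insert ha, Finset.sum_insert ha]
    exact (M.add_le _ _).trans (add_le_add le_rfl ih)

/-- A matrix is bounded by the sum of its blocks. -/
lemma N_le_sum_blocks (x : Matrix (ι × κ) (ι × κ) V) :
    M.N x ≤ ∑ k : κ, ∑ l : κ, M.N (Matrix.of fun i j : ι => x (i, k) (j, l)) := by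
  classical
  have h : x = ∑ kl : κ × κ, matMul
      ((1 : Matrix (ι × κ) (ι × κ) ℂ).submatrix id (fun i : ι => (i, kl.1)))
      (Matrix.of fun i j : ι => x (i, kl.1) (j, kl.2))
      ((1 : Matrix (ι × κ) (ι × κ) ℂ).submatrix (fun i : ι => (i, kl.2)) id) := by
    ext ⟨a, b⟩ ⟨c, d⟩
    simp only [Matrix.sum_apply, matMul, Matrix.submatrix_apply, id, Matrix.one_apply,
      Prod.mk.injEq]
    rw [Finset.sum_eq_single (b, d)]
    · rw [Finset.sum_eq_single a, Finset.sum_eq_single c] <;> simp +contextual [eq_comm]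
    · rintro ⟨k, l⟩ - hkl
      refine Finset.sum_eq_zero fun i _ => Finset.sum_eq_zero fun j _ => ?_
      by_cases h1 : b = k
      · by_cases h2 : l = d
        · exact absurd (by rw [h1, h2]) hkl
        · simp [h2]
      · simp [h1]
    · simp
  conv_lhs => rw [h]
  refine (M.N_finset_sum_le _ _).trans ?_
  rw [Fintype.sum_prod_type]
  refine Finset.sum_le_sum fun k _ => Finset.sum_le_sum fun l _ => ?_
  refine (M.mul_le _ _ _).trans ?_
  have h1 := scalarNorm_inj_le' (fun i : ι => (i, k)) (fun _ _ h => congrArg Prod.fst h)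
  have h2 := scalarNorm_inj_le (fun i : ι => (i, l)) (fun _ _ h => congrArg Prod.fst h)
  have h3 := M.N_nonneg (Matrix.of fun i j : ι => x (i, k) (j, l))
  calc _ ≤ 1 * M.N (Matrix.of fun i j : ι => x (i, k) (j, l)) * 1 := by
        gcongr
        · exact scalarNorm_nonneg _
    _ = _ := by ring

lemma N_le_sum (x : Matrix ι ι V) : M.N x ≤ ∑ i, ∑ j, M.nrm (x i j) := by
  have := M.N_le_sum_blocks (x.submatrix (Equiv.punitProd ι) (Equiv.punitProd ι))
  rw [N_submatrix_equiv] at this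
  exact this

lemma abs_N_sub_le (x y : Matrix ι ι V) : |M.N x - M.N y| ≤ M.N (x - y) := by
  rw [abs_sub_le_iff]
  constructor
  · have := M.add_le (x - y) y
    rw [sub_add_cancel] at this; linarith
  · have := M.add_le (y - x) x
    rw [sub_add_cancel, ← neg_sub, N_neg] at this; linarith

end MatNorm

/-! ## Operator spaces -/

/-- The block-diagonal matrix `x ⊕ y`. -/
def directSum {V : Type*} [Zero V] {m n : ℕ} (x : Matrix (Fin m) (Fin m) V)
    (y : Matrix (Fin n) (Fin n) V) : Matrix (Fin (m + n)) (Fin (m + n)) V :=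
  (Matrix.fromBlocks x 0 0 y).submatrix finSumFinEquiv.symm finSumFinEquiv.symm

/-- An (abstract) operator space: a complex Banach space together with norms `‖·‖ₙ` on the
spaces of `n × n` matrices over it, such that `‖·‖₁` is the given norm and such that
`‖x ⊕ y‖ = max ‖x‖ ‖y‖` and `‖α x β‖ ≤ ‖α‖ ‖x‖ ‖β‖` for complex matrices `α`, `β`. -/
structure OpSpace : Type (u + 1) where
  carrier : Type u
  [normedAddCommGroup : NormedAddCommGroup carrier]
  [normedSpace : NormedSpace ℂ carrier]
  [completeSpace : CompleteSpace carrier]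
  /-- The norm `‖·‖ₙ` on `n × n` matrices. -/
  matNorm : ∀ n : ℕ, Matrix (Fin n) (Fin n) carrier → ℝ
  matNorm_add_le : ∀ (n : ℕ) (x y : Matrix (Fin n) (Fin n) carrier),
    matNorm n (x + y) ≤ matNorm n x + matNorm n y
  matNorm_smul : ∀ (n : ℕ) (c : ℂ) (x : Matrix (Fin n) (Fin n) carrier),
    matNorm n (c • x) = ‖c‖ * matNorm n x
  eq_zero_of_matNorm : ∀ (n : ℕ) (x : Matrix (Fin n) (Fin n) carrier), matNorm n x = 0 → x = 0
  matNorm_one : ∀ x : carrier, matNorm 1 (Matrix.of fun _ _ => x) = ‖x‖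
  matNorm_directSum : ∀ (m n : ℕ) (x : Matrix (Fin m) (Fin m) carrier)
    (y : Matrix (Fin n) (Fin n) carrier),
    matNorm (m + n) (directSum x y) = max (matNorm m x) (matNorm n y)
  matNorm_mul_le : ∀ (m n : ℕ) (α : Matrix (Fin n) (Fin m) ℂ) (x : Matrix (Fin m) (Fin m) carrier)
    (β : Matrix (Fin m) (Fin n) ℂ),
    matNorm n (matMul α x β) ≤ scalarNorm α * matNorm m x * scalarNorm β

attribute [instance] OpSpace.normedAddCommGroup OpSpace.normedSpace OpSpace.completeSpace

instance : CoeSort OpSpace.{u} (Type u) := ⟨OpSpace.carrier⟩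

lemma matMul_submatrix {V : Type*} [AddCommGroup V] [Module ℂ V] {m n p q m' n' p' q' : Type*}
    [Fintype p] [Fintype q] [Fintype p'] [Fintype q']
    (α : Matrix m p ℂ) (x : Matrix p q V) (β : Matrix q n ℂ) (f : m' → m) (g : n' → n)
    (e : p' ≃ p) (e' : q' ≃ q) :
    matMul (α.submatrix f e) (x.submatrix e e') (β.submatrix e' g)
      = (matMul α x β).submatrix f g := by
  ext i j
  simp only [matMul, Matrix.submatrix_apply]
  rw [← e.sum_comp]
  refine Finset.sum_congr rfl fun k _ => ?_
  rw [← e'.sum_comp]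

lemma scalarNorm_submatrix_le {m n m' n' : Type*} [Fintype m] [Fintype n] [Fintype m']
    [Fintype n'] (α : Matrix m n ℂ) (e : m' ≃ m) (e' : n' ≃ n) :
    scalarNorm (α.submatrix e e') ≤ scalarNorm α := by
  refine scalarNorm_le_of_sum_sq (scalarNorm_nonneg _) fun ξ => ?_
  have h := sum_sq_mulVec_le α (ξ ∘ e'.symm)
  rw [← e.sum_comp, ← e'.sum_comp (fun j => ‖(ξ ∘ e'.symm) j‖ ^ 2)] at h
  rw [Matrix.submatrix_mulVec_equiv]
  simpa using h

lemma scalarNorm_submatrix_equiv {m n m' n' : Type*} [Fintype m] [Fintype n] [Fintype m']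
    [Fintype n'] (α : Matrix m n ℂ) (e : m' ≃ m) (e' : n' ≃ n) :
    scalarNorm (α.submatrix e e') = scalarNorm α := by
  refine le_antisymm (scalarNorm_submatrix_le α e e') ?_
  have := scalarNorm_submatrix_le (α.submatrix e e') e.symm e'.symm
  simpa using this

namespace OpSpace

lemma matNorm_nonneg (X : OpSpace.{u}) (n : ℕ) (x : Matrix (Fin n) (Fin n) X) :
    0 ≤ X.matNorm n x := by
  have h4 := X.matNorm_add_le n x ((-1 : ℂ) • x)
  have h5 := X.matNorm_smul n 0 x
  have h6 : x + (-1 : ℂ) • x = (0 : ℂ) • x := by simp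
  rw [h6, h5, X.matNorm_smul] at h4
  simp at h4; linarith

/-- The matrix norms of an operator space, for matrices indexed by arbitrary finite sets. -/
def mn (X : OpSpace.{u}) : MatNorm X where
  N {ι} _ x := X.matNorm (Fintype.card ι)
    (x.submatrix (Fintype.equivFin ι).symm (Fintype.equivFin ι).symm)
  add_le x y := X.matNorm_add_le _ _ _
  mul_le {ι κ} _ _ α x β := by
    rw [← matMul_submatrix α x β _ _ (Fintype.equivFin ι).symm (Fintype.equivFin ι).symm]
    refine (X.matNorm_mul_le _ _ _ _ _).trans ?_
    rw [scalarNorm_submatrix_equiv, scalarNorm_submatrix_equiv]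
  blocks_le {ι κ} _ _ x y := by
    rw [← X.matNorm_directSum]
    let e : Fin (Fintype.card (ι ⊕ κ)) ≃ Fin (Fintype.card ι + Fintype.card κ) :=
      ((Fintype.equivFin (ι ⊕ κ)).symm.trans
        ((Fintype.equivFin ι).sumCongr (Fintype.equivFin κ))).trans finSumFinEquiv
    have h : (Matrix.fromBlocks x 0 0 y).submatrix (Fintype.equivFin (ι ⊕ κ)).symm
        (Fintype.equivFin (ι ⊕ κ)).symm = (directSum
        (x.submatrix (Fintype.equivFin ι).symm (Fintype.equivFin ι).symm)
        (y.submatrix (Fintype.equivFin κ).symm (Fintype.equivFin κ).symm)).submatrix e e := by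
      ext i j
      simp only [directSum, Matrix.submatrix_apply, e, Equiv.trans_apply, Equiv.symm_apply_apply,
        Equiv.sumCongr_apply]
      rcases (Fintype.equivFin (ι ⊕ κ)).symm i with a | a <;>
      rcases (Fintype.equivFin (ι ⊕ κ)).symm j with b | b <;> simp
    rw [h, ← matMul_inj]
    refine (X.matNorm_mul_le _ _ _ _ _).trans ?_
    have h1 := scalarNorm_inj_le e e.injective
    have h2 := scalarNorm_inj_le' e e.injective
    calc _ ≤ 1 * X.matNorm _ (directSum
        (x.submatrix (Fintype.equivFin ι).symm (Fintype.equivFin ι).symm)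
        (y.submatrix (Fintype.equivFin κ).symm (Fintype.equivFin κ).symm)) * 1 := by
          gcongr
          · exact scalarNorm_nonneg _
          · exact mul_nonneg zero_le_one (X.matNorm_nonneg _ _)
          · exact X.matNorm_nonneg _ _
      _ = _ := by ring

variable (X : OpSpace.{u}) {ι κ : Type} [Fintype ι] [Fintype κ]

/-- The norm of a square matrix over an operator space, indexed by an arbitrary finite set. -/
def mnorm (x : Matrix ι ι X) : ℝ := X.mn.N x

lemma mnorm_fin {n : ℕ} (x : Matrix (Fin n) (Fin n) X) : X.mnorm x = X.matNorm n x := by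
  have key : ∀ (m : ℕ) (hm : m = n) (e : Fin m ≃ Fin n),
      X.matNorm m (x.submatrix e e) = X.matNorm n x := by
    rintro m rfl e
    have key : ∀ (e : Fin m ≃ Fin m) x, X.matNorm m (x.submatrix e e) ≤ X.matNorm m x := by
      intro e x
      rw [← matMul_inj]
      refine (X.matNorm_mul_le _ _ _ _ _).trans ?_
      have h1 := scalarNorm_inj_le e e.injective
      have h2 := scalarNorm_inj_le' e e.injective
      calc _ ≤ 1 * X.matNorm m x * 1 := by
            gcongr
            · exact scalarNorm_nonneg _
            · exact mul_nonneg zero_le_one (X.matNorm_nonneg _ _)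
            · exact X.matNorm_nonneg _ _
        _ = _ := by ring
    refine le_antisymm (key e x) ?_
    have := key e.symm (x.submatrix e e)
    simpa using this
  exact key _ (Fintype.card_fin n) _

lemma nrm_eq (x : X) : X.mn.nrm x = ‖x‖ := by
  rw [← X.matNorm_one, ← mnorm_fin, mnorm]
  exact (X.mn.N_submatrix_equiv (Equiv.equivPUnit (Fin 1)) (Matrix.of fun _ _ : Unit => x)).symm

/-- A Banach space with a compatible Ruan family of matrix seminorms is an operator space. -/
@[simps carrier]
def ofMatNorm (V : Type u) [NormedAddCommGroup V] [NormedSpace ℂ V] [CompleteSpace V]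
    (M : MatNorm V) (h : ∀ v, M.nrm v = ‖v‖) : OpSpace.{u} where
  carrier := V
  matNorm n x := M.N x
  matNorm_add_le n := M.add_le
  matNorm_smul n := M.N_smul
  eq_zero_of_matNorm n x hx := by
    ext i j
    have h1 := M.entry_le x i j
    rw [hx, h] at h1
    simpa using h1
  matNorm_one x := by
    rw [← h, MatNorm.nrm,
      ← M.N_submatrix_equiv (Equiv.equivPUnit (Fin 1)) (Matrix.of fun _ _ : Unit => x)]
    rfl
  matNorm_directSum m n x y := by
    rw [directSum, M.N_submatrix_equiv, M.N_fromBlocks]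
  matNorm_mul_le m n := M.mul_le

lemma ofMatNorm_mnorm (V : Type u) [NormedAddCommGroup V] [NormedSpace ℂ V] [CompleteSpace V]
    (M : MatNorm V) (h : ∀ v, M.nrm v = ‖v‖) (x : Matrix ι ι V) :
    (ofMatNorm V M h).mnorm x = M.N x :=
  M.N_submatrix_equiv (Fintype.equivFin ι).symm x

end OpSpace

namespace MatNorm

variable {V W : Type*} [AddCommGroup V] [Module ℂ V] [AddCommGroup W] [Module ℂ W]

lemma matMul_map {m n p q : Type*} [Fintype p] [Fintype q] (α : Matrix m p ℂ) (x : Matrix p q V)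
    (β : Matrix q n ℂ) (f : V →ₗ[ℂ] W) : (matMul α x β).map f = matMul α (x.map f) β := by
  ext i j; simp [matMul]

/-- The pullback of matrix seminorms along a linear map. -/
def comap (M : MatNorm W) (f : V →ₗ[ℂ] W) : MatNorm V where
  N x := M.N (x.map f)
  add_le x y := by
    rw [Matrix.map_add f f.map_add]; exact M.add_le _ _
  mul_le α x β := by
    rw [matMul_map]; exact M.mul_le _ _ _
  blocks_le x y := by
    rw [Matrix.fromBlocks_map]
    simpa using M.blocks_le (x.map f) (y.map f)

/-- The `ℓ^∞` combination of matrix seminorms on a product. -/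
def prod (M : MatNorm V) (M' : MatNorm W) : MatNorm (V × W) where
  N x := max (M.N (x.map Prod.fst)) (M'.N (x.map Prod.snd))
  add_le x y := by
    refine max_le ?_ ?_
    · exact (M.add_le (x.map Prod.fst) (y.map Prod.fst)).trans
        (add_le_add (le_max_left _ _) (le_max_left _ _))
    · exact (M'.add_le (x.map Prod.snd) (y.map Prod.snd)).trans
        (add_le_add (le_max_right _ _) (le_max_right _ _))
  mul_le α x β := by
    refine max_le ?_ ?_
    · refine ((M.comap (LinearMap.fst ℂ V W)).mul_le α x β).trans ?_
      gcongr
      · exact scalarNorm_nonneg _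
      · exact scalarNorm_nonneg _
      · exact le_max_left _ _
    · refine ((M'.comap (LinearMap.snd ℂ V W)).mul_le α x β).trans ?_
      gcongr
      · exact scalarNorm_nonneg _
      · exact scalarNorm_nonneg _
      · exact le_max_right _ _
  blocks_le x y := by
    refine max_le ?_ ?_
    · exact ((M.comap (LinearMap.fst ℂ V W)).blocks_le x y).trans
        (max_le_max (le_max_left _ _) (le_max_left _ _))
    · exact ((M'.comap (LinearMap.snd ℂ V W)).blocks_le x y).trans
        (max_le_max (le_max_right _ _) (le_max_right _ _))

end MatNorm

namespace OpSpace

/-- A Banach space that is isometrically embedded in an operator space inherits an operator space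
structure. -/
def comap (X : OpSpace.{v}) (V : Type u) [NormedAddCommGroup V] [NormedSpace ℂ V]
    [CompleteSpace V] (f : V →ₗᵢ[ℂ] X) : OpSpace.{u} :=
  ofMatNorm V (X.mn.comap f.toLinearMap) fun v => by
    rw [← f.norm_map, ← X.nrm_eq]; rfl

/-- A closed subspace of an operator space. -/
def ofSubmodule (X : OpSpace.{u}) (S : Submodule ℂ X) (hS : IsClosed (S : Set X)) : OpSpace.{u} :=
  have : CompleteSpace S := hS.completeSpace_coe
  X.comap S S.subtypeₗᵢ

/-- The `ℓ^∞` direct sum of two operator spaces. -/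
def prod (X : OpSpace.{u}) (Y : OpSpace.{v}) : OpSpace.{max u v} :=
  ofMatNorm (X × Y) (X.mn.prod Y.mn) fun v => by
    rw [Prod.norm_def, ← X.nrm_eq, ← Y.nrm_eq]; rfl

variable (X : OpSpace.{u}) {ι κ : Type} [Fintype ι] [Fintype κ]

lemma mnorm_comap (V : Type v) [NormedAddCommGroup V] [NormedSpace ℂ V]
    [CompleteSpace V] (f : V →ₗᵢ[ℂ] X) (x : Matrix ι ι V) :
    (X.comap V f).mnorm x = X.mnorm (x.map f) := ofMatNorm_mnorm _ _ _ _

end OpSpace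

/-! ## Completely bounded maps -/

section CB

variable (X : OpSpace.{u}) (Y : OpSpace.{v})

/-- `K` is a common bound for the norms of all amplifications `uₙ` of `u`. -/
def IsCBBound {X : OpSpace.{u}} {Y : OpSpace.{v}} (u : X →ₗ[ℂ] Y) (K : ℝ) : Prop :=
  0 ≤ K ∧ ∀ (n : ℕ) (x : Matrix (Fin n) (Fin n) X), Y.matNorm n (x.map u) ≤ K * X.matNorm n x

/-- The completely bounded norm `sup_n ‖uₙ‖`, as the least common bound. -/
def cbNorm {X : OpSpace.{u}} {Y : OpSpace.{v}} (u : X →ₗ[ℂ] Y) : ℝ := sInf {K | IsCBBound u K}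

/-- The matrix `[u_{ij}(x_{kl})]_{(k,i),(l,j)}`, i.e. the amplification of the map
`x ↦ [u_{ij}(x)]`. -/
def bigAmp {X : OpSpace.{u}} {Y : OpSpace.{v}} {ι κ : Type} (U : Matrix ι ι (X →ₗ[ℂ] Y))
    (x : Matrix κ κ X) : Matrix (κ × ι) (κ × ι) Y :=
  Matrix.of fun i j => U i.2 j.2 (x i.1 j.1)

/-- `K` is a bound for the completely bounded norm of the map `x ↦ [u_{ij}(x)]`. -/
def IsMatCBBound {X : OpSpace.{u}} {Y : OpSpace.{v}} {ι : Type} [Fintype ι]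
    (U : Matrix ι ι (X →ₗ[ℂ] Y)) (K : ℝ) : Prop :=
  0 ≤ K ∧ ∀ (n : ℕ) (x : Matrix (Fin n) (Fin n) X), Y.mnorm (bigAmp U x) ≤ K * X.matNorm n x

/-- The completely bounded norm of the map `x ↦ [u_{ij}(x)]`. -/
def matCBNorm {X : OpSpace.{u}} {Y : OpSpace.{v}} {ι : Type} [Fintype ι]
    (U : Matrix ι ι (X →ₗ[ℂ] Y)) : ℝ := sInf {K | IsMatCBBound U K}

variable {X Y} {ι κ τ : Type} [Fintype ι] [Fintype κ] [Fintype τ]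

lemma isMatCBBound_one (u : X →ₗ[ℂ] Y) (K : ℝ) :
    IsMatCBBound (Matrix.of fun _ _ : Unit => u) K ↔ IsCBBound u K := by
  refine and_congr_right fun _ => forall_congr' fun n => forall_congr' fun x => ?_
  have : Y.mnorm (bigAmp (Matrix.of fun _ _ : Unit => u) x) = Y.matNorm n (x.map u) := by
    rw [← OpSpace.mnorm_fin]
    exact Y.mn.N_submatrix_equiv (Equiv.prodPUnit (Fin n)) (x.map u)
  rw [this]

lemma matCBNorm_one (u : X →ₗ[ℂ] Y) :
    matCBNorm (Matrix.of fun _ _ : Unit => u) = cbNorm u := by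
  simp only [matCBNorm, cbNorm, isMatCBBound_one]

lemma IsMatCBBound.le {U : Matrix ι ι (X →ₗ[ℂ] Y)} {K : ℝ} (h : IsMatCBBound U K)
    (x : Matrix κ κ X) : Y.mnorm (bigAmp U x) ≤ K * X.mnorm x := by
  have h1 := h.2 _ (x.submatrix (Fintype.equivFin κ).symm (Fintype.equivFin κ).symm)
  rw [← OpSpace.mnorm_fin] at h1
  simp only [OpSpace.mnorm, X.mn.N_submatrix_equiv] at h1 ⊢
  rw [← Y.mn.N_submatrix_equiv ((Fintype.equivFin κ).symm.prodCongr (Equiv.refl ι))]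
  exact h1

lemma IsCBBound.le {u : X →ₗ[ℂ] Y} {K : ℝ} (h : IsCBBound u K)
    (x : Matrix κ κ X) : Y.mnorm (x.map u) ≤ K * X.mnorm x := by
  have h1 := h.2 _ (x.submatrix (Fintype.equivFin κ).symm (Fintype.equivFin κ).symm)
  exact h1

lemma IsMatCBBound.norm_le {U : Matrix ι ι (X →ₗ[ℂ] Y)} {K : ℝ} (h : IsMatCBBound U K) :
    matCBNorm U ≤ K := csInf_le ⟨0, fun _ h => h.1⟩ h

lemma matCBNorm_nonneg (U : Matrix ι ι (X →ₗ[ℂ] Y)) : 0 ≤ matCBNorm U :=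
  Real.sInf_nonneg fun _ h => h.1

lemma IsMatCBBound.self {U : Matrix ι ι (X →ₗ[ℂ] Y)} {K : ℝ} (h : IsMatCBBound U K) :
    IsMatCBBound U (matCBNorm U) := by
  refine ⟨matCBNorm_nonneg U, fun n x => ?_⟩
  rcases (X.matNorm_nonneg n x).eq_or_lt with h0 | h0
  · have := h.2 n x; rw [← h0] at this ⊢; simpa using this
  · rw [← div_le_iff₀ h0]
    exact le_csInf ⟨K, h⟩ fun K' h' => (div_le_iff₀ h0).2 (h'.2 n x)

lemma IsCBBound.norm_le {u : X →ₗ[ℂ] Y} {K : ℝ} (h : IsCBBound u K) : cbNorm u ≤ K :=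
  csInf_le ⟨0, fun _ h => h.1⟩ h

lemma IsCBBound.self {u : X →ₗ[ℂ] Y} {K : ℝ} (h : IsCBBound u K) : IsCBBound u (cbNorm u) := by
  rw [← matCBNorm_one, ← isMatCBBound_one]
  exact ((isMatCBBound_one u K).2 h).self

lemma IsMatCBBound.add {U V : Matrix ι ι (X →ₗ[ℂ] Y)} {K L : ℝ} (h : IsMatCBBound U K)
    (h' : IsMatCBBound V L) : IsMatCBBound (U + V) (K + L) := by
  refine ⟨add_nonneg h.1 h'.1, fun n x => ?_⟩
  rw [add_mul]
  exact (Y.mn.add_le (bigAmp U x) (bigAmp V x)).trans (add_le_add (h.2 n x) (h'.2 n x))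

lemma scalarNorm_one_kron_le {m n p : Type*} [Fintype m] [Fintype n] [Fintype p] [DecidableEq p]
    (α : Matrix m n ℂ) :
    scalarNorm (Matrix.of fun (i : p × m) (j : p × n) => if i.1 = j.1 then α i.2 j.2 else 0)
      ≤ scalarNorm α := by
  refine scalarNorm_le_of_sum_sq (scalarNorm_nonneg _) fun ξ => ?_
  rw [Fintype.sum_prod_type, Fintype.sum_prod_type, Finset.mul_sum]
  refine Finset.sum_le_sum fun k _ => ?_
  refine le_trans (le_of_eq ?_) (sum_sq_mulVec_le α fun j => ξ (k, j))
  refine Finset.sum_congr rfl fun i _ => ?_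
  congr 2
  simp [Matrix.mulVec, dotProduct, Fintype.sum_prod_type, ite_mul]

lemma scalarNorm_kron_one_le {m n p : Type*} [Fintype m] [Fintype n] [Fintype p] [DecidableEq p]
    (α : Matrix m n ℂ) :
    scalarNorm (Matrix.of fun (i : m × p) (j : n × p) => if i.2 = j.2 then α i.1 j.1 else 0)
      ≤ scalarNorm α := by
  refine le_trans (le_of_eq ?_) (scalarNorm_one_kron_le (p := p) α)
  rw [← scalarNorm_submatrix_equiv _ (Equiv.prodComm p m) (Equiv.prodComm p n)]
  rfl

lemma IsMatCBBound.mul {U : Matrix ι ι (X →ₗ[ℂ] Y)} {K : ℝ} (h : IsMatCBBound U K)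
    (α : Matrix κ ι ℂ) (β : Matrix ι κ ℂ) :
    IsMatCBBound (matMul α U β) (scalarNorm α * K * scalarNorm β) := by
  have := scalarNorm_nonneg α
  have := scalarNorm_nonneg β
  have := h.1
  refine ⟨by positivity, fun n x => ?_⟩
  have h1 : bigAmp (matMul α U β) x = matMul
      (Matrix.of fun (i : Fin n × κ) (j : Fin n × ι) => if i.1 = j.1 then α i.2 j.2 else 0)
      (bigAmp U x)
      (Matrix.of fun (i : Fin n × ι) (j : Fin n × κ) => if i.1 = j.1 then β i.2 j.2 else 0) := by
    ext ⟨a, b⟩ ⟨c, d⟩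
    simp [bigAmp, matMul, Fintype.sum_prod_type, ite_smul]
  rw [h1]
  refine (Y.mn.mul_le _ _ _).trans ?_
  have h2 := scalarNorm_one_kron_le (p := Fin n) α
  have h3 := scalarNorm_one_kron_le (p := Fin n) β
  have h4 := h.2 n x
  have h5 := Y.mn.N_nonneg (bigAmp U x)
  have h6 := X.matNorm_nonneg n x
  calc _ ≤ scalarNorm α * (K * X.matNorm n x) * scalarNorm β := by
        gcongr
        · exact scalarNorm_nonneg _
        · exact h4
    _ = _ := by ring

lemma IsMatCBBound.blocks {U : Matrix ι ι (X →ₗ[ℂ] Y)} {V : Matrix κ κ (X →ₗ[ℂ] Y)} {K L : ℝ}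
    (h : IsMatCBBound U K) (h' : IsMatCBBound V L) :
    IsMatCBBound (Matrix.fromBlocks U 0 0 V) (max K L) := by
  refine ⟨le_max_of_le_left h.1, fun n x => ?_⟩
  have h1 : bigAmp (Matrix.fromBlocks U 0 0 V) x
      = (Matrix.fromBlocks (bigAmp U x) 0 0 (bigAmp V x)).submatrix
        (Equiv.prodSumDistrib (Fin n) ι κ) (Equiv.prodSumDistrib (Fin n) ι κ) := by
    ext ⟨a, b | b⟩ ⟨c, d | d⟩ <;> simp [bigAmp]
  have h6 := X.matNorm_nonneg n x
  rw [OpSpace.mnorm, h1, Y.mn.N_submatrix_equiv]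
  refine (Y.mn.blocks_le _ _).trans (max_le ?_ ?_)
  · exact (h.2 n x).trans (by gcongr; exact le_max_left _ _)
  · exact (h'.2 n x).trans (by gcongr; exact le_max_right _ _)

lemma isMatCBBound_of_entries (U : Matrix ι ι (X →ₗ[ℂ] Y)) (K : ι → ι → ℝ)
    (h : ∀ i j, IsCBBound (U i j) (K i j)) : IsMatCBBound U (∑ i, ∑ j, K i j) := by
  refine ⟨Finset.sum_nonneg fun i _ => Finset.sum_nonneg fun j _ => (h i j).1, fun n x => ?_⟩
  refine (Y.mn.N_le_sum_blocks _).trans ?_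
  simp only [Finset.sum_mul]
  refine Finset.sum_le_sum fun i _ => Finset.sum_le_sum fun j _ => ?_
  have := (h i j).2 n x
  rwa [← OpSpace.mnorm_fin] at this

variable (X Y)

/-- The space of completely bounded maps. -/
def cbSubmodule : Submodule ℂ (X →ₗ[ℂ] Y) where
  carrier := {u | ∃ K, IsCBBound u K}
  add_mem' := by
    rintro a b ⟨K, hK⟩ ⟨L, hL⟩
    rw [← isMatCBBound_one] at hK hL
    exact ⟨K + L, (isMatCBBound_one _ _).1 (hK.add hL)⟩
  zero_mem' := ⟨0, le_rfl, fun n x => by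
    have h : x.map (0 : X →ₗ[ℂ] Y) = 0 := by ext; simp
    rw [h, ← OpSpace.mnorm_fin, OpSpace.mnorm, MatNorm.N_zero, zero_mul]⟩
  smul_mem' := by
    rintro c a ⟨K, hK⟩
    refine ⟨‖c‖ * K, mul_nonneg (norm_nonneg _) hK.1, fun n x => ?_⟩
    have h : x.map (c • a) = c • x.map a := by ext; simp
    rw [h, Y.matNorm_smul, mul_assoc]
    exact mul_le_mul_of_nonneg_left (hK.2 n x) (norm_nonneg _)

/-- Completely bounded maps between operator spaces. -/
abbrev CB : Type (max u v) := cbSubmodule X Y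

variable {X Y}

lemma CB.isCBBound (u : CB X Y) : IsCBBound (u : X →ₗ[ℂ] Y) (cbNorm (u : X →ₗ[ℂ] Y)) :=
  u.2.choose_spec.self

lemma CB.isMatCBBound (U : Matrix ι ι (CB X Y)) :
    IsMatCBBound (U.map (cbSubmodule X Y).subtype)
      (matCBNorm (U.map (cbSubmodule X Y).subtype)) :=
  (isMatCBBound_of_entries _ _ fun i j => (U i j).isCBBound).self

variable (X Y)

/-- The matrix norms on `CB(X, Y)` given by `Mₙ(CB(X, Y)) = CB(X, Mₙ(Y))`. -/
def cbMatNorm : MatNorm (CB X Y) where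
  N U := matCBNorm (U.map (cbSubmodule X Y).subtype)
  add_le U V := ((CB.isMatCBBound U).add (CB.isMatCBBound V)).norm_le
  mul_le α U β := by
    rw [MatNorm.matMul_map]
    exact ((CB.isMatCBBound U).mul α β).norm_le
  blocks_le U V := by
    have := ((CB.isMatCBBound U).blocks (CB.isMatCBBound V)).norm_le
    rwa [Matrix.fromBlocks_map, Matrix.map_zero _ (map_zero _), Matrix.map_zero _ (map_zero _)]

variable {X Y}

lemma cbMatNorm_nrm (u : CB X Y) : (cbMatNorm X Y).nrm u = cbNorm (u : X →ₗ[ℂ] Y) := by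
  rw [← matCBNorm_one]
  simp only [MatNorm.nrm, cbMatNorm]
  congr 1

lemma CB.le (u : CB X Y) (x : X) : ‖(u : X →ₗ[ℂ] Y) x‖ ≤ cbNorm (u : X →ₗ[ℂ] Y) * ‖x‖ := by
  have := u.isCBBound.2 1 (Matrix.of fun _ _ => x)
  rw [X.matNorm_one] at this
  rw [← Y.matNorm_one]
  exact this

variable (X Y)

instance : NormedAddCommGroup (CB X Y) :=
  AddGroupNorm.toNormedAddCommGroup
    { toFun := fun u => cbNorm (u : X →ₗ[ℂ] Y)
      map_zero' := by
        rw [← cbMatNorm_nrm]; exact MatNorm.N_zero _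
      add_le' := fun u v => by
        simp only [← cbMatNorm_nrm]; exact MatNorm.add_le _ _ _
      neg' := fun u => by
        simp only [← cbMatNorm_nrm]; exact MatNorm.N_neg _ _
      eq_zero_of_map_eq_zero' := fun u hu => by
        ext x
        have := u.le x
        rw [hu, zero_mul] at this
        simpa using this }

lemma CB.norm_def (u : CB X Y) : ‖u‖ = cbNorm (u : X →ₗ[ℂ] Y) := rfl

instance : NormedSpace ℂ (CB X Y) where
  norm_smul_le c u := by
    rw [CB.norm_def, CB.norm_def, ← cbMatNorm_nrm, ← cbMatNorm_nrm]
    exact (MatNorm.N_smul (cbMatNorm X Y) c (Matrix.of fun _ _ : Unit => u)).le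

lemma OpSpace.tendsto_mnorm {F : Type*} {l : Filter F} {f : F → Matrix ι ι X} {x : Matrix ι ι X}
    (h : ∀ i j, Filter.Tendsto (fun t => f t i j) l (nhds (x i j))) :
    Filter.Tendsto (fun t => X.mnorm (f t)) l (nhds (X.mnorm x)) := by
  rw [tendsto_iff_norm_sub_tendsto_zero]
  have h0 : Filter.Tendsto (fun t => ∑ i, ∑ j, ‖f t i j - x i j‖) l (nhds 0) := by
    rw [show (0 : ℝ) = ∑ i : ι, ∑ j : ι, 0 by simp]
    exact tendsto_finsetSum _ fun i _ => tendsto_finsetSum _ fun j _ =>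
      tendsto_iff_norm_sub_tendsto_zero.1 (h i j)
  refine squeeze_zero (fun _ => norm_nonneg _) (fun t => ?_) h0
  refine (X.mn.abs_N_sub_le _ _).trans ((X.mn.N_le_sum _).trans (le_of_eq ?_))
  simp only [OpSpace.nrm_eq, Matrix.sub_apply]

instance : CompleteSpace (CB X Y) := by
  refine Metric.complete_of_cauchySeq_tendsto fun u hu => ?_
  have hp : ∀ x : X, CauchySeq fun k => (u k : X →ₗ[ℂ] Y) x := by
    intro x
    rw [Metric.cauchySeq_iff] at hu ⊢
    intro ε hε
    obtain ⟨N, hN⟩ := hu (ε / (‖x‖ + 1)) (by positivity)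
    refine ⟨N, fun m hm n hn => ?_⟩
    have h1 := hN m hm n hn
    rw [dist_eq_norm, CB.norm_def] at h1
    have h2 := CB.le (u m - u n) x
    rw [dist_eq_norm]
    calc ‖(u m : X →ₗ[ℂ] Y) x - (u n : X →ₗ[ℂ] Y) x‖
        ≤ cbNorm ((u m - u n : CB X Y) : X →ₗ[ℂ] Y) * ‖x‖ := h2
      _ ≤ ε / (‖x‖ + 1) * ‖x‖ := by gcongr
      _ < ε / (‖x‖ + 1) * (‖x‖ + 1) := by gcongr; linarith
      _ = ε := by field_simp
  choose f hf using fun x => cauchySeq_tendsto_of_complete (hp x)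
  let g : X →ₗ[ℂ] Y :=
    { toFun := f
      map_add' := fun x y => tendsto_nhds_unique (hf (x + y)) (by
        simpa using (hf x).add (hf y))
      map_smul' := fun c x => tendsto_nhds_unique (hf (c • x)) (by
        simpa using (hf x).const_smul c) }
  have key : ∀ ε > 0, ∃ N, ∀ m ≥ N, IsCBBound ((u m : X →ₗ[ℂ] Y) - g) ε := by
    intro ε hε
    obtain ⟨N, hN⟩ := Metric.cauchySeq_iff.1 hu ε hε
    refine ⟨N, fun m hm => ⟨hε.le, fun n x => ?_⟩⟩
    rw [← OpSpace.mnorm_fin, ← OpSpace.mnorm_fin]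
    have h1 : Filter.Tendsto (fun k => Y.mnorm (x.map ((u m - u k : CB X Y) : X →ₗ[ℂ] Y)))
        Filter.atTop (nhds (Y.mnorm (x.map ((u m : X →ₗ[ℂ] Y) - g)))) := by
      refine Y.tendsto_mnorm fun i j => ?_
      exact tendsto_const_nhds.sub (hf (x i j))
    refine le_of_tendsto h1 (Filter.eventually_atTop.2 ⟨N, fun k hk => ?_⟩)
    have h2 := hN m hm k hk
    rw [dist_eq_norm, CB.norm_def] at h2
    exact ((u m - u k).isCBBound.le x).trans
      (mul_le_mul_of_nonneg_right h2.le (X.mn.N_nonneg x))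
  obtain ⟨N, hN⟩ := key 1 one_pos
  have hg : g ∈ cbSubmodule X Y := by
    have : g = (u N : X →ₗ[ℂ] Y) - ((u N : X →ₗ[ℂ] Y) - g) := by abel
    rw [this]
    exact (cbSubmodule X Y).sub_mem (u N).2 ⟨1, hN N le_rfl⟩
  refine ⟨⟨g, hg⟩, ?_⟩
  rw [Metric.tendsto_atTop]
  intro ε hε
  obtain ⟨N, hN⟩ := key (ε / 2) (half_pos hε)
  refine ⟨N, fun m hm => ?_⟩
  rw [dist_eq_norm, CB.norm_def]
  exact lt_of_le_of_lt (hN m hm).norm_le (half_lt_self hε)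

/-- The operator space `CB(X, Y)`. -/
def OpSpace.cb : OpSpace.{max u v} :=
  OpSpace.ofMatNorm (CB X Y) (cbMatNorm X Y) fun u => cbMatNorm_nrm u

variable {X Y}

lemma OpSpace.cb_mnorm (U : Matrix ι ι (CB X Y)) :
    (OpSpace.cb X Y).mnorm U = matCBNorm (U.map (cbSubmodule X Y).subtype) :=
  OpSpace.ofMatNorm_mnorm _ _ _ _

end CB

/-! ## Complete contractions -/

/-- Linear complete contractions between operator spaces. -/
@[ext]
structure CCMap (X : OpSpace.{u}) (Y : OpSpace.{v}) where
  toLinearMap : X →ₗ[ℂ] Y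
  contractive : ∀ (n : ℕ) (x : Matrix (Fin n) (Fin n) X),
    Y.matNorm n (x.map toLinearMap) ≤ X.matNorm n x

namespace CCMap

variable {X : OpSpace.{u}} {Y : OpSpace.{v}} {Z : OpSpace.{w}}

instance : CoeFun (CCMap X Y) fun _ => X → Y := ⟨fun f => f.toLinearMap⟩

/-- The identity. -/
def id (X : OpSpace.{u}) : CCMap X X := ⟨LinearMap.id, fun _ _ => le_rfl⟩

/-- Composition of complete contractions. -/
def comp (g : CCMap Y Z) (f : CCMap X Y) : CCMap X Z :=
  ⟨g.toLinearMap ∘ₗ f.toLinearMap, fun n x =>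
    (g.contractive n (x.map f)).trans (f.contractive n x)⟩

/-- A completely isometric isomorphism is a surjective map all of whose amplifications are
isometric. -/
def IsCompletelyIsometricIso (f : CCMap X Y) : Prop :=
  Function.Surjective f ∧
    ∀ (n : ℕ) (x : Matrix (Fin n) (Fin n) X), Y.matNorm n (x.map f) = X.matNorm n x

lemma isCBBound (f : CCMap X Y) : IsCBBound f.toLinearMap 1 :=
  ⟨zero_le_one, fun n x => by rw [one_mul]; exact f.contractive n x⟩

lemma mnorm_le {ι : Type} [Fintype ι] (f : CCMap X Y) (x : Matrix ι ι X) :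
    Y.mnorm (x.map f) ≤ X.mnorm x := by
  simpa using f.isCBBound.le x

lemma norm_le (f : CCMap X Y) (x : X) : ‖f x‖ ≤ ‖x‖ := by
  rw [← X.matNorm_one, ← Y.matNorm_one]
  exact f.contractive 1 _

lemma continuous (f : CCMap X Y) : Continuous f :=
  AddMonoidHomClass.continuous_of_bound f.toLinearMap 1 fun x => by simpa using f.norm_le x

end CCMap

/-! ## The operator spaces `ℂ` and `B(H)` -/

lemma matMul_complex {m n p q : Type*} [Fintype m] [Fintype n] [Fintype p] [Fintype q]
    (α : Matrix m p ℂ) (x : Matrix p q ℂ) (β : Matrix q n ℂ) : matMul α x β = α * x * β := by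
  ext i j
  simp only [matMul, Matrix.mul_apply, smul_eq_mul, Finset.sum_mul]
  rw [Finset.sum_comm]
  exact Finset.sum_congr rfl fun _ _ => Finset.sum_congr rfl fun _ _ => by ring

lemma scalarNorm_add_le {m n : Type*} [Fintype m] [Fintype n] (α β : Matrix m n ℂ) :
    scalarNorm (α + β) ≤ scalarNorm α + scalarNorm β := by
  classical
  open scoped Matrix.Norms.L2Operator in
  unfold scalarNorm; exact norm_add_le α β

/-- The matrix norms of `ℂ`: the operator norms of complex matrices. -/
def complexMatNorm : MatNorm ℂ where
  N x := scalarNorm x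
  add_le x y := scalarNorm_add_le x y
  mul_le α x β := by
    rw [matMul_complex]
    exact (scalarNorm_mul_le _ _).trans
      (mul_le_mul_of_nonneg_right (scalarNorm_mul_le _ _) (scalarNorm_nonneg _))
  blocks_le x y := scalarNorm_fromBlocks_le x y

/-- The operator space `ℂ`, with `Mₙ(ℂ) = B(ℂⁿ)`. -/
def OpSpace.complex : OpSpace.{0} :=
  OpSpace.ofMatNorm ℂ complexMatNorm fun c => by
    refine le_antisymm ?_ (norm_entry_le (Matrix.of fun _ _ : Unit => c) () ())
    have : (Matrix.of fun _ _ : Unit => c) = c • (1 : Matrix Unit Unit ℂ) := by ext; simp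
    rw [MatNorm.nrm, this]
    exact scalarNorm_smul_one_le c

section BH

variable (H : Type u) [NormedAddCommGroup H] [InnerProductSpace ℂ H]

variable {H} {ι κ : Type} [Fintype ι] [Fintype κ]

/-- The operator on the Hilbert space direct sum `H^{⊕ι}` given by a matrix of operators. -/
def opMat {ι : Type} [Fintype ι] (A : Matrix ι ι (H →L[ℂ] H)) :
    PiLp 2 (fun _ : ι => H) →L[ℂ] PiLp 2 (fun _ : ι => H) :=
  (PiLp.continuousLinearEquiv 2 ℂ (fun _ : ι => H)).symm.toContinuousLinearMap ∘L
    ContinuousLinearMap.pi fun i => ∑ j, A i j ∘L PiLp.proj 2 (fun _ : ι => H) j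

lemma opMat_apply (A : Matrix ι ι (H →L[ℂ] H)) (ξ : PiLp 2 (fun _ : ι => H)) (i : ι) :
    opMat A ξ i = ∑ j, A i j (ξ j) := by
  simp [opMat]

lemma opMat_sq_le (A : Matrix ι ι (H →L[ℂ] H)) (ξ : ι → H) :
    ∑ i, ‖∑ j, A i j (ξ j)‖ ^ 2 ≤ ‖opMat A‖ ^ 2 * ∑ j, ‖ξ j‖ ^ 2 := by
  have h := pow_le_pow_left₀ (norm_nonneg _) ((opMat A).le_opNorm (WithLp.toLp 2 ξ)) 2
  rw [mul_pow, PiLp.norm_sq_eq_of_L2, PiLp.norm_sq_eq_of_L2] at h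
  simpa only [opMat_apply] using h

lemma norm_opMat_le {A : Matrix ι ι (H →L[ℂ] H)} {C : ℝ} (hC : 0 ≤ C)
    (h : ∀ ξ : ι → H, ∑ i, ‖∑ j, A i j (ξ j)‖ ^ 2 ≤ C ^ 2 * ∑ j, ‖ξ j‖ ^ 2) :
    ‖opMat A‖ ≤ C := by
  refine ContinuousLinearMap.opNorm_le_bound _ hC fun ξ => ?_
  refine le_of_sq_le_sq ?_ (by positivity)
  rw [mul_pow, PiLp.norm_sq_eq_of_L2, PiLp.norm_sq_eq_of_L2]
  simpa only [opMat_apply] using h ξ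

lemma sum_sq_smul_le {m n : Type*} [Fintype m] [Fintype n] (α : Matrix m n ℂ) (ξ : n → H) :
    ∑ i, ‖∑ j, α i j • ξ j‖ ^ 2 ≤ scalarNorm α ^ 2 * ∑ j, ‖ξ j‖ ^ 2 := by
  let S : Submodule ℂ H := Submodule.span ℂ (Set.range ξ)
  have : FiniteDimensional ℂ S := FiniteDimensional.span_of_finite ℂ (Set.finite_range ξ)
  let η : n → S := fun j => ⟨ξ j, Submodule.subset_span ⟨j, rfl⟩⟩
  let b := stdOrthonormalBasis ℂ S
  have h1 : ∀ i, ‖∑ j, α i j • ξ j‖ = ‖∑ j, α i j • η j‖ := fun i => by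
    rw [← Submodule.norm_coe]; simp [η]
  have h2 : ∀ j, ‖ξ j‖ = ‖η j‖ := fun j => rfl
  simp only [h1, h2, ← b.sum_sq_norm_inner_right]
  rw [Finset.sum_comm, Finset.sum_comm (s := (Finset.univ : Finset n)), Finset.mul_sum]
  refine Finset.sum_le_sum fun k _ => ?_
  refine le_trans (le_of_eq ?_) (sum_sq_mulVec_le α fun j => ⟪b k, η j⟫_ℂ)
  refine Finset.sum_congr rfl fun i _ => ?_
  simp [Matrix.mulVec, dotProduct, inner_sum, inner_smul_right]

variable (H)

/-- The matrix norms of `B(H)`, given by `Mₙ(B(H)) = B(H^{⊕n})`. -/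
def bhMatNorm : MatNorm (H →L[ℂ] H) where
  N A := ‖opMat A‖
  add_le A B := by
    have : opMat (A + B) = opMat A + opMat B := by
      ext ξ i; simp [opMat_apply, Finset.sum_add_distrib]
    rw [this]; exact norm_add_le (opMat A) (opMat B)
  mul_le {ι κ} _ _ α A β := by
    have h0 := scalarNorm_nonneg α
    have h0' := scalarNorm_nonneg β
    refine norm_opMat_le (by positivity) fun ξ => ?_
    have h1 := sum_sq_smul_le β ξ
    have h2 := opMat_sq_le A fun k => ∑ j, β k j • ξ j
    have h3 := sum_sq_smul_le α fun i => ∑ k, A i k (∑ j, β k j • ξ j)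
    have h4 : ∀ i, ∑ j, (matMul α A β) i j (ξ j)
        = ∑ l, α i l • ∑ k, A l k (∑ j, β k j • ξ j) := fun i => by
      simp only [matMul, sum_apply, smul_apply, map_sum,
        map_smul, Finset.smul_sum, smul_smul]
      rw [Finset.sum_comm]
      refine Finset.sum_congr rfl fun l _ => ?_
      rw [Finset.sum_comm]
    simp only [h4]
    calc _ ≤ _ := h3
      _ ≤ scalarNorm α ^ 2 * (‖opMat A‖ ^ 2 * (scalarNorm β ^ 2 * ∑ j, ‖ξ j‖ ^ 2)) := by
          gcongr
          exact h2.trans (by gcongr)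
      _ = _ := by ring
  blocks_le A B := by
    refine norm_opMat_le (le_max_of_le_left (norm_nonneg (opMat A))) fun ξ => ?_
    have h1 := opMat_sq_le A fun i => ξ (Sum.inl i)
    have h2 := opMat_sq_le B fun i => ξ (Sum.inr i)
    simp only [Fintype.sum_sum_type, Matrix.fromBlocks_apply₁₁, Matrix.fromBlocks_apply₁₂,
      Matrix.fromBlocks_apply₂₁, Matrix.fromBlocks_apply₂₂, Matrix.zero_apply,
      zero_apply, Finset.sum_const_zero, add_zero, zero_add, mul_add]
    refine add_le_add (h1.trans ?_) (h2.trans ?_)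
    · gcongr; exact le_max_left _ _
    · gcongr; exact le_max_right _ _

/-- The operator space `B(H)` of bounded operators on a Hilbert space. -/
def OpSpace.B [CompleteSpace H] : OpSpace.{u} :=
  OpSpace.ofMatNorm (H →L[ℂ] H) (bhMatNorm H) fun T => by
    have h : ∀ ξ : Unit → H, ∑ i : Unit, ‖∑ j : Unit, (Matrix.of fun _ _ : Unit => T) i j (ξ j)‖ ^ 2
        = ‖T (ξ ())‖ ^ 2 := fun ξ => by simp
    have hs : ∀ f : Unit → ℝ, ∑ j : Unit, f j = f () := fun f => by simp
    refine le_antisymm (norm_opMat_le (norm_nonneg T) fun ξ => ?_) ?_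
    · rw [h, hs, ← mul_pow]
      exact pow_le_pow_left₀ (norm_nonneg _) (T.le_opNorm _) 2
    · change ‖T‖ ≤ ‖opMat (Matrix.of fun _ _ : Unit => T)‖
      refine ContinuousLinearMap.opNorm_le_bound _ (norm_nonneg _) fun x => ?_
      have := opMat_sq_le (Matrix.of fun _ _ : Unit => T) fun _ => x
      rw [h, hs, ← mul_pow] at this
      exact le_of_sq_le_sq this (by positivity)

end BH

/-! ## Completion of matrix seminorms -/

section Completion

open UniformSpace Filter Topology

variable {V : Type u} [SeminormedAddCommGroup V] [NormedSpace ℂ V] (M : MatNorm V)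
  {ι κ : Type} [Fintype ι] [Fintype κ]

namespace MatNorm

/-- The continuous extension of the seminorms of `M` to the matrices over the completion. -/
def complN (A : Matrix ι ι (Completion V)) : ℝ :=
  limUnder (Filter.comap (fun v : Matrix ι ι V => v.map ((↑) : V → Completion V)) (𝓝 A)) M.N

/-- The entrywise distance. -/
def complDist (v : Matrix ι ι V) (A : Matrix ι ι (Completion V)) : ℝ :=
  ∑ i, ∑ j, ‖(v i j : Completion V) - A i j‖

lemma complDist_nonneg (v : Matrix ι ι V) (A : Matrix ι ι (Completion V)) : 0 ≤ complDist v A :=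
  Finset.sum_nonneg fun _ _ => Finset.sum_nonneg fun _ _ => norm_nonneg _

lemma N_le_add_complDist (h : ∀ v, M.nrm v = ‖v‖) (v w : Matrix ι ι V)
    (A : Matrix ι ι (Completion V)) :
    M.N v ≤ M.N w + (complDist v A + complDist w A) := by
  have h1 := M.add_le (v - w) w
  rw [sub_add_cancel] at h1
  have h2 := M.N_le_sum (v - w)
  simp only [h] at h2
  have h3 : ∑ i, ∑ j, ‖(v - w) i j‖ ≤ complDist v A + complDist w A := by
    simp only [complDist, ← Finset.sum_add_distrib]
    refine Finset.sum_le_sum fun i _ => Finset.sum_le_sum fun j _ => ?_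
    rw [← Completion.norm_coe, Matrix.sub_apply, Completion.coe_sub]
    have := norm_sub_le ((v i j : Completion V) - A i j) ((w i j : Completion V) - A i j)
    rwa [sub_sub_sub_cancel_right] at this
  linarith

/-- Auxiliary formula for the extended seminorm. -/
def complInf (A : Matrix ι ι (Completion V)) : ℝ :=
  ⨅ v : Matrix ι ι V, (M.N v + complDist v A)

lemma abs_sub_complInf_le (h : ∀ v, M.nrm v = ‖v‖) (v : Matrix ι ι V)
    (A : Matrix ι ι (Completion V)) : |M.N v - M.complInf A| ≤ complDist v A := by
  rw [abs_sub_le_iff]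
  constructor
  · have : M.N v - complDist v A ≤ M.complInf A := le_ciInf fun w => by
      have := M.N_le_add_complDist h v w A; linarith
    linarith
  · have : M.complInf A ≤ M.N v + complDist v A :=
      ciInf_le ⟨0, by rintro _ ⟨w, rfl⟩; exact add_nonneg (M.N_nonneg w) (complDist_nonneg w A)⟩ v
    linarith

lemma tendsto_complDist {F : Type*} {l : Filter F} {f : F → Matrix ι ι V}
    {A : Matrix ι ι (Completion V)}
    (hf : ∀ i j, Tendsto (fun t => (f t i j : Completion V)) l (𝓝 (A i j))) :
    Tendsto (fun t => complDist (f t) A) l (𝓝 0) := by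
  rw [show (0 : ℝ) = ∑ i : ι, ∑ j : ι, 0 by simp]
  exact tendsto_finsetSum _ fun i _ => tendsto_finsetSum _ fun j _ =>
    tendsto_iff_norm_sub_tendsto_zero.1 (hf i j)

lemma tendsto_complInf (h : ∀ v, M.nrm v = ‖v‖) {F : Type*} {l : Filter F}
    {f : F → Matrix ι ι V} {A : Matrix ι ι (Completion V)}
    (hf : ∀ i j, Tendsto (fun t => (f t i j : Completion V)) l (𝓝 (A i j))) :
    Tendsto (fun t => M.N (f t)) l (𝓝 (M.complInf A)) := by
  rw [tendsto_iff_norm_sub_tendsto_zero]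
  exact squeeze_zero (fun _ => norm_nonneg _) (fun t => M.abs_sub_complInf_le h (f t) A)
    (tendsto_complDist hf)

lemma exists_seq (A : Matrix ι ι (Completion V)) : ∃ f : ℕ → Matrix ι ι V,
    ∀ i j, Tendsto (fun t => (f t i j : Completion V)) atTop (𝓝 (A i j)) := by
  have h1 : ∀ a : Completion V, ∃ g : ℕ → V, Tendsto (fun t => (g t : Completion V)) atTop (𝓝 a) :=
    fun a => by
      obtain ⟨x, hx, hx'⟩ := mem_closure_iff_seq_limit.1
        ((Completion.denseRange_coe (α := V)).closure_range ▸ Set.mem_univ a)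
      choose g hg using hx
      exact ⟨g, by simpa only [hg] using hx'⟩
  choose g hg using fun i j => h1 (A i j)
  exact ⟨fun t => Matrix.of fun i j => g i j t, fun i j => hg i j⟩

lemma complN_eq (h : ∀ v, M.nrm v = ‖v‖) (A : Matrix ι ι (Completion V)) :
    M.complN A = M.complInf A := by
  obtain ⟨f, hf⟩ := exists_seq A
  have hf' : Tendsto (fun t => (f t).map ((↑) : V → Completion V)) atTop (𝓝 A) :=
    tendsto_pi_nhds.2 fun i => tendsto_pi_nhds.2 fun j => hf i j
  have : (Filter.comap (fun v : Matrix ι ι V => v.map ((↑) : V → Completion V)) (𝓝 A)).NeBot := by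
    refine comap_neBot fun t ht => ?_
    obtain ⟨k, hk⟩ := (hf'.eventually ht).exists
    exact ⟨f k, hk⟩
  refine Tendsto.limUnder_eq (M.tendsto_complInf h (f := fun v => v) fun i j => ?_)
  exact ((continuous_apply_apply i j).tendsto A).comp
    (tendsto_comap (f := fun v : Matrix ι ι V => v.map ((↑) : V → Completion V)))

lemma tendsto_complN (h : ∀ v, M.nrm v = ‖v‖) {F : Type*} {l : Filter F}
    {f : F → Matrix ι ι V} {A : Matrix ι ι (Completion V)}
    (hf : ∀ i j, Tendsto (fun t => (f t i j : Completion V)) l (𝓝 (A i j))) :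
    Tendsto (fun t => M.N (f t)) l (𝓝 (M.complN A)) := by
  rw [M.complN_eq h]; exact M.tendsto_complInf h hf

lemma complN_coe (h : ∀ v, M.nrm v = ‖v‖) (v : Matrix ι ι V) :
    M.complN (v.map ((↑) : V → Completion V)) = M.N v :=
  tendsto_nhds_unique
    (M.tendsto_complN h (l := (atTop : Filter ℕ)) (f := fun _ => v) fun _ _ => tendsto_const_nhds)
    tendsto_const_nhds

/-- The extension of matrix seminorms to the completion. -/
def completion (h : ∀ v, M.nrm v = ‖v‖) : MatNorm (Completion V) where
  N A := M.complN A
  add_le A B := by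
    obtain ⟨f, hf⟩ := exists_seq A
    obtain ⟨g, hg⟩ := exists_seq B
    refine le_of_tendsto_of_tendsto' (M.tendsto_complN h (f := fun t => f t + g t) fun i j => ?_)
      ((M.tendsto_complN h hf).add (M.tendsto_complN h hg)) fun t => M.add_le _ _
    simpa only [Matrix.add_apply, Completion.coe_add] using (hf i j).add (hg i j)
  mul_le α A β := by
    obtain ⟨f, hf⟩ := exists_seq A
    refine le_of_tendsto_of_tendsto'
      (M.tendsto_complN h (f := fun t => matMul α (f t) β) fun i j => ?_)
      (((M.tendsto_complN h hf).const_mul _).mul_const _) fun t => M.mul_le _ _ _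
    have : ∀ t, ((matMul α (f t) β i j : V) : Completion V)
        = ∑ k, ∑ l, (α i k * β l j) • (f t k l : Completion V) := fun t => by
      change (Completion.toComplL (𝕜 := ℂ) (matMul α (f t) β i j)) = _
      simp [matMul]
    simp only [this]
    exact tendsto_finsetSum _ fun k _ => tendsto_finsetSum _ fun l _ => (hf k l).const_smul _
  blocks_le A B := by
    obtain ⟨f, hf⟩ := exists_seq A
    obtain ⟨g, hg⟩ := exists_seq B
    refine le_of_tendsto_of_tendsto'
      (M.tendsto_complN h (f := fun t => Matrix.fromBlocks (f t) 0 0 (g t)) fun i j => ?_)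
      ((M.tendsto_complN h hf).max (M.tendsto_complN h hg)) fun t => M.blocks_le _ _
    rcases i with i | i <;> rcases j with j | j <;>
      simp [hf, hg, Completion.coe_zero]

lemma completion_nrm (h : ∀ v, M.nrm v = ‖v‖) (A : Completion V) :
    (M.completion h).nrm A = ‖A‖ := by
  obtain ⟨f, hf⟩ := exists_seq (Matrix.of fun _ _ : Unit => A)
  refine tendsto_nhds_unique (M.tendsto_complN h hf) ?_
  have h1 : ∀ t, M.N (f t) = ‖((f t () () : V) : Completion V)‖ := fun t => by
    rw [Completion.norm_coe, ← h]; rfl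
  simp only [h1]
  exact (hf () ()).norm

end MatNorm

/-- The operator space obtained by completing a space with Ruan matrix seminorms. -/
def OpSpace.completion (h : ∀ v, M.nrm v = ‖v‖) : OpSpace.{u} :=
  OpSpace.ofMatNorm (Completion V) (M.completion h) (M.completion_nrm h)

/-- The extension of a map to the completion. -/
lemma completion_lift (h : ∀ v, M.nrm v = ‖v‖) {Z : OpSpace.{v}} (f : V →ₗ[ℂ] Z)
    (hf : ∀ (n : ℕ) (x : Matrix (Fin n) (Fin n) V), Z.matNorm n (x.map f) ≤ M.N x) :
    ∃ g : CCMap (OpSpace.completion M h) Z, ∀ x : V, g.toLinearMap (x : Completion V) = f x := by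
  have hb : ∀ x, ‖f x‖ ≤ 1 * ‖x‖ := fun x => by
    rw [one_mul, ← h, ← Z.matNorm_one, MatNorm.nrm,
      ← M.N_submatrix_equiv (Equiv.equivPUnit (Fin 1)) (Matrix.of fun _ _ : Unit => x)]
    exact hf 1 (Matrix.of fun _ _ => x)
  let F : V →L[ℂ] Z := f.mkContinuous 1 hb
  have hd : DenseRange (Completion.toComplL (𝕜 := ℂ) (E := V)) := Completion.denseRange_coe
  have hu : IsUniformInducing (Completion.toComplL (𝕜 := ℂ) (E := V)) :=
    Completion.isUniformInducing_coe V
  let G : Completion V →L[ℂ] Z := F.extend (Completion.toComplL (𝕜 := ℂ) (E := V))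
  have hG : ∀ x : V, G (x : Completion V) = f x := fun x => F.extend_eq hd hu x
  refine ⟨⟨G.toLinearMap, fun n A => ?_⟩, hG⟩
  obtain ⟨s, hs⟩ := MatNorm.exists_seq (V := V) A
  have h1 : Tendsto (fun t => Z.mnorm ((s t).map f)) atTop (𝓝 (Z.mnorm (A.map G))) := by
    refine Z.tendsto_mnorm fun i j => ?_
    have := (G.continuous.tendsto (A i j)).comp (hs i j)
    simp only [Function.comp_def, hG] at this
    exact this
  rw [OpSpace.mnorm_fin] at h1
  exact le_of_tendsto_of_tendsto' h1 (M.tendsto_complN h hs) fun t => by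
    rw [OpSpace.mnorm_fin]; exact hf n (s t)

end Completion

/-! ## The completely projective tensor product -/

section Proj

variable {X : OpSpace.{u}} {Y : OpSpace.{v}} {ι κ : Type} [Fintype ι] [Fintype κ]

/-- The tensor product of matrices `x ⊗ y = [x_{ij} ⊗ y_{kl}]_{(i,k),(j,l)}`. -/
def tensorMat {p q : Type} (x : Matrix p p X) (y : Matrix q q Y) :
    Matrix (p × q) (p × q) (X ⊗[ℂ] Y) :=
  Matrix.of fun i j => x i.1 j.1 ⊗ₜ[ℂ] y i.2 j.2

/-- The numbers `‖α‖ ‖x‖ ‖y‖ ‖β‖` for all the representations `v = α (x ⊗ y) β`. -/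
def projSet (v : Matrix ι ι (X ⊗[ℂ] Y)) : Set ℝ :=
  {r | ∃ (p q : ℕ) (x : Matrix (Fin p) (Fin p) X) (y : Matrix (Fin q) (Fin q) Y)
    (α : Matrix ι (Fin p × Fin q) ℂ) (β : Matrix (Fin p × Fin q) ι ℂ),
    v = matMul α (tensorMat x y) β ∧
    r = scalarNorm α * X.matNorm p x * Y.matNorm q y * scalarNorm β}

/-- The norm `‖v‖_∧` of a matrix over the algebraic tensor product. -/
def projNorm (v : Matrix ι ι (X ⊗[ℂ] Y)) : ℝ := sInf (projSet v)

/-- A representation `v = α (x ⊗ y) β` with `‖x‖, ‖y‖ ≤ 1` and `‖α‖, ‖β‖ ≤ √r`. -/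
def HasRep (v : Matrix ι ι (X ⊗[ℂ] Y)) (r : ℝ) : Prop :=
  ∃ (p q : Type) (_ : Fintype p) (_ : Fintype q) (x : Matrix p p X) (y : Matrix q q Y)
    (α : Matrix ι (p × q) ℂ) (β : Matrix (p × q) ι ℂ),
    v = matMul α (tensorMat x y) β ∧ X.mnorm x ≤ 1 ∧ Y.mnorm y ≤ 1 ∧
    scalarNorm α ≤ √r ∧ scalarNorm β ≤ √r

lemma projSet_nonneg {v : Matrix ι ι (X ⊗[ℂ] Y)} {r : ℝ} (h : r ∈ projSet v) : 0 ≤ r := by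
  obtain ⟨p, q, x, y, α, β, -, rfl⟩ := h
  have := scalarNorm_nonneg α
  have := scalarNorm_nonneg β
  have := X.matNorm_nonneg p x
  have := Y.matNorm_nonneg q y
  positivity

lemma projNorm_nonneg (v : Matrix ι ι (X ⊗[ℂ] Y)) : 0 ≤ projNorm v :=
  Real.sInf_nonneg fun _ h => projSet_nonneg h

lemma mem_projSet {p q : Type} [Fintype p] [Fintype q] (x : Matrix p p X) (y : Matrix q q Y)
    (α : Matrix ι (p × q) ℂ) (β : Matrix (p × q) ι ℂ) :
    scalarNorm α * X.mnorm x * Y.mnorm y * scalarNorm β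
      ∈ projSet (matMul α (tensorMat x y) β) := by
  let e := (Fintype.equivFin p).symm
  let e' := (Fintype.equivFin q).symm
  refine ⟨Fintype.card p, Fintype.card q, x.submatrix e e, y.submatrix e' e',
    α.submatrix (Equiv.refl ι) (e.prodCongr e'), β.submatrix (e.prodCongr e') (Equiv.refl ι), ?_, ?_⟩
  · have : tensorMat (x.submatrix e e) (y.submatrix e' e')
        = (tensorMat x y).submatrix (e.prodCongr e') (e.prodCongr e') := rfl
    rw [this, matMul_submatrix]; rfl
  · rw [scalarNorm_submatrix_equiv, scalarNorm_submatrix_equiv]; rfl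

lemma HasRep.projNorm_le {v : Matrix ι ι (X ⊗[ℂ] Y)} {r : ℝ} (hr : 0 ≤ r) (h : HasRep v r) :
    projNorm v ≤ r := by
  obtain ⟨p, q, _, _, x, y, α, β, rfl, hx, hy, hα, hβ⟩ := h
  refine (csInf_le ⟨0, fun _ h => projSet_nonneg h⟩ (mem_projSet x y α β)).trans ?_
  have := X.mn.N_nonneg x
  have := Y.mn.N_nonneg y
  have := scalarNorm_nonneg β
  calc _ ≤ √r * 1 * 1 * √r := by gcongr
    _ = r := by rw [mul_one, mul_one, Real.mul_self_sqrt hr]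

/-- The block-diagonal combination of two representations. -/
lemma rep_blocks {p q p' q' : Type} [Fintype p] [Fintype q] [Fintype p'] [Fintype q']
    (x : Matrix p p X) (y : Matrix q q Y) (x' : Matrix p' p' X) (y' : Matrix q' q' Y) :
    ∃ (γ : Matrix (p × q ⊕ p' × q') ((p ⊕ p') × (q ⊕ q')) ℂ)
      (δ : Matrix ((p ⊕ p') × (q ⊕ q')) (p × q ⊕ p' × q') ℂ),
      scalarNorm γ ≤ 1 ∧ scalarNorm δ ≤ 1 ∧
      Matrix.fromBlocks (tensorMat x y) 0 0 (tensorMat x' y') = matMul γ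
        (tensorMat (Matrix.fromBlocks x 0 0 x') (Matrix.fromBlocks y 0 0 y')) δ := by
  classical
  let j : p × q ⊕ p' × q' → (p ⊕ p') × (q ⊕ q') :=
    Sum.elim (fun a => (Sum.inl a.1, Sum.inl a.2)) (fun a => (Sum.inr a.1, Sum.inr a.2))
  have hj : Function.Injective j := by
    rintro (⟨a, b⟩ | ⟨a, b⟩) (⟨c, d⟩ | ⟨c, d⟩) h <;> simp_all [j]
  refine ⟨_, _, scalarNorm_inj_le j hj, scalarNorm_inj_le' j hj, ?_⟩
  rw [matMul_inj]
  ext (⟨a, b⟩ | ⟨a, b⟩) (⟨c, d⟩ | ⟨c, d⟩) <;> simp [tensorMat, j]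

lemma matMul_fromBlocks {V : Type*} [AddCommGroup V] [Module ℂ V] {m n p q m' n' p' q' : Type*}
    [Fintype p] [Fintype q] [Fintype p'] [Fintype q'] (α : Matrix m p ℂ) (x : Matrix p q V)
    (β : Matrix q n ℂ) (α' : Matrix m' p' ℂ) (x' : Matrix p' q' V) (β' : Matrix q' n' ℂ) :
    matMul (Matrix.fromBlocks α 0 0 α') (Matrix.fromBlocks x 0 0 x') (Matrix.fromBlocks β 0 0 β')
      = Matrix.fromBlocks (matMul α x β) 0 0 (matMul α' x' β') := by
  ext (i | i) (j | j) <;> simp [matMul]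

lemma matMul_fromCols {V : Type*} [AddCommGroup V] [Module ℂ V] {m n p q p' q' : Type*}
    [Fintype p] [Fintype q] [Fintype p'] [Fintype q'] (α : Matrix m p ℂ) (x : Matrix p q V)
    (β : Matrix q n ℂ) (α' : Matrix m p' ℂ) (x' : Matrix p' q' V) (β' : Matrix q' n ℂ) :
    matMul (Matrix.fromCols α α') (Matrix.fromBlocks x 0 0 x') (Matrix.fromRows β β')
      = matMul α x β + matMul α' x' β' := by
  ext i j; simp [matMul]

lemma exists_rep (v : Matrix ι ι (X ⊗[ℂ] Y)) :
    ∃ (p q : Type) (_ : Fintype p) (_ : Fintype q) (x : Matrix p p X) (y : Matrix q q Y)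
      (α : Matrix ι (p × q) ℂ) (β : Matrix (p × q) ι ℂ), v = matMul α (tensorMat x y) β := by
  classical
  let P : Matrix ι ι (X ⊗[ℂ] Y) → Prop := fun v =>
    ∃ (p q : Type) (_ : Fintype p) (_ : Fintype q) (x : Matrix p p X) (y : Matrix q q Y)
      (α : Matrix ι (p × q) ℂ) (β : Matrix (p × q) ι ℂ), v = matMul α (tensorMat x y) β
  change P v
  have hadd : ∀ v w, P v → P w → P (v + w) := by
    rintro v w ⟨p, q, _, _, x, y, α, β, rfl⟩ ⟨p', q', _, _, x', y', α', β', rfl⟩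
    obtain ⟨γ, δ, -, -, h⟩ := rep_blocks x y x' y'
    refine ⟨p ⊕ p', q ⊕ q', inferInstance, inferInstance, Matrix.fromBlocks x 0 0 x',
      Matrix.fromBlocks y 0 0 y', Matrix.fromCols α α' * γ, δ * Matrix.fromRows β β', ?_⟩
    rw [← matMul_matMul, ← h, matMul_fromCols]
  have hzero : P 0 :=
    ⟨Unit, Unit, inferInstance, inferInstance, 0, 0, 0, 0, by ext; simp [matMul]⟩
  induction v using Matrix.induction_on' with
  | h_zero => exact hzero
  | h_add v w hv hw => exact hadd v w hv hw
  | h_std_basis i j t =>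
    induction t using TensorProduct.induction_on with
    | zero => simpa using hzero
    | add s t hs ht => rw [Matrix.single_add]; exact hadd _ _ hs ht
    | tmul a b =>
      refine ⟨Unit, Unit, inferInstance, inferInstance, Matrix.of fun _ _ => a,
        Matrix.of fun _ _ => b, Matrix.of fun k _ => if i = k then 1 else 0,
        Matrix.of fun _ k => if j = k then 1 else 0, ?_⟩
      ext k l
      simp only [matMul, tensorMat, Matrix.single_apply, Matrix.of_apply]
      by_cases h1 : i = k <;> by_cases h2 : j = l <;> simp [h1, h2]

lemma projSet_nonempty (v : Matrix ι ι (X ⊗[ℂ] Y)) : (projSet v).Nonempty := by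
  obtain ⟨p, q, _, _, x, y, α, β, rfl⟩ := exists_rep v
  exact ⟨_, mem_projSet x y α β⟩

lemma hasRep_of_lt {v : Matrix ι ι (X ⊗[ℂ] Y)} {r : ℝ} (h : projNorm v < r) : HasRep v r := by
  obtain ⟨s, ⟨p, q, x, y, α, β, rfl, rfl⟩, hs⟩ := exists_lt_of_csInf_lt (projSet_nonempty v) h
  have hr : 0 < r := (projNorm_nonneg _).trans_lt h
  have ha := scalarNorm_nonneg α
  have hb := scalarNorm_nonneg β
  have hx := X.matNorm_nonneg p x
  have hy := Y.matNorm_nonneg q y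
  set a := scalarNorm α
  set b := scalarNorm β
  set c := X.matNorm p x
  set d := Y.matNorm q y
  have hc : Continuous fun ε : ℝ => (a + ε) * (c + ε) * (d + ε) * (b + ε) := by fun_prop
  have h0 : ∀ᶠ ε in nhdsWithin (0 : ℝ) (Set.Ioi 0),
      (a + ε) * (c + ε) * (d + ε) * (b + ε) < r := by
    refine Filter.Eventually.filter_mono nhdsWithin_le_nhds ?_
    refine (hc.tendsto 0).eventually_lt_const ?_
    simpa using hs
  obtain ⟨ε, hε, hε0⟩ := (h0.and self_mem_nhdsWithin).exists
  replace hε0 : 0 < ε := hε0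
  have hA : 0 < a + ε := by positivity
  have hB : 0 < b + ε := by positivity
  have hC : 0 < c + ε := by positivity
  have hD : 0 < d + ε := by positivity
  have hsr : 0 < √r := Real.sqrt_pos.2 hr
  refine ⟨Fin p, Fin q, inferInstance, inferInstance, (((c + ε)⁻¹ : ℝ) : ℂ) • x,
    (((d + ε)⁻¹ : ℝ) : ℂ) • y, ((√r * (a + ε)⁻¹ : ℝ) : ℂ) • α,
    (((a + ε) * (c + ε) * (d + ε) * (√r)⁻¹ : ℝ) : ℂ) • β, ?_, ?_, ?_, ?_, ?_⟩
  · ext i j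
    simp only [matMul, tensorMat, Matrix.smul_apply, Matrix.of_apply, smul_eq_mul,
      TensorProduct.smul_tmul_smul, smul_smul]
    refine Finset.sum_congr rfl fun k _ => Finset.sum_congr rfl fun l _ => ?_
    congr 1
    have h1 : ((a + ε : ℝ) : ℂ) ≠ 0 := by exact_mod_cast hA.ne'
    have h2 : ((c + ε : ℝ) : ℂ) ≠ 0 := by exact_mod_cast hC.ne'
    have h3 : ((d + ε : ℝ) : ℂ) ≠ 0 := by exact_mod_cast hD.ne'
    have h4 : ((√r : ℝ) : ℂ) ≠ 0 := by exact_mod_cast hsr.ne'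
    simp only [Complex.ofReal_mul, Complex.ofReal_inv]
    field_simp
  · rw [OpSpace.mnorm_fin, X.matNorm_smul, Complex.norm_real, Real.norm_of_nonneg (by positivity),
      inv_mul_le_iff₀ hC, mul_one]
    change c ≤ c + ε; linarith
  · rw [OpSpace.mnorm_fin, Y.matNorm_smul, Complex.norm_real, Real.norm_of_nonneg (by positivity),
      inv_mul_le_iff₀ hD, mul_one]
    change d ≤ d + ε; linarith
  · rw [scalarNorm_smul, Complex.norm_real, Real.norm_of_nonneg (by positivity), mul_assoc]
    refine mul_le_of_le_one_right hsr.le ?_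
    rw [inv_mul_le_iff₀ hA, mul_one]
    change a ≤ a + ε; linarith
  · rw [scalarNorm_smul, Complex.norm_real, Real.norm_of_nonneg (by positivity)]
    have h1 : (a + ε) * (c + ε) * (d + ε) * b ≤ r := by
      refine le_trans ?_ hε.le
      gcongr; linarith
    calc (a + ε) * (c + ε) * (d + ε) * (√r)⁻¹ * b
        = ((a + ε) * (c + ε) * (d + ε) * b) * (√r)⁻¹ := by ring
      _ ≤ r * (√r)⁻¹ := by gcongr
      _ = √r := by rw [← div_eq_mul_inv, Real.div_sqrt]

variable (X Y)

/-- The matrix norms `‖·‖_∧` on the algebraic tensor product. -/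
def projMatNorm : MatNorm (X ⊗[ℂ] Y) where
  N v := projNorm v
  add_le v w := by
    refine le_of_forall_pos_le_add fun ε hε => ?_
    obtain ⟨p, q, _, _, x, y, α, β, hv, hx, hy, hα, hβ⟩ :=
      hasRep_of_lt (lt_add_of_pos_right (projNorm v) (half_pos hε))
    obtain ⟨p', q', _, _, x', y', α', β', hw, hx', hy', hα', hβ'⟩ :=
      hasRep_of_lt (lt_add_of_pos_right (projNorm w) (half_pos hε))
    obtain ⟨γ, δ, hγ, hδ, h⟩ := rep_blocks x y x' y'
    have hvn := projNorm_nonneg v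
    have hwn := projNorm_nonneg w
    have e : projNorm v + projNorm w + ε
        = (projNorm v + ε / 2) + (projNorm w + ε / 2) := by ring
    have sq : ∀ {a b s t : ℝ}, 0 ≤ a → 0 ≤ b → 0 ≤ s → 0 ≤ t → a ≤ √s → b ≤ √t →
        √(a ^ 2 + b ^ 2) ≤ √(s + t) := by
      intro a b s t ha hb hs ht h1 h2
      refine Real.sqrt_le_sqrt (add_le_add ?_ ?_)
      · rw [← Real.sq_sqrt hs]; exact pow_le_pow_left₀ ha h1 2
      · rw [← Real.sq_sqrt ht]; exact pow_le_pow_left₀ hb h2 2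
    rw [e]
    refine HasRep.projNorm_le (by positivity) ⟨p ⊕ p', q ⊕ q', inferInstance, inferInstance, _, _,
      Matrix.fromCols α α' * γ, δ * Matrix.fromRows β β', ?_,
      (X.mn.blocks_le x x').trans (max_le hx hx'), (Y.mn.blocks_le y y').trans (max_le hy hy'),
      ?_, ?_⟩
    · rw [← matMul_matMul, ← h, matMul_fromCols, ← hv, ← hw]
    · refine (scalarNorm_mul_le _ _).trans
        ((mul_le_of_le_one_right (scalarNorm_nonneg _) hγ).trans ?_)
      exact (scalarNorm_fromCols_sq_le _ _).trans (sq (scalarNorm_nonneg _) (scalarNorm_nonneg _)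
        (by positivity) (by positivity) hα hα')
    · refine (scalarNorm_mul_le _ _).trans
        ((mul_le_of_le_one_left (scalarNorm_nonneg _) hδ).trans ?_)
      exact (scalarNorm_fromRows_sq_le _ _).trans (sq (scalarNorm_nonneg _) (scalarNorm_nonneg _)
        (by positivity) (by positivity) hβ hβ')
  mul_le a v b := by
    have ha := scalarNorm_nonneg a
    have hb := scalarNorm_nonneg b
    have key : ∀ r ∈ projSet v, projNorm (matMul a v b) ≤ (scalarNorm a * scalarNorm b) * r := by
      rintro r ⟨p, q, x, y, α, β, rfl, rfl⟩
      rw [matMul_matMul]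
      refine (csInf_le ⟨0, fun _ h => projSet_nonneg h⟩ (mem_projSet x y _ _)).trans ?_
      have := X.matNorm_nonneg p x
      have := Y.matNorm_nonneg q y
      have h1 := scalarNorm_mul_le a α
      have h2 := scalarNorm_mul_le β b
      have := scalarNorm_nonneg α
      have := scalarNorm_nonneg β
      rw [OpSpace.mnorm_fin, OpSpace.mnorm_fin]
      calc _ ≤ (scalarNorm a * scalarNorm α) * X.matNorm p x * Y.matNorm q y
            * (scalarNorm β * scalarNorm b) := by
            gcongr
            exact scalarNorm_nonneg _
        _ = _ := by ring
    have h0 : projNorm (matMul a v b) ≤ (scalarNorm a * scalarNorm b) * projNorm v := by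
      rcases (mul_nonneg ha hb).eq_or_lt with h | h
      · obtain ⟨r, hr⟩ := projSet_nonempty v
        have := key r hr
        rw [← h, zero_mul] at this ⊢; exact this
      · rw [← div_le_iff₀' h]
        exact le_csInf (projSet_nonempty v) fun r hr => (div_le_iff₀' h).2 (key r hr)
    calc _ ≤ _ := h0
      _ = _ := by ring
  blocks_le v w := by
    refine le_of_forall_pos_le_add fun ε hε => ?_
    obtain ⟨p, q, _, _, x, y, α, β, hv, hx, hy, hα, hβ⟩ :=
      hasRep_of_lt (lt_add_of_pos_right (projNorm v) hε)
    obtain ⟨p', q', _, _, x', y', α', β', hw, hx', hy', hα', hβ'⟩ :=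
      hasRep_of_lt (lt_add_of_pos_right (projNorm w) hε)
    obtain ⟨γ, δ, hγ, hδ, h⟩ := rep_blocks x y x' y'
    have hvn := projNorm_nonneg v
    have h1 : √(projNorm v + ε) ≤ √(max (projNorm v) (projNorm w) + ε) :=
      Real.sqrt_le_sqrt (by gcongr; exact le_max_left _ _)
    have h2 : √(projNorm w + ε) ≤ √(max (projNorm v) (projNorm w) + ε) :=
      Real.sqrt_le_sqrt (by gcongr; exact le_max_right _ _)
    refine HasRep.projNorm_le (add_nonneg (le_max_of_le_left hvn) hε.le)
      ⟨p ⊕ p', q ⊕ q', inferInstance, inferInstance, _, _,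
      Matrix.fromBlocks α 0 0 α' * γ, δ * Matrix.fromBlocks β 0 0 β', ?_,
      (X.mn.blocks_le x x').trans (max_le hx hx'), (Y.mn.blocks_le y y').trans (max_le hy hy'),
      ?_, ?_⟩
    · rw [← matMul_matMul, ← h, matMul_fromBlocks, ← hv, ← hw]
    · refine (scalarNorm_mul_le _ _).trans
        ((mul_le_of_le_one_right (scalarNorm_nonneg _) hγ).trans ?_)
      exact (scalarNorm_fromBlocks_le _ _).trans (max_le (hα.trans h1) (hα'.trans h2))
    · refine (scalarNorm_mul_le _ _).trans
        ((mul_le_of_le_one_left (scalarNorm_nonneg _) hδ).trans ?_)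
      exact (scalarNorm_fromBlocks_le _ _).trans (max_le (hβ.trans h1) (hβ'.trans h2))

/-- The algebraic tensor product of two operator spaces, as a normed space for `‖·‖_∧`. -/
def AlgProj : Type (max u v) := X ⊗[ℂ] Y

instance : AddCommGroup (AlgProj X Y) := inferInstanceAs (AddCommGroup (X ⊗[ℂ] Y))

instance : Module ℂ (AlgProj X Y) := inferInstanceAs (Module ℂ (X ⊗[ℂ] Y))

/-- The matrix norms `‖·‖_∧`. -/
def algProjMatNorm : MatNorm (AlgProj X Y) := projMatNorm X Y

instance : SeminormedAddCommGroup (AlgProj X Y) :=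
  AddGroupSeminorm.toSeminormedAddCommGroup
    { toFun := (algProjMatNorm X Y).nrm
      map_zero' := (algProjMatNorm X Y).N_zero
      add_le' := fun _ _ => (algProjMatNorm X Y).add_le _ _
      neg' := fun _ => (algProjMatNorm X Y).N_neg _ }

instance : NormedSpace ℂ (AlgProj X Y) where
  norm_smul_le c v := ((algProjMatNorm X Y).N_smul c (Matrix.of fun _ _ : Unit => v)).le

/-- The completely projective tensor product: the completion of the algebraic tensor product for
the norms `‖·‖_∧`. -/
def OpSpace.proj : OpSpace.{max u v} :=
  OpSpace.completion (algProjMatNorm X Y) fun _ => rfl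

end Proj

/-! ## The universal property of the completely projective tensor product -/

section Universal

open UniformSpace

universe t

variable {X : OpSpace.{u}} {Y : OpSpace.{v}} {Z : OpSpace.{w}} {W : OpSpace.{t}}

variable (X Y) in
/-- The canonical map from the algebraic to the completely projective tensor product. -/
def toProj : X ⊗[ℂ] Y →ₗ[ℂ] OpSpace.proj X Y :=
  (Completion.toComplL (𝕜 := ℂ) (E := AlgProj X Y)).toLinearMap

/-- The elementary tensor `x ⊗ y` in the completely projective tensor product. -/
def tmul (x : X) (y : Y) : OpSpace.proj X Y := toProj X Y (x ⊗ₜ[ℂ] y)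

/-- The matrix `[b(x_{ij}, y_{kl})]_{(i,k),(j,l)}`. -/
def bilinAmp {ι κ : Type} (b : X → Y → Z) (x : Matrix ι ι X) (y : Matrix κ κ Y) :
    Matrix (ι × κ) (ι × κ) Z :=
  Matrix.of fun i j => b (x i.1 j.1) (y i.2 j.2)

/-- Jointly completely contractive bilinear maps. -/
def IsJCC (b : X →ₗ[ℂ] Y →ₗ[ℂ] Z) : Prop :=
  ∀ (m n : ℕ) (x : Matrix (Fin m) (Fin m) X) (y : Matrix (Fin n) (Fin n) Y),
    Z.mnorm (bilinAmp (fun x y => b x y) x y) ≤ X.matNorm m x * Y.matNorm n y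

lemma IsJCC.le {b : X →ₗ[ℂ] Y →ₗ[ℂ] Z} (hb : IsJCC b) {ι κ : Type} [Fintype ι] [Fintype κ]
    (x : Matrix ι ι X) (y : Matrix κ κ Y) :
    Z.mnorm (bilinAmp (fun x y => b x y) x y) ≤ X.mnorm x * Y.mnorm y := by
  let e := (Fintype.equivFin ι).symm
  let e' := (Fintype.equivFin κ).symm
  refine le_trans (le_of_eq ?_) (hb _ _ (x.submatrix e e) (y.submatrix e' e'))
  rw [OpSpace.mnorm, ← Z.mn.N_submatrix_equiv (e.prodCongr e')]
  rfl

/-- The algebraic linear map induced by a bilinear map. -/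
def algLift (b : X →ₗ[ℂ] Y →ₗ[ℂ] Z) : AlgProj X Y →ₗ[ℂ] Z :=
  (TensorProduct.lift b : X ⊗[ℂ] Y →ₗ[ℂ] Z)

lemma algLift_le {b : X →ₗ[ℂ] Y →ₗ[ℂ] Z} (hb : IsJCC b) (n : ℕ)
    (v : Matrix (Fin n) (Fin n) (AlgProj X Y)) :
    Z.matNorm n (v.map (algLift b)) ≤ (algProjMatNorm X Y).N v := by
  refine le_csInf (projSet_nonempty (X := X) (Y := Y) v) ?_
  rintro r ⟨p, q, x, y, α, β, hv, rfl⟩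
  have h1 : v.map (algLift b) = matMul α (bilinAmp (fun x y => b x y) x y) β := by
    have h2 : (matMul α (tensorMat x y) β).map (TensorProduct.lift b)
        = matMul α ((tensorMat x y).map (TensorProduct.lift b)) β :=
      MatNorm.matMul_map _ _ _ _
    have h3 : (tensorMat x y).map (TensorProduct.lift b) = bilinAmp (fun x y => b x y) x y := by
      ext i j; simp [tensorMat, bilinAmp]
    rw [h3, ← hv] at h2
    exact h2
  rw [h1, ← OpSpace.mnorm_fin]
  refine (Z.mn.mul_le _ _ _).trans ?_
  have h4 := hb p q x y
  have := scalarNorm_nonneg α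
  have := scalarNorm_nonneg β
  rw [mul_assoc (scalarNorm α) (X.matNorm p x)]
  exact mul_le_mul_of_nonneg_right (mul_le_mul_of_nonneg_left h4 (scalarNorm_nonneg α))
    (scalarNorm_nonneg β)

lemma exists_lift {b : X →ₗ[ℂ] Y →ₗ[ℂ] Z} (hb : IsJCC b) :
    ∃ g : CCMap (OpSpace.proj X Y) Z, ∀ x y, g (tmul x y) = b x y := by
  obtain ⟨g, hg⟩ := completion_lift (algProjMatNorm X Y) (fun _ => rfl) (algLift b) (algLift_le hb)
  exact ⟨g, fun x y => (hg (x ⊗ₜ[ℂ] y : X ⊗[ℂ] Y)).trans (TensorProduct.lift.tmul x y)⟩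

/-- The complete contraction on `X ⊗^ Y` induced by a jointly completely contractive map. -/
def lift (b : X →ₗ[ℂ] Y →ₗ[ℂ] Z) (hb : IsJCC b) : CCMap (OpSpace.proj X Y) Z :=
  (exists_lift hb).choose

lemma lift_tmul (b : X →ₗ[ℂ] Y →ₗ[ℂ] Z) (hb : IsJCC b) (x : X) (y : Y) :
    lift b hb (tmul x y) = b x y := (exists_lift hb).choose_spec x y

/-- Complete contractions on `X ⊗^ Y` are determined on elementary tensors. -/
lemma proj_ext {f g : CCMap (OpSpace.proj X Y) Z} (h : ∀ x y, f (tmul x y) = g (tmul x y)) :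
    f = g := by
  have h2 : f.toLinearMap ∘ₗ toProj X Y = g.toLinearMap ∘ₗ toProj X Y :=
    TensorProduct.ext' h
  have h1 : ∀ v : AlgProj X Y, f.toLinearMap (v : Completion (AlgProj X Y))
      = g.toLinearMap (v : Completion (AlgProj X Y)) := fun v => LinearMap.congr_fun h2 v
  have h3 : (f : OpSpace.proj X Y → Z) = g :=
    (Completion.denseRange_coe (α := AlgProj X Y)).equalizer f.continuous g.continuous (funext h1)
  ext v
  exact congrFun h3 v

variable (X Y) in
/-- The bilinear map `(x, y) ↦ x ⊗ y`. -/
def mkBilin : X →ₗ[ℂ] Y →ₗ[ℂ] OpSpace.proj X Y :=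
  (TensorProduct.mk ℂ X Y).compr₂ (toProj X Y)

lemma mkBilin_apply (x : X) (y : Y) : mkBilin X Y x y = tmul x y := rfl

lemma mkBilin_jcc : IsJCC (mkBilin X Y) := by
  intro m n x y
  have h1 : (OpSpace.proj X Y).mnorm (bilinAmp (fun x y => mkBilin X Y x y) x y)
      = projNorm (tensorMat x y) := by
    refine (OpSpace.ofMatNorm_mnorm _ _ ((algProjMatNorm X Y).completion_nrm fun _ => rfl) _).trans ?_
    exact (algProjMatNorm X Y).complN_coe (fun _ => rfl) (tensorMat x y)
  rw [h1]
  classical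
  have h2 := mem_projSet x y (1 : Matrix (Fin m × Fin n) (Fin m × Fin n) ℂ) 1
  have h3 : matMul (1 : Matrix (Fin m × Fin n) (Fin m × Fin n) ℂ) (tensorMat x y) 1
      = tensorMat x y := by
    have := matMul_smul_one (1 : ℂ) (tensorMat x y)
    rwa [one_smul, one_smul] at this
  rw [h3] at h2
  refine (csInf_le ⟨0, fun _ h => projSet_nonneg h⟩ h2).trans ?_
  have h4 : scalarNorm (1 : Matrix (Fin m × Fin n) (Fin m × Fin n) ℂ) ≤ 1 := by
    have := scalarNorm_smul_one_le (n := Fin m × Fin n) 1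
    rwa [one_smul, norm_one] at this
  rw [OpSpace.mnorm_fin, OpSpace.mnorm_fin]
  have := X.matNorm_nonneg m x
  have := Y.matNorm_nonneg n y
  have := scalarNorm_nonneg (1 : Matrix (Fin m × Fin n) (Fin m × Fin n) ℂ)
  calc _ ≤ 1 * X.matNorm m x * Y.matNorm n y * 1 := by gcongr
    _ = _ := by ring

lemma CCMap.comp_mk_jcc (f : CCMap (OpSpace.proj X Y) Z) :
    IsJCC ((mkBilin X Y).compr₂ f.toLinearMap) := fun m n x y =>
  (f.mnorm_le _).trans (mkBilin_jcc m n x y)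

lemma IsJCC.comp {X' : OpSpace} {Y' : OpSpace} {b : X' →ₗ[ℂ] Y' →ₗ[ℂ] Z} (hb : IsJCC b)
    (f : CCMap X X') (g : CCMap Y Y') : IsJCC (b.compl₁₂ f.toLinearMap g.toLinearMap) :=
  fun m n x y => (hb m n (x.map f) (y.map g)).trans
    (mul_le_mul (f.contractive m x) (g.contractive n y) (Y'.matNorm_nonneg _ _)
      (X.matNorm_nonneg _ _))

/-- The complete contraction `f ⊗ g` between completely projective tensor products. -/
def CCMap.map {X' : OpSpace} {Y' : OpSpace} (f : CCMap X X') (g : CCMap Y Y') :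
    CCMap (OpSpace.proj X Y) (OpSpace.proj X' Y') :=
  lift ((mkBilin X' Y').compl₁₂ f.toLinearMap g.toLinearMap) (mkBilin_jcc.comp f g)

lemma CCMap.map_tmul {X' : OpSpace} {Y' : OpSpace} (f : CCMap X X') (g : CCMap Y Y') (x : X)
    (y : Y) : CCMap.map f g (tmul x y) = tmul (f x) (g y) := lift_tmul _ _ _ _

/-- A complete contraction into `CB(Y, Z)`, as a bilinear map. -/
def uncurryBilin (f : CCMap X (OpSpace.cb Y Z)) : X →ₗ[ℂ] Y →ₗ[ℂ] Z :=
  (cbSubmodule Y Z).subtype ∘ₗ f.toLinearMap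

lemma uncurry_jcc (f : CCMap X (OpSpace.cb Y Z)) : IsJCC (uncurryBilin f) := by
  intro m n x y
  have h1 : Z.mnorm (bigAmp ((x.map f.toLinearMap).map (cbSubmodule Y Z).subtype) y) ≤
      matCBNorm ((x.map f.toLinearMap).map (cbSubmodule Y Z).subtype) * Y.matNorm n y :=
    (CB.isMatCBBound (x.map f.toLinearMap)).2 n y
  have h2 := f.mnorm_le x
  rw [X.mnorm_fin] at h2
  have h3 : (OpSpace.cb Y Z).mnorm (x.map f.toLinearMap)
    = matCBNorm ((x.map f.toLinearMap).map (cbSubmodule Y Z).subtype) := OpSpace.cb_mnorm _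
  rw [← h3] at h1
  refine le_trans (le_of_eq ?_) (h1.trans (mul_le_mul_of_nonneg_right h2 (Y.matNorm_nonneg n y)))
  rw [OpSpace.mnorm, ← Z.mn.N_submatrix_equiv (Equiv.prodComm (Fin n) (Fin m))]
  rfl

/-- Jointly completely contractive trilinear maps. -/
def IsJCC₃ (t : X →ₗ[ℂ] Y →ₗ[ℂ] W →ₗ[ℂ] Z) : Prop :=
  ∀ (m n k : ℕ) (x : Matrix (Fin m) (Fin m) X) (y : Matrix (Fin n) (Fin n) Y)
    (z : Matrix (Fin k) (Fin k) W),
    Z.mnorm (Matrix.of fun (i j : Fin m × Fin n × Fin k) =>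
      t (x i.1 j.1) (y i.2.1 j.2.1) (z i.2.2 j.2.2))
      ≤ X.matNorm m x * Y.matNorm n y * W.matNorm k z

lemma IsJCC₃.cb {t : X →ₗ[ℂ] Y →ₗ[ℂ] W →ₗ[ℂ] Z} (ht : IsJCC₃ t) (x : X) (y : Y) :
    IsCBBound (t x y) (‖x‖ * ‖y‖) := by
  refine ⟨by positivity, fun k z => ?_⟩
  have h := ht 1 1 k (Matrix.of fun _ _ => x) (Matrix.of fun _ _ => y) z
  rw [X.matNorm_one, Y.matNorm_one] at h
  refine le_trans (le_of_eq ?_) h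
  rw [OpSpace.mnorm, ← OpSpace.mnorm_fin, OpSpace.mnorm,
    ← Z.mn.N_submatrix_equiv (((Equiv.uniqueProd (Fin k) (Fin 1)).symm).trans
      (Equiv.uniqueProd (Fin 1 × Fin k) (Fin 1)).symm)]
  rfl

/-- A jointly completely contractive trilinear map, as a bilinear map into `CB(W, Z)`. -/
def curryBilin (t : X →ₗ[ℂ] Y →ₗ[ℂ] W →ₗ[ℂ] Z) (ht : IsJCC₃ t) :
    X →ₗ[ℂ] Y →ₗ[ℂ] OpSpace.cb W Z :=
  LinearMap.mk₂ ℂ (fun x y => (⟨t x y, _, ht.cb x y⟩ : CB W Z))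
    (fun x x' y => Subtype.ext (show t (x + x') y = t x y + t x' y by simp))
    (fun c x y => Subtype.ext (show t (c • x) y = c • t x y by simp))
    (fun x y y' => Subtype.ext (show t x (y + y') = t x y + t x y' by simp))
    (fun c x y => Subtype.ext (show t x (c • y) = c • t x y by simp))

lemma curryBilin_jcc (t : X →ₗ[ℂ] Y →ₗ[ℂ] W →ₗ[ℂ] Z) (ht : IsJCC₃ t) :
    IsJCC (curryBilin t ht) := by
  intro m n x y
  refine (OpSpace.cb_mnorm _).le.trans (IsMatCBBound.norm_le ⟨mul_nonneg (X.matNorm_nonneg _ _)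
    (Y.matNorm_nonneg _ _), fun k z => le_trans (le_of_eq ?_) (ht m n k x y z)⟩)
  rw [OpSpace.mnorm, ← Z.mn.N_submatrix_equiv
    ((Equiv.prodAssoc (Fin m) (Fin n) (Fin k)).symm.trans (Equiv.prodComm _ _))]
  rfl

/-- The complete contraction on `(X ⊗^ Y) ⊗^ W` induced by a trilinear map. -/
def lift₃ (t : X →ₗ[ℂ] Y →ₗ[ℂ] W →ₗ[ℂ] Z) (ht : IsJCC₃ t) :
    CCMap (OpSpace.proj (OpSpace.proj X Y) W) Z :=
  lift _ (uncurry_jcc (lift (curryBilin t ht) (curryBilin_jcc t ht)))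

lemma lift₃_tmul (t : X →ₗ[ℂ] Y →ₗ[ℂ] W →ₗ[ℂ] Z) (ht : IsJCC₃ t) (x : X) (y : Y) (z : W) :
    lift₃ t ht (tmul (tmul x y) z) = t x y z := by
  rw [lift₃, lift_tmul]
  have := lift_tmul (curryBilin t ht) (curryBilin_jcc t ht) x y
  exact congrArg (fun u : CB W Z => (u : W →ₗ[ℂ] Z) z) this

end Universal

/-! ## Trace-class operators -/

section TraceClass

open InnerProductSpace

variable (H : Type u) [NormedAddCommGroup H] [InnerProductSpace ℂ H] [CompleteSpace H]

/-- The index set of a fixed orthonormal basis of `H`. -/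
def basisSet : Set H := (exists_hilbertBasis ℂ H).choose

/-- A fixed orthonormal basis of `H`. -/
def stdBasis : HilbertBasis (basisSet H) ℂ H := (exists_hilbertBasis ℂ H).choose_spec.choose

variable {H}

/-- `T` is trace class if `∑ ⟨e, |T| e⟩` converges; this does not depend on the basis. -/
def IsTraceClass (T : H →L[ℂ] H) : Prop :=
  Summable fun i => (⟪stdBasis H i, CFC.abs T (stdBasis H i)⟫_ℂ).re

/-- The trace norm `tr |T|`. -/
def traceNorm (T : H →L[ℂ] H) : ℝ :=
  ∑' i, (⟪stdBasis H i, CFC.abs T (stdBasis H i)⟫_ℂ).re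

/-- The trace `∑ ⟨e, T e⟩` of a trace-class operator. -/
def trace (T : H →L[ℂ] H) : ℂ := ∑' i, ⟪stdBasis H i, T (stdBasis H i)⟫_ℂ

/-- Polar decomposition. -/
lemma exists_polar (T : H →L[ℂ] H) : ∃ U : H →L[ℂ] H, ‖U‖ ≤ 1 ∧ (∀ x, T x = U (CFC.abs T x)) ∧
    ∀ x y, ⟪U x, T y⟫_ℂ = ⟪x, CFC.abs T y⟫_ℂ := by
  set A := CFC.abs T with hA
  have hsa : IsSelfAdjoint A := IsSelfAdjoint.of_nonneg (CFC.abs_nonneg T)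
  have hin : ∀ x y, ⟪A x, A y⟫_ℂ = ⟪T x, T y⟫_ℂ := fun x y => by
    have h1 : A * A = star T * T := CFC.abs_mul_abs T
    have h2 : A (A y) = (ContinuousLinearMap.adjoint T) (T y) := congrArg (fun B => B y) h1
    have h3 : ⟪A x, A y⟫_ℂ = ⟪x, A (A y)⟫_ℂ := by
      rw [← ContinuousLinearMap.adjoint_inner_right, hsa.adjoint_eq]
    rw [h3, h2, ContinuousLinearMap.adjoint_inner_right]
  have hn : ∀ x, ‖T x‖ = ‖A x‖ := fun x => by
    rw [norm_eq_sqrt_re_inner (𝕜 := ℂ), norm_eq_sqrt_re_inner (𝕜 := ℂ) (A x), hin]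
  let K : Submodule ℂ H := (LinearMap.range A.toLinearMap).topologicalClosure
  have hK : ∀ x, A x ∈ K := fun x => subset_closure ⟨x, rfl⟩
  have : CompleteSpace K := (Submodule.isClosed_topologicalClosure _).completeSpace_coe
  let e : H →ₗ[ℂ] K := A.toLinearMap.codRestrict K hK
  have hd : DenseRange e := by
    intro z
    rw [closure_subtype]
    refine closure_mono ?_ z.2
    rintro _ ⟨x, rfl⟩
    exact ⟨e x, ⟨x, rfl⟩, rfl⟩
  have hb : ∀ x, ‖T.toLinearMap x‖ ≤ 1 * ‖e x‖ := fun x => by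
    rw [one_mul]; exact (hn x).le
  let U₀ : K →L[ℂ] H := T.toLinearMap.extendOfNorm e
  have hU₀ : ∀ x, U₀ (e x) = T x := fun x => LinearMap.extendOfNorm_eq hd ⟨1, hb⟩ x
  have hU₀n : ‖U₀‖ ≤ 1 := LinearMap.opNorm_extendOfNorm_le hd zero_le_one hb
  let U : H →L[ℂ] H := U₀ ∘L K.orthogonalProjectionOnto
  have hUn : ‖U‖ ≤ 1 := by
    refine (ContinuousLinearMap.opNorm_comp_le _ _).trans ?_
    exact mul_le_one₀ hU₀n (norm_nonneg _) K.orthogonalProjectionOnto_norm_le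
  have hUA : ∀ x, T x = U (A x) := fun x => by
    have : K.orthogonalProjectionOnto (A x) = e x :=
      Submodule.orthogonalProjectionOnto_mem_subspace_eq_self (e x)
    rw [← hU₀, ContinuousLinearMap.comp_apply, this]
  refine ⟨U, hUn, hUA, fun x y => ?_⟩
  have h1 : ContinuousLinearMap.adjoint U (T y) = A y := by
    rw [← sub_eq_zero, ← norm_eq_zero, ← sq_eq_zero_iff]
    refine le_antisymm ?_ (by positivity)
    have h2 : ‖ContinuousLinearMap.adjoint U (T y)‖ ≤ ‖A y‖ := by
      refine (ContinuousLinearMap.le_opNorm _ _).trans ?_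
      rw [LinearIsometryEquiv.norm_map, hn]
      exact mul_le_of_le_one_left (norm_nonneg _) hUn
    have h3 : ⟪ContinuousLinearMap.adjoint U (T y), A y⟫_ℂ = ⟪A y, A y⟫_ℂ := by
      rw [ContinuousLinearMap.adjoint_inner_left, ← hUA, hin]
    have h4 := norm_sub_sq (𝕜 := ℂ) (ContinuousLinearMap.adjoint U (T y)) (A y)
    have h5 : RCLike.re ⟪A y, A y⟫_ℂ = ‖A y‖ ^ 2 := inner_self_eq_norm_sq _
    rw [h3, h5] at h4
    have h6 := pow_le_pow_left₀ (norm_nonneg _) h2 2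
    linarith
  rw [← ContinuousLinearMap.adjoint_inner_right, h1]

/-- The finite rank operator `∑ xᵢ ⟨yᵢ, ·⟩`. -/
def finRank {σ : Type*} (s : Finset σ) (x y : σ → H) : H →L[ℂ] H :=
  ∑ i ∈ s, rankOne ℂ (x i) (y i)

lemma finRank_apply {σ : Type*} (s : Finset σ) (x y : σ → H) (z : H) :
    finRank s x y z = ∑ i ∈ s, ⟪y i, z⟫_ℂ • x i := by
  simp [finRank]

/-- The pairing of `T` with finite rank operators is bounded by `C`. -/
def FinBound (T : H →L[ℂ] H) (C : ℝ) : Prop :=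
  0 ≤ C ∧ ∀ (σ : Type u) (s : Finset σ) (x y : σ → H),
    ‖∑ i ∈ s, ⟪y i, T (x i)⟫_ℂ‖ ≤ C * ‖finRank s x y‖

lemma abs_inner_nonneg (T : H →L[ℂ] H) (x : H) : 0 ≤ (⟪x, CFC.abs T x⟫_ℂ).re := by
  have h := (ContinuousLinearMap.nonneg_iff_isPositive _).1 (CFC.abs_nonneg T)
  exact h.re_inner_nonneg_right x

lemma traceNorm_nonneg (T : H →L[ℂ] H) : 0 ≤ traceNorm T :=
  tsum_nonneg fun _ => abs_inner_nonneg T _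

lemma IsTraceClass.finBound {T : H →L[ℂ] H} (hT : IsTraceClass T) : FinBound T (traceNorm T) := by
  refine ⟨traceNorm_nonneg T, fun σ s x y => ?_⟩
  obtain ⟨U, hU, hUT, -⟩ := exists_polar T
  set A := CFC.sqrt (CFC.abs T) with hA
  have hsa : IsSelfAdjoint A := IsSelfAdjoint.of_nonneg (CFC.sqrt_nonneg _)
  have hAA : ∀ x, A (A x) = CFC.abs T x := fun x =>
    congrArg (fun B : H →L[ℂ] H => B x) (CFC.sqrt_mul_sqrt_self (CFC.abs T) (CFC.abs_nonneg T))
  have hAin : ∀ x y, ⟪A x, y⟫_ℂ = ⟪x, A y⟫_ℂ := fun x y => by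
    rw [← ContinuousLinearMap.adjoint_inner_left, hsa.adjoint_eq]
  let e := stdBasis H
  have h1 : ∀ i, HasSum (fun k => ⟪y i, U (A (e k))⟫_ℂ * ⟪A (e k), x i⟫_ℂ) ⟪y i, T (x i)⟫_ℂ := by
    intro i
    have := e.hasSum_inner_mul_inner (A (ContinuousLinearMap.adjoint U (y i))) (A (x i))
    simp only [hAin, hAA, ContinuousLinearMap.adjoint_inner_left] at this
    rw [← hUT] at this
    simpa only [hAin] using this
  have h2 := hasSum_sum (s := s) fun i _ => h1 i
  have h3 : HasSum (fun k => (⟪e k, CFC.abs T (e k)⟫_ℂ).re * ‖finRank s x y‖)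
      (traceNorm T * ‖finRank s x y‖) := hT.hasSum.mul_right _
  refine h2.norm_le_of_bounded h3 fun k => ?_
  have h4 : ∑ i ∈ s, ⟪y i, U (A (e k))⟫_ℂ * ⟪A (e k), x i⟫_ℂ
      = ⟪A (e k), finRank s x y (U (A (e k)))⟫_ℂ := by
    rw [finRank_apply, inner_sum]
    simp only [inner_smul_right]
  have h5 : (⟪e k, CFC.abs T (e k)⟫_ℂ).re = ‖A (e k)‖ ^ 2 := by
    rw [← hAA, ← hAin]
    exact inner_self_eq_norm_sq (𝕜 := ℂ) _
  rw [h4, h5]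
  calc _ ≤ ‖A (e k)‖ * ‖finRank s x y (U (A (e k)))‖ := norm_inner_le_norm _ _
    _ ≤ ‖A (e k)‖ * (‖finRank s x y‖ * (1 * ‖A (e k)‖)) := by
        gcongr
        refine (ContinuousLinearMap.le_opNorm _ _).trans ?_
        gcongr
        exact (ContinuousLinearMap.le_opNorm _ _).trans (by gcongr)
    _ = _ := by ring

/-- Partial diagonal operators are contractions. -/
lemma norm_diag_le (s : Finset (basisSet H)) (c : basisSet H → ℂ) (hc : ∀ k, ‖c k‖ ≤ 1) :
    ‖finRank s (fun k => stdBasis H k) (fun k => c k • stdBasis H k)‖ ≤ 1 := by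
  refine ContinuousLinearMap.opNorm_le_bound _ zero_le_one fun z => ?_
  rw [one_mul, finRank_apply]
  refine le_of_sq_le_sq ?_ (norm_nonneg _)
  have h1 := (stdBasis H).orthonormal.inner_sum (fun k => ⟪c k • stdBasis H k, z⟫_ℂ)
    (fun k => ⟪c k • stdBasis H k, z⟫_ℂ) s
  have h2 := congrArg Complex.re h1
  rw [inner_self_eq_norm_sq_to_K] at h2
  have h3 : ‖∑ i ∈ s, ⟪c i • stdBasis H i, z⟫_ℂ • stdBasis H i‖ ^ 2
      = ∑ k ∈ s, ‖⟪c k • stdBasis H k, z⟫_ℂ‖ ^ 2 := by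
    have h4 : ∀ k, (starRingEnd ℂ) ⟪c k • stdBasis H k, z⟫_ℂ * ⟪c k • stdBasis H k, z⟫_ℂ
        = ((‖⟪c k • stdBasis H k, z⟫_ℂ‖ ^ 2 : ℝ) : ℂ) := fun k => by
      rw [Complex.conj_mul']; simp
    simp only [h4, ← Complex.ofReal_sum, Complex.ofReal_re] at h2
    rw [← h2]
    norm_cast
  rw [h3]
  refine le_trans ?_ ((stdBasis H).orthonormal.sum_inner_products_le z (s := s))
  refine Finset.sum_le_sum fun k _ => ?_
  rw [inner_smul_left, norm_mul, mul_pow]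
  refine mul_le_of_le_one_left (by positivity) ?_
  rw [RCLike.norm_conj]
  exact pow_le_one₀ (norm_nonneg _) (hc k)

lemma FinBound.sum_le {T : H →L[ℂ] H} {C : ℝ} (h : FinBound T C) (s : Finset (basisSet H)) :
    ∑ k ∈ s, (⟪stdBasis H k, CFC.abs T (stdBasis H k)⟫_ℂ).re ≤ C := by
  obtain ⟨U, hU, -, hUT⟩ := exists_polar T
  have h1 := h.2 (basisSet H) s (fun k => stdBasis H k) (fun k => U (stdBasis H k))
  have h2 : finRank s (fun k => stdBasis H k) (fun k => U (stdBasis H k))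
      = finRank s (fun k => stdBasis H k) (fun k => (1 : ℂ) • stdBasis H k)
        ∘L ContinuousLinearMap.adjoint U := by
    ext z
    simp only [ContinuousLinearMap.comp_apply, finRank_apply, one_smul,
      ContinuousLinearMap.adjoint_inner_right]
  have h3 : ‖finRank s (fun k => stdBasis H k) (fun k => U (stdBasis H k))‖ ≤ 1 := by
    rw [h2]
    refine (ContinuousLinearMap.opNorm_comp_le _ _).trans ?_
    refine mul_le_one₀ (norm_diag_le s _ fun _ => by simp) (norm_nonneg _) ?_
    rwa [LinearIsometryEquiv.norm_map]
  simp only [hUT] at h1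
  calc _ = (∑ k ∈ s, ⟪stdBasis H k, CFC.abs T (stdBasis H k)⟫_ℂ).re := by
        rw [Complex.re_sum]
    _ ≤ _ := Complex.re_le_norm _
    _ ≤ _ := h1
    _ ≤ C * 1 := mul_le_mul_of_nonneg_left h3 h.1
    _ = C := mul_one C

lemma FinBound.isTraceClass {T : H →L[ℂ] H} {C : ℝ} (h : FinBound T C) : IsTraceClass T :=
  summable_of_sum_le (fun _ => abs_inner_nonneg T _) h.sum_le

lemma FinBound.traceNorm_le {T : H →L[ℂ] H} {C : ℝ} (h : FinBound T C) : traceNorm T ≤ C :=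
  Real.tsum_le_of_sum_le (fun _ => abs_inner_nonneg T _) h.sum_le

lemma FinBound.add {S T : H →L[ℂ] H} {C D : ℝ} (h : FinBound S C) (h' : FinBound T D) :
    FinBound (S + T) (C + D) := by
  refine ⟨add_nonneg h.1 h'.1, fun σ s x y => ?_⟩
  simp only [add_apply, inner_add_right, Finset.sum_add_distrib, add_mul]
  exact (norm_add_le _ _).trans (add_le_add (h.2 σ s x y) (h'.2 σ s x y))

lemma FinBound.smul {T : H →L[ℂ] H} {C : ℝ} (c : ℂ) (h : FinBound T C) :
    FinBound (c • T) (‖c‖ * C) := by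
  refine ⟨mul_nonneg (norm_nonneg _) h.1, fun σ s x y => ?_⟩
  simp only [smul_apply, inner_smul_right, ← Finset.mul_sum, norm_mul, mul_assoc]
  exact mul_le_mul_of_nonneg_left (h.2 σ s x y) (norm_nonneg _)

lemma FinBound.zero : FinBound (0 : H →L[ℂ] H) 0 :=
  ⟨le_rfl, fun σ s x y => by simp⟩

lemma FinBound.norm_le {T : H →L[ℂ] H} {C : ℝ} (h : FinBound T C) : ‖T‖ ≤ C := by
  refine ContinuousLinearMap.opNorm_le_bound _ h.1 fun x => ?_
  have h1 := h.2 PUnit {PUnit.unit} (fun _ => x) (fun _ => T x)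
  simp only [Finset.sum_singleton, finRank, norm_rankOne, inner_self_eq_norm_sq_to_K] at h1
  rcases (norm_nonneg (T x)).eq_or_lt with h0 | h0
  · rw [← h0]; exact mul_nonneg h.1 (norm_nonneg _)
  · have h2 : ‖T x‖ * ‖T x‖ ≤ C * ‖x‖ * ‖T x‖ := by
      calc _ = ‖((‖T x‖ : ℂ)) ^ 2‖ := by simp [sq]
        _ ≤ C * (‖x‖ * ‖T x‖) := h1
        _ = _ := by ring
    exact le_of_mul_le_mul_right h2 h0

lemma FinBound.sum_norm_le {T : H →L[ℂ] H} {C : ℝ} (h : FinBound T C) (B : H →L[ℂ] H)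
    (s : Finset (basisSet H)) :
    ∑ k ∈ s, ‖⟪stdBasis H k, T (B (stdBasis H k))⟫_ℂ‖ ≤ C * ‖B‖ := by
  have hc : ∀ z : ℂ, ∃ c : ℂ, ‖c‖ ≤ 1 ∧ (starRingEnd ℂ) c * z = ‖z‖ := fun z => by
    rcases eq_or_ne z 0 with rfl | hz
    · exact ⟨0, by simp⟩
    · have hz' : (‖z‖ : ℂ) ≠ 0 := by simpa using hz
      refine ⟨z / ‖z‖, by simp [hz], ?_⟩
      rw [map_div₀, Complex.conj_ofReal, div_mul_eq_mul_div, Complex.conj_mul']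
      field_simp
  choose c hc1 hc2 using hc
  let d : basisSet H → ℂ := fun k => c ⟪stdBasis H k, T (B (stdBasis H k))⟫_ℂ
  have h1 := h.2 (basisSet H) s (fun k => B (stdBasis H k)) (fun k => d k • stdBasis H k)
  have h2 : finRank s (fun k => B (stdBasis H k)) (fun k => d k • stdBasis H k)
      = B ∘L finRank s (fun k => stdBasis H k) (fun k => d k • stdBasis H k) := by
    ext z
    simp [finRank_apply]
  have h3 : ‖finRank s (fun k => B (stdBasis H k)) (fun k => d k • stdBasis H k)‖ ≤ ‖B‖ := by
    rw [h2]
    refine (ContinuousLinearMap.opNorm_comp_le _ _).trans ?_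
    exact mul_le_of_le_one_right (norm_nonneg _) (norm_diag_le s d fun _ => hc1 _)
  have h4 : ∑ k ∈ s, ⟪d k • stdBasis H k, T (B (stdBasis H k))⟫_ℂ
      = ((∑ k ∈ s, ‖⟪stdBasis H k, T (B (stdBasis H k))⟫_ℂ‖ : ℝ) : ℂ) := by
    push_cast
    refine Finset.sum_congr rfl fun k _ => ?_
    rw [inner_smul_left]; exact hc2 _
  rw [h4, Complex.norm_real] at h1
  exact (le_abs_self _).trans (h1.trans (mul_le_mul_of_nonneg_left h3 h.1))

lemma FinBound.summable {T : H →L[ℂ] H} {C : ℝ} (h : FinBound T C) (B : H →L[ℂ] H) :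
    Summable fun k => ⟪stdBasis H k, T (B (stdBasis H k))⟫_ℂ :=
  .of_norm (summable_of_sum_le (fun _ => norm_nonneg _) (h.sum_norm_le B))

lemma FinBound.norm_trace_le {T : H →L[ℂ] H} {C : ℝ} (h : FinBound T C) (B : H →L[ℂ] H) :
    ‖trace (T * B)‖ ≤ C * ‖B‖ := by
  have hs : Summable fun k => ‖⟪stdBasis H k, T (B (stdBasis H k))⟫_ℂ‖ :=
    summable_of_sum_le (fun _ => norm_nonneg _) (h.sum_norm_le B)
  exact (norm_tsum_le_tsum_norm hs).trans
    (Real.tsum_le_of_sum_le (fun _ => norm_nonneg _) (h.sum_norm_le B))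

lemma hasSum_rankOne (T : H →L[ℂ] H) (x y : H) :
    HasSum (fun k => ⟪stdBasis H k, T (rankOne ℂ x y (stdBasis H k))⟫_ℂ) ⟪y, T x⟫_ℂ := by
  have := (stdBasis H).hasSum_inner_mul_inner y (T x)
  simpa [inner_smul_right] using this

lemma trace_finRank (T : H →L[ℂ] H) {σ : Type*} (s : Finset σ) (x y : σ → H) :
    trace (T * finRank s x y) = ∑ i ∈ s, ⟪y i, T (x i)⟫_ℂ := by
  refine HasSum.tsum_eq ?_
  have := hasSum_sum (s := s) fun i _ => hasSum_rankOne T (x i) (y i)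
  simpa [finRank, map_sum, inner_sum] using this

/-- The trace norm is the norm of the functional `B ↦ tr(T B)`. -/
lemma finBound_of_trace {T : H →L[ℂ] H} {C : ℝ} (hC : 0 ≤ C)
    (h : ∀ B, ‖trace (T * B)‖ ≤ C * ‖B‖) : FinBound T C :=
  ⟨hC, fun σ s x y => by rw [← trace_finRank]; exact h _⟩

variable (H)

/-- The subspace of trace-class operators. -/
def traceClassSubmodule : Submodule ℂ (H →L[ℂ] H) where
  carrier := {T | IsTraceClass T}
  add_mem' hS hT := (hS.finBound.add hT.finBound).isTraceClass
  zero_mem' := FinBound.zero.isTraceClass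
  smul_mem' c _ hT := (hT.finBound.smul c).isTraceClass

/-- The space of trace-class operators. -/
def TraceClass : Type u := traceClassSubmodule H

variable {H}

instance : AddCommGroup (TraceClass H) := inferInstanceAs (AddCommGroup (traceClassSubmodule H))

instance : Module ℂ (TraceClass H) := inferInstanceAs (Module ℂ (traceClassSubmodule H))

/-- The underlying bounded operator. -/
def TraceClass.toOp : TraceClass H →ₗ[ℂ] (H →L[ℂ] H) := (traceClassSubmodule H).subtype

/-- A trace-class operator as an element of `TraceClass H`. -/
def TraceClass.mk (T : H →L[ℂ] H) (h : IsTraceClass T) : TraceClass H :=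
  (⟨T, h⟩ : traceClassSubmodule H)

lemma TraceClass.toOp_mk (T : H →L[ℂ] H) (h : IsTraceClass T) : (TraceClass.mk T h).toOp = T := rfl

lemma TraceClass.toOp_injective : Function.Injective (TraceClass.toOp (H := H)) :=
  Subtype.val_injective

lemma TraceClass.finBound (t : TraceClass H) : FinBound t.toOp (traceNorm t.toOp) :=
  IsTraceClass.finBound t.2

instance : NormedAddCommGroup (TraceClass H) :=
  AddGroupNorm.toNormedAddCommGroup
    { toFun := fun t => traceNorm t.toOp
      map_zero' := by
        refine le_antisymm ?_ (traceNorm_nonneg _)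
        rw [map_zero]; exact FinBound.zero.traceNorm_le
      add_le' := fun s t => by
        rw [map_add]; exact (s.finBound.add t.finBound).traceNorm_le
      neg' := fun t => by
        have key : ∀ t : TraceClass H, traceNorm (TraceClass.toOp (-t)) ≤ traceNorm t.toOp := by
          intro t
          have := (t.finBound.smul (-1)).traceNorm_le
          rw [map_neg]
          simpa using this
        refine le_antisymm (key t) ?_
        have := key (-t)
        rwa [neg_neg] at this
      eq_zero_of_map_eq_zero' := fun t ht => by
        have := t.finBound.norm_le
        rw [ht] at this
        exact TraceClass.toOp_injective (by rw [map_zero]; simpa using this) }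

lemma TraceClass.norm_def (t : TraceClass H) : ‖t‖ = traceNorm t.toOp := rfl

instance : NormedSpace ℂ (TraceClass H) where
  norm_smul_le c t := by
    rw [TraceClass.norm_def, map_smul]
    exact (t.finBound.smul c).traceNorm_le

instance : CompleteSpace (TraceClass H) := by
  refine Metric.complete_of_cauchySeq_tendsto fun u hu => ?_
  have hc : CauchySeq fun n => (u n).toOp := by
    rw [Metric.cauchySeq_iff] at hu ⊢
    intro ε hε
    obtain ⟨N, hN⟩ := hu ε hε
    refine ⟨N, fun m hm n hn => lt_of_le_of_lt ?_ (hN m hm n hn)⟩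
    rw [dist_eq_norm, dist_eq_norm, ← map_sub]
    exact (u m - u n).finBound.norm_le
  obtain ⟨T, hT⟩ := cauchySeq_tendsto_of_complete hc
  have key : ∀ ε > 0, ∃ N, ∀ m ≥ N, FinBound ((u m).toOp - T) ε := by
    intro ε hε
    obtain ⟨N, hN⟩ := Metric.cauchySeq_iff.1 hu ε hε
    refine ⟨N, fun m hm => ⟨hε.le, fun σ s x y => ?_⟩⟩
    have h1 : Filter.Tendsto (fun k => ‖∑ i ∈ s, ⟪y i, ((u m).toOp - (u k).toOp) (x i)⟫_ℂ‖)
        Filter.atTop (nhds ‖∑ i ∈ s, ⟪y i, ((u m).toOp - T) (x i)⟫_ℂ‖) := by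
      refine (tendsto_finsetSum _ fun i _ => ?_).norm
      refine Filter.Tendsto.inner tendsto_const_nhds ?_
      exact ((ContinuousLinearMap.apply ℂ H (x i)).continuous.tendsto _).comp
        (tendsto_const_nhds.sub hT)
    refine le_of_tendsto h1 (Filter.eventually_atTop.2 ⟨N, fun k hk => ?_⟩)
    have h2 := hN m hm k hk
    rw [dist_eq_norm, TraceClass.norm_def] at h2
    have h3 := (u m - u k).finBound.2 σ s x y
    rw [map_sub] at h2 h3
    exact h3.trans (mul_le_mul_of_nonneg_right h2.le (norm_nonneg _))
  obtain ⟨N, hN⟩ := key 1 one_pos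
  have hTm : IsTraceClass T := by
    have : T ∈ traceClassSubmodule H := by
      have h1 : T = (u N).toOp - ((u N).toOp - T) := by abel
      rw [h1]
      exact (traceClassSubmodule H).sub_mem (u N).2 (hN N le_rfl).isTraceClass
    exact this
  refine ⟨TraceClass.mk T hTm, ?_⟩
  rw [Metric.tendsto_atTop]
  intro ε hε
  obtain ⟨N, hN⟩ := key (ε / 2) (half_pos hε)
  refine ⟨N, fun m hm => ?_⟩
  rw [dist_eq_norm, TraceClass.norm_def, map_sub, TraceClass.toOp_mk]
  exact lt_of_le_of_lt (hN m hm).traceNorm_le (half_lt_self hε)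

end TraceClass

/-! ## The trace-class operator space and the trace pairing -/

section TracePairing

open InnerProductSpace

lemma scalarNorm_col_le {ι : Type*} [Fintype ι] (ξ : ι → ℂ) :
    scalarNorm (Matrix.of fun (i : ι) (_ : Unit) => ξ i) ≤ √(∑ i, ‖ξ i‖ ^ 2) := by
  refine scalarNorm_le_of_sum_sq (Real.sqrt_nonneg _) fun t => ?_
  rw [Real.sq_sqrt (by positivity), Finset.sum_mul]
  refine Finset.sum_le_sum fun i _ => ?_
  simp [Matrix.mulVec, dotProduct, mul_pow]

lemma scalarNorm_row_le {ι : Type*} [Fintype ι] (ξ : ι → ℂ) :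
    scalarNorm (Matrix.of fun (_ : Unit) (i : ι) => (starRingEnd ℂ) (ξ i))
      ≤ √(∑ i, ‖ξ i‖ ^ 2) := by
  have h : (Matrix.of fun (_ : Unit) (i : ι) => (starRingEnd ℂ) (ξ i))
      = (Matrix.of fun (i : ι) (_ : Unit) => ξ i).conjTranspose := by
    ext i j; simp [Matrix.conjTranspose_apply]
  rw [h, scalarNorm_conjTranspose]
  exact scalarNorm_col_le ξ

/-- Bounded functionals are completely bounded with the same norm. -/
lemma isCBBound_functional {X : OpSpace.{u}} (φ : X →ₗ[ℂ] OpSpace.complex) {C : ℝ} (hC : 0 ≤ C)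
    (h : ∀ x, ‖φ x‖ ≤ C * ‖x‖) : IsCBBound φ C := by
  refine ⟨hC, fun n x => ?_⟩
  have h0 : OpSpace.complex.matNorm n (x.map φ) = scalarNorm (x.map φ : Matrix (Fin n) (Fin n) ℂ) :=
    rfl
  have hN := X.matNorm_nonneg n x
  rw [h0]
  refine scalarNorm_le_of_sum_sq (by positivity) fun ξ => ?_
  set η : Fin n → ℂ := (x.map φ : Matrix (Fin n) (Fin n) ℂ).mulVec ξ with hη
  set S := ∑ i, ‖η i‖ ^ 2 with hS
  set R := ∑ i, ‖ξ i‖ ^ 2 with hR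
  have hS0 : 0 ≤ S := by positivity
  have hR0 : 0 ≤ R := by positivity
  let z : X := ∑ i, ∑ j, ((starRingEnd ℂ) (η i) * ξ j) • x i j
  have h1 : φ z = (S : ℂ) := by
    have h2 : φ z = ∑ i, (starRingEnd ℂ) (η i) * η i := by
      simp only [z, map_sum, map_smul]
      refine Finset.sum_congr rfl fun i _ => ?_
      simp only [hη, Matrix.mulVec, dotProduct, Finset.mul_sum]
      refine Finset.sum_congr rfl fun j _ => ?_
      exact mul_assoc ((starRingEnd ℂ) (η i)) (ξ j) (φ (x i j) : ℂ) |>.trans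
        (congrArg _ (mul_comm (ξ j) (φ (x i j) : ℂ)))
    rw [h2, hS]
    push_cast
    exact Finset.sum_congr rfl fun i _ => Complex.conj_mul' _
  have h3 : ‖z‖ ≤ √S * X.matNorm n x * √R := by
    rw [← X.nrm_eq, ← X.mnorm_fin]
    refine (X.mn.mul_le (Matrix.of fun (_ : Unit) (i : Fin n) => (starRingEnd ℂ) (η i)) x
      (Matrix.of fun (i : Fin n) (_ : Unit) => ξ i)).trans ?_
    have := scalarNorm_row_le η
    have := scalarNorm_col_le ξ
    have := X.mn.N_nonneg x
    change _ ≤ √S * X.mn.N x * √R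
    gcongr
    exact scalarNorm_nonneg _
  have h4 : S ≤ C * (√S * X.matNorm n x * √R) := by
    have h5 := h z
    rw [h1] at h5
    have h6 : ‖(S : ℂ)‖ = S := by rw [Complex.norm_real, Real.norm_of_nonneg hS0]
    change ‖(S : ℂ)‖ ≤ _ at h5
    rw [h6] at h5
    exact h5.trans (by gcongr)
  rcases hS0.eq_or_lt with h0 | h0
  · rw [← h0]; positivity
  · have h7 : √S ≤ C * X.matNorm n x * √R := by
      have h8 : √S * √S ≤ √S * (C * X.matNorm n x * √R) := by
        rw [Real.mul_self_sqrt hS0]; linarith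
      exact le_of_mul_le_mul_left h8 (Real.sqrt_pos.2 h0)
    have h9 := pow_le_pow_left₀ (Real.sqrt_nonneg _) h7 2
    rwa [Real.sq_sqrt hS0, mul_pow, Real.sq_sqrt hR0] at h9

variable (H : Type u) [NormedAddCommGroup H] [InnerProductSpace ℂ H] [CompleteSpace H]

section

variable {H} {S T : H →L[ℂ] H} {C D : ℝ}

lemma FinBound.trace_mul_add (h : FinBound T C) (b c : H →L[ℂ] H) :
    trace (T * (b + c)) = trace (T * b) + trace (T * c) := by
  refine (tsum_congr fun k => ?_).trans ((h.summable b).tsum_add (h.summable c))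
  simp

lemma FinBound.trace_mul_smul (h : FinBound T C) (c : ℂ) (b : H →L[ℂ] H) :
    trace (T * (c • b)) = c * trace (T * b) := by
  refine (tsum_congr fun k => ?_).trans ((h.summable b).tsum_mul_left c)
  simp

lemma FinBound.trace_add_mul (h : FinBound S C) (h' : FinBound T D) (b : H →L[ℂ] H) :
    trace ((S + T) * b) = trace (S * b) + trace (T * b) := by
  refine (tsum_congr fun k => ?_).trans ((h.summable b).tsum_add (h'.summable b))
  simp

lemma FinBound.trace_smul_mul (h : FinBound T C) (c : ℂ) (b : H →L[ℂ] H) :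
    trace ((c • T) * b) = c * trace (T * b) := by
  refine (tsum_congr fun k => ?_).trans ((h.summable b).tsum_mul_left c)
  simp

/-- The functional `b ↦ tr(t b)` on `B(H)`. -/
def traceFunctional (t : TraceClass H) : OpSpace.B H →ₗ[ℂ] OpSpace.complex :=
  ({ toFun := fun b => trace (t.toOp * b)
     map_add' := t.finBound.trace_mul_add
     map_smul' := t.finBound.trace_mul_smul } : (H →L[ℂ] H) →ₗ[ℂ] ℂ)

lemma traceFunctional_bound (t : TraceClass H) : IsCBBound (traceFunctional t) ‖t‖ :=
  isCBBound_functional _ (norm_nonneg t) fun b => t.finBound.norm_trace_le b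

end

/-- The embedding `t ↦ tr(t ·)` of `T(H)` into the dual of `B(H)`. -/
def traceEmbedding : TraceClass H →ₗᵢ[ℂ] CB (OpSpace.B H) OpSpace.complex where
  toFun t := ⟨traceFunctional t, _, traceFunctional_bound t⟩
  map_add' s t := Subtype.ext (LinearMap.ext fun b => s.finBound.trace_add_mul t.finBound b)
  map_smul' c t := Subtype.ext (LinearMap.ext fun b => t.finBound.trace_smul_mul c b)
  norm_map' t := by
    refine le_antisymm (traceFunctional_bound t).norm_le ?_
    refine (finBound_of_trace (norm_nonneg _) fun b => ?_).traceNorm_le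
    exact CB.le (⟨traceFunctional t, _, traceFunctional_bound t⟩ : CB _ _) b

/-- The operator space `T(H)` of trace-class operators: its matrix norms are those inherited from
the dual operator space of `B(H)` along `t ↦ tr(t ·)`. -/
def OpSpace.T : OpSpace.{u} :=
  (OpSpace.cb (OpSpace.B H) OpSpace.complex).comap (TraceClass H) (traceEmbedding H)

/-- The embedding of `T(H)` into the dual operator space of `B(H)`. -/
def traceInclusion : CCMap (OpSpace.T H) (OpSpace.cb (OpSpace.B H) OpSpace.complex) :=
  ⟨(traceEmbedding H).toLinearMap, fun n x => by
    rw [← OpSpace.mnorm_fin, ← OpSpace.mnorm_fin]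
    exact (OpSpace.mnorm_comap (OpSpace.cb (OpSpace.B H) OpSpace.complex) (TraceClass H)
      (traceEmbedding H) x).ge⟩

/-- The trace pairing `T(H) ⊗^ B(H) → ℂ`. -/
def trPairing : CCMap (OpSpace.proj (OpSpace.T H) (OpSpace.B H)) OpSpace.complex :=
  lift (uncurryBilin (traceInclusion H)) (uncurry_jcc (traceInclusion H))

lemma trPairing_tmul (t : TraceClass H) (b : H →L[ℂ] H) :
    trPairing H (tmul (X := OpSpace.T H) (Y := OpSpace.B H) t b) = trace (t.toOp * b) :=
  lift_tmul _ _ _ _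

end TracePairing

/-! ## Hilbert space tensor product and spatial tensor product of von Neumann algebras -/

section Spatial

variable {H : Type u} [NormedAddCommGroup H] [InnerProductSpace ℂ H] [CompleteSpace H]
variable {K : Type v} [NormedAddCommGroup K] [InnerProductSpace ℂ K] [CompleteSpace K]

variable (H K) in
/-- The Hilbert space tensor product: the completion of the algebraic tensor product for the inner
product with `⟨x ⊗ y, x' ⊗ y'⟩ = ⟨x, x'⟩ ⟨y, y'⟩`. -/
abbrev HilbertTensor : Type (max u v) := UniformSpace.Completion (H ⊗[ℂ] K)

/-- The operator `a ⊗ b` on the Hilbert space tensor product. -/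
def opTensor (a : H →L[ℂ] H) (b : K →L[ℂ] K) : HilbertTensor H K →L[ℂ] HilbertTensor H K :=
  (TensorProduct.mapL a b).completion

lemma opTensor_tmul (a : H →L[ℂ] H) (b : K →L[ℂ] K) (x : H) (y : K) :
    opTensor a b ((x ⊗ₜ[ℂ] y : H ⊗[ℂ] K) : HilbertTensor H K)
      = ((a x ⊗ₜ[ℂ] b y : H ⊗[ℂ] K) : HilbertTensor H K) :=
  ContinuousLinearMap.completion_apply_coe _ _

variable (H) in
/-- The von Neumann algebra of all bounded operators on `H`. -/
def fullVNA : VonNeumannAlgebra H where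
  toStarSubalgebra := ⊤
  centralizer_centralizer' := by
    refine Set.eq_univ_of_forall fun a b hb => ?_
    exact (hb a trivial).symm

/-- The von Neumann algebra generated by a set of operators. -/
def generatedVNA (S : Set (H →L[ℂ] H)) : VonNeumannAlgebra H where
  toStarSubalgebra :=
    StarSubalgebra.centralizer ℂ (StarSubalgebra.centralizer ℂ S : Set (H →L[ℂ] H))
  centralizer_centralizer' := by
    change Set.centralizer (Set.centralizer ((StarSubalgebra.centralizer ℂ
      (StarSubalgebra.centralizer ℂ S : Set (H →L[ℂ] H)) : StarSubalgebra ℂ (H →L[ℂ] H)) :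
      Set (H →L[ℂ] H))) = _
    rw [StarSubalgebra.coe_centralizer]
    exact Set.centralizer_centralizer_centralizer _

lemma coe_generatedVNA (S : Set (H →L[ℂ] H)) :
    (generatedVNA S : Set (H →L[ℂ] H)) = Set.centralizer (Set.centralizer (S ∪ star S)) :=
  StarSubalgebra.coe_centralizer_centralizer ℂ S

/-- The spatial tensor product `M ⊗̄ N`: the von Neumann algebra generated by the operators
`a ⊗ b` with `a ∈ M` and `b ∈ N`. -/
def spatialTensor (M : VonNeumannAlgebra H) (N : VonNeumannAlgebra K) :
    VonNeumannAlgebra (HilbertTensor H K) :=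
  generatedVNA {T | ∃ a ∈ M, ∃ b ∈ N, T = opTensor a b}

/-- The operators in a von Neumann algebra, as a subspace of `B(H)`. -/
def vnaSubmodule (M : VonNeumannAlgebra H) : Submodule ℂ (OpSpace.B H) :=
  (M.toStarSubalgebra.toSubalgebra.toSubmodule : Submodule ℂ (H →L[ℂ] H))

/-- A von Neumann algebra on `H`, as an operator subspace of `B(H)`. -/
def OpSpace.ofVNA (M : VonNeumannAlgebra H) : OpSpace.{u} :=
  (OpSpace.B H).ofSubmodule (vnaSubmodule M) (by
    have h : IsClosed (M : Set (H →L[ℂ] H)) := by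
      rw [← M.centralizer_centralizer]
      exact Set.isClosed_centralizer _
    exact h)

/-- The inclusion of a closed subspace. -/
def CCMap.subtype (X : OpSpace.{u}) (S : Submodule ℂ X) (hS : IsClosed (S : Set X)) :
    CCMap (X.ofSubmodule S hS) X :=
  ⟨S.subtype, fun n x => by
    have := hS.completeSpace_coe
    rw [← OpSpace.mnorm_fin, ← OpSpace.mnorm_fin]
    exact (X.mnorm_comap S S.subtypeₗᵢ x).ge⟩

/-- The inclusion of a von Neumann algebra on `H` into `B(H)`. -/
def vnaInclusion (M : VonNeumannAlgebra H) : CCMap (OpSpace.ofVNA M) (OpSpace.B H) :=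
  CCMap.subtype _ _ _

end Spatial

/-! ## The category `Q` -/

/-- Objects of `Q = Chu(OS, ℂ)`: two operator spaces with a complete contraction
`d : X ⊗^ Y → ℂ`. -/
structure QObj : Type (u + 1) where
  X : OpSpace.{u}
  Y : OpSpace.{u}
  d : CCMap (OpSpace.proj X Y) OpSpace.complex

/-- Morphisms of `Q`: pairs of complete contractions `f : X₁ → X₂`, `g : Y₂ → Y₁` with
`d₂ ∘ (f ⊗ id) = d₁ ∘ (id ⊗ g)`. -/
@[ext]
structure QHom (A B : QObj.{u}) where
  f : CCMap A.X B.X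
  g : CCMap B.Y A.Y
  comm : B.d.comp (CCMap.map f (CCMap.id B.Y)) = A.d.comp (CCMap.map (CCMap.id A.X) g)

lemma QHom.adjoint {A B : QObj.{u}} (h : QHom A B) (x : A.X) (y : B.Y) :
    B.d (tmul (h.f x) y) = A.d (tmul x (h.g y)) := by
  have := congrArg (fun F : CCMap _ _ => F (tmul x y)) h.comm
  have h1 := CCMap.map_tmul h.f (CCMap.id B.Y) x y
  have h2 := CCMap.map_tmul (CCMap.id A.X) h.g x y
  exact (congrArg B.d h1).symm.trans (this.trans (congrArg A.d h2))

lemma qhom_comm_iff {A B : QObj.{u}} (f : CCMap A.X B.X) (g : CCMap B.Y A.Y)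
    (h : ∀ x y, B.d (tmul (f x) y) = A.d (tmul x (g y))) :
    B.d.comp (CCMap.map f (CCMap.id B.Y)) = A.d.comp (CCMap.map (CCMap.id A.X) g) := by
  refine proj_ext fun x y => ?_
  have h1 := CCMap.map_tmul f (CCMap.id B.Y) x y
  have h2 := CCMap.map_tmul (CCMap.id A.X) g x y
  exact (congrArg B.d h1).trans ((h x y).trans (congrArg A.d h2).symm)

instance : CategoryTheory.Category QObj.{u} where
  Hom := QHom
  id A := ⟨CCMap.id A.X, CCMap.id A.Y, rfl⟩
  comp {A B C} h k := ⟨k.f.comp h.f, h.g.comp k.g, qhom_comm_iff _ _ fun x y =>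
    (k.adjoint (h.f x) y).trans (h.adjoint x (k.g y))⟩

/-- The first projection of an `ℓ^∞` direct sum. -/
def CCMap.fst (X : OpSpace.{u}) (Y : OpSpace.{v}) : CCMap (OpSpace.prod X Y) X :=
  ⟨LinearMap.fst ℂ X Y, fun n x => by
    have h := OpSpace.ofMatNorm_mnorm (X × Y) (X.mn.prod Y.mn) (fun v => by
      rw [Prod.norm_def, ← X.nrm_eq, ← Y.nrm_eq]; rfl) x
    rw [← OpSpace.mnorm_fin, ← OpSpace.mnorm_fin]
    exact (le_max_left _ _).trans h.ge⟩

namespace QObj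

/-- The bilinear form of an object of `Q`. -/
def pair (A : QObj.{u}) : A.X →ₗ[ℂ] A.Y →ₗ[ℂ] OpSpace.complex :=
  (mkBilin A.X A.Y).compr₂ A.d.toLinearMap

lemma pair_apply (A : QObj.{u}) (x : A.X) (y : A.Y) : A.pair x y = A.d (tmul x y) := rfl

lemma pair_jcc (A : QObj.{u}) : IsJCC A.pair := A.d.comp_mk_jcc

lemma norm_pair_le (A : QObj.{u}) (x : A.X) (y : A.Y) : ‖A.pair x y‖ ≤ ‖x‖ * ‖y‖ := by
  have h := A.pair_jcc.le (Matrix.of fun _ _ : Unit => x) (Matrix.of fun _ _ : Unit => y)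
  have h1 := OpSpace.complex.mn.entry_le (bilinAmp (fun x y => A.pair x y)
    (Matrix.of fun _ _ : Unit => x) (Matrix.of fun _ _ : Unit => y)) ((), ()) ((), ())
  rw [OpSpace.nrm_eq] at h1
  refine h1.trans (h.trans (le_of_eq ?_))
  rw [← OpSpace.nrm_eq, ← OpSpace.nrm_eq]
  rfl

variable (A B : QObj.{u})

/-- The pairs of completely bounded maps `f : X₁ → Y₂`, `g : X₂ → Y₁` with
`d₂(x₂ ⊗ f(x₁)) = d₁(x₁ ⊗ g(x₂))` for all `x₁`, `x₂`. -/
def tensorSubmodule :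
    Submodule ℂ (OpSpace.prod (OpSpace.cb A.X B.Y) (OpSpace.cb B.X A.Y)) :=
  ({ carrier := {p | ∀ x₁ x₂, B.pair x₂ ((p.1 : A.X →ₗ[ℂ] B.Y) x₁)
      = A.pair x₁ ((p.2 : B.X →ₗ[ℂ] A.Y) x₂)}
     add_mem' := fun {p q} hp hq x₁ x₂ => by
       have h1 := map_add (B.pair x₂) ((p.1 : A.X →ₗ[ℂ] B.Y) x₁) ((q.1 : A.X →ₗ[ℂ] B.Y) x₁)
       have h2 := map_add (A.pair x₁) ((p.2 : B.X →ₗ[ℂ] A.Y) x₂) ((q.2 : B.X →ₗ[ℂ] A.Y) x₂)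
       rw [hp, hq] at h1
       exact h1.trans h2.symm
     zero_mem' := fun x₁ x₂ => (map_zero (B.pair x₂)).trans (map_zero (A.pair x₁)).symm
     smul_mem' := fun c p hp x₁ x₂ => by
       have h1 := map_smul (B.pair x₂) c ((p.1 : A.X →ₗ[ℂ] B.Y) x₁)
       have h2 := map_smul (A.pair x₁) c ((p.2 : B.X →ₗ[ℂ] A.Y) x₂)
       rw [hp] at h1
       exact h1.trans h2.symm } : Submodule ℂ (CB A.X B.Y × CB B.X A.Y))

lemma isClosed_tensorSubmodule : IsClosed (tensorSubmodule A B : Set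
    (OpSpace.prod (OpSpace.cb A.X B.Y) (OpSpace.cb B.X A.Y))) := by
  have key : ∀ (C D : QObj.{u}) (x₁ : C.X) (x₂ : D.X),
      Continuous fun f : CB C.X D.Y => D.pair x₂ ((f : C.X →ₗ[ℂ] D.Y) x₁) := by
    intro C D x₁ x₂
    refine AddMonoidHomClass.continuous_of_bound
      (D.pair x₂ ∘ₗ LinearMap.applyₗ x₁ ∘ₗ (cbSubmodule C.X D.Y).subtype) (‖x₂‖ * ‖x₁‖)
      fun f => ?_
    refine (D.norm_pair_le x₂ _).trans ?_
    have := CB.le f x₁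
    rw [mul_assoc, mul_comm ‖x₁‖]
    exact mul_le_mul_of_nonneg_left this (norm_nonneg _)
  have h : IsClosed {p : CB A.X B.Y × CB B.X A.Y | ∀ x₁ x₂,
      B.pair x₂ ((p.1 : A.X →ₗ[ℂ] B.Y) x₁) = A.pair x₁ ((p.2 : B.X →ₗ[ℂ] A.Y) x₂)} := by
    simp only [Set.ofPred_forall]
    refine isClosed_iInter fun x₁ => isClosed_iInter fun x₂ => ?_
    exact isClosed_eq ((key A B x₁ x₂).comp continuous_fst)
      ((key B A x₂ x₁).comp continuous_snd)
  exact h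

/-- The second component of the monoidal product: the pullback of `CB(X₁, Y₂)` and `CB(X₂, Y₁)`
over `CB(X₁ ⊗^ X₂, ℂ)`. -/
def tensorY : OpSpace.{u} :=
  OpSpace.ofSubmodule _ (tensorSubmodule A B) (isClosed_tensorSubmodule A B)

/-- The trilinear form `(x₁, x₂, (f, g)) ↦ d₂(x₂ ⊗ f(x₁)) = d₁(x₁ ⊗ g(x₂))`. -/
def tensorForm : A.X →ₗ[ℂ] B.X →ₗ[ℂ] tensorY A B →ₗ[ℂ] OpSpace.complex :=
  LinearMap.mk₂ ℂ (fun x₁ x₂ => B.pair x₂ ∘ₗ LinearMap.applyₗ x₁ ∘ₗ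
      (cbSubmodule A.X B.Y).subtype ∘ₗ LinearMap.fst ℂ (CB A.X B.Y) (CB B.X A.Y) ∘ₗ
      (tensorSubmodule A B).subtype)
    (fun x x' y => LinearMap.ext fun p => by simp)
    (fun c x y => LinearMap.ext fun p => by simp)
    (fun x y y' => LinearMap.ext fun p => by simp)
    (fun c x y => LinearMap.ext fun p => by simp)

lemma tensorForm_jcc : IsJCC₃ (tensorForm A B) := by
  intro m n k x₁ x₂ z
  let z' : Matrix (Fin k) (Fin k) (CB A.X B.Y × CB B.X A.Y) :=
    z.map (tensorSubmodule A B).subtype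
  let F : Matrix (Fin k) (Fin k) (CB A.X B.Y) := z'.map Prod.fst
  have h1 := (CB.isMatCBBound F).2 m x₁
  have h2 : matCBNorm (F.map (cbSubmodule A.X B.Y).subtype) ≤ (tensorY A B).matNorm k z := by
    rw [← OpSpace.cb_mnorm]
    have h3 := ((CCMap.fst (OpSpace.cb A.X B.Y) (OpSpace.cb B.X A.Y)).comp (CCMap.subtype _
      (tensorSubmodule A B) (isClosed_tensorSubmodule A B))).contractive k z
    rw [← OpSpace.mnorm_fin] at h3
    exact h3
  have h4 := B.pair_jcc.le x₂ (bigAmp (F.map (cbSubmodule A.X B.Y).subtype) x₁)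
  have h5 : B.Y.mnorm (bigAmp (F.map (cbSubmodule A.X B.Y).subtype) x₁)
      ≤ (tensorY A B).matNorm k z * A.X.matNorm m x₁ :=
    h1.trans (mul_le_mul_of_nonneg_right h2 (A.X.matNorm_nonneg _ _))
  rw [B.X.mnorm_fin] at h4
  have h6 := h4.trans (mul_le_mul_of_nonneg_left h5 (B.X.matNorm_nonneg _ _))
  let e : Fin m × Fin n × Fin k ≃ Fin n × Fin m × Fin k :=
    ((Equiv.prodAssoc _ _ _).symm.trans
      ((Equiv.prodComm _ _).prodCongr (Equiv.refl _))).trans (Equiv.prodAssoc _ _ _)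
  refine le_trans (le_of_eq ?_) (h6.trans (le_of_eq (by ring)))
  rw [OpSpace.mnorm, OpSpace.mnorm, ← OpSpace.complex.mn.N_submatrix_equiv e]
  rfl

/-- The monoidal product of `Q`: the tensor product of the Chu construction. -/
def tensor : QObj.{u} where
  X := OpSpace.proj A.X B.X
  Y := tensorY A B
  d := lift₃ (tensorForm A B) (tensorForm_jcc A B)

lemma tensor_d (x₁ : A.X) (x₂ : B.X) (p : tensorY A B) :
    (tensor A B).d (tmul (X := OpSpace.proj A.X B.X) (Y := tensorY A B) (tmul x₁ x₂) p)
      = tensorForm A B x₁ x₂ p :=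
  lift₃_tmul _ _ _ _ _

/-- The object `(T(H), B(H), tr)`. -/
def tr (H : Type u) [NormedAddCommGroup H] [InnerProductSpace ℂ H] [CompleteSpace H] :
    QObj.{u} := ⟨OpSpace.T H, OpSpace.B H, trPairing H⟩

end QObj

end QOS

end

/-!
# Trace-class operators, bounded operators and the Chu tensor product

The idea is that `B(H ⊗₂ K)` is the space of jointly completely bounded bilinear forms on
`T(H) × T(K)`, with the matrix norms of that space; all three assertions follow from this.

From operators to forms, an operator `b` on `H ⊗₂ K` gives the form `(s, t) ↦ tr((s ⊗ t) b)`, which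
can be computed with the slice maps of `b`:
`tr((s ⊗ t) b) = tr(s · (id ⊗ tr(t ·))(b)) = tr(t · (tr(s ·) ⊗ id)(b))`
(`trace_opTensor_mul`, `trace_opTensor_mul'`). Slicing is completely bounded
(`norm_opMat_slice_le`): compressed to finitely many basis vectors of `H`, a slice is the pairing
of a matrix over `T(K)` with a compression of `b`. It follows that `s ⊗ t` is of trace class and
that `(s, t) ↦ s ⊗ t` is jointly completely contractive, which gives the map `tensorMap` from
`T(H) ⊗^ T(K)` to `T(H ⊗₂ K)`.

From forms to operators, the values of a form at matrix units are the matrix coefficients of an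
operator in the basis `eₖ ⊗ fₗ`. The operator exists because all finite sections are bounded by the
norm of the form, the matrix units of a finite orthonormal family being a contraction over the
trace class (`T_mnorm_rankOneTC_le`). This is `exists_operator_of_forms`. Since rank one operators
have dense span in the trace class, bounded bilinear forms on trace classes are determined by
their values at matrix units (`TraceClass.bilin_ext`), and so every identity between such forms is
checked there.

1. `tensorMap` is completely isometric (`mnorm_le_mnorm_tensorMap`). By Ruan's theorem, in the form
   of `exists_dual_matrix`, the norm of a matrix over `T(H) ⊗^ T(K)` is attained up to `ε` by a
   completely contractive matrix of functionals, and such a matrix comes from a contractive matrix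
   of operators on `H ⊗₂ K`. The map is onto because its range is closed and contains the rank one
   operators between elementary tensors. The case of Ruan's theorem that is needed is proved by the
   usual route: a Hahn–Banach functional, states that dominate it, obtained by a separation
   argument in finite dimension, and a factorization through these states.
2. An operator that commutes with all `a ⊗ b` commutes with the rank one operators between
   elementary tensors, so it is a scalar; hence `B(H) ⊗̄ B(K)` contains every operator.
3. The `Y`-component of the monoidal product consists of the pairs of maps `T(H) → B(K)` and
   `T(K) → B(H)` that represent the same form on `T(H) × T(K)`. Sending an operator to the pair of
   its slice maps is a completely isometric isomorphism from `B(H ⊗₂ K)` onto this space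
   (`isCompletelyIsometricIso_slicePairMap`).
-/

noncomputable section

namespace QOS

/-! ### Separation of matrix norms by completely contractive maps into matrices -/

section Duality

/-- The sandwich theorem: a superlinear function on a convex cone that is dominated by a sublinear
function admits a linear functional in between. The graph `C` of the superlinear function is a
convex cone of pairs (point, value). -/
lemma exists_linear_between {E : Type*} [AddCommGroup E] [Module ℝ E] (P : E → ℝ)
    (P_smul : ∀ c : ℝ, 0 < c → ∀ x, P (c • x) = c * P x) (P_add : ∀ x y, P (x + y) ≤ P x + P y)
    (C : Set (E × ℝ)) (C_zero : (0, 0) ∈ C) (C_add : ∀ k ∈ C, ∀ l ∈ C, k + l ∈ C)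
    (C_smul : ∀ c : ℝ, 0 < c → ∀ k ∈ C, c • k ∈ C) (h : ∀ k ∈ C, k.2 ≤ P k.1) :
    ∃ L : E →ₗ[ℝ] ℝ, (∀ x, L x ≤ P x) ∧ ∀ k ∈ C, k.2 ≤ L k.1 := by
  -- a linear function lies below `P` and above `C` if and only if it lies below `N`
  let N : E → ℝ := fun x => ⨅ k : C, (P (x + k.1.1) - k.1.2)
  have : Nonempty C := ⟨⟨_, C_zero⟩⟩
  have hb : ∀ x, BddBelow (Set.range fun k : C => P (x + k.1.1) - k.1.2) := fun x => by
    refine ⟨-P (-x), ?_⟩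
    rintro _ ⟨k, rfl⟩
    have h1 := P_add (x + k.1.1) (-x)
    rw [add_neg_cancel_comm] at h1
    have h2 := h k.1 k.2
    change -P (-x) ≤ P (x + k.1.1) - k.1.2
    linarith
  have hle : ∀ x, ∀ k ∈ C, N x ≤ P (x + k.1) - k.2 := fun x k hk => ciInf_le (hb x) ⟨k, hk⟩
  have hN_smul_le : ∀ c : ℝ, 0 < c → ∀ x, N (c • x) ≤ c * N x := fun c hc x => by
    rw [Real.mul_iInf_of_nonneg hc.le]
    refine le_ciInf fun k => ?_
    refine (hle _ _ (C_smul c hc _ k.2)).trans (le_of_eq ?_)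
    rw [Prod.smul_fst, Prod.smul_snd, ← smul_add, P_smul c hc, smul_eq_mul, mul_sub]
  obtain ⟨L, -, hL⟩ := exists_extension_of_le_sublinear (⊥ : E →ₗ.[ℝ] ℝ) N
    (fun c hc x => by
      refine le_antisymm (hN_smul_le c hc x) ?_
      have h1 := hN_smul_le c⁻¹ (inv_pos.2 hc) (c • x)
      rw [smul_smul, inv_mul_cancel₀ hc.ne', one_smul] at h1
      calc c * N x ≤ c * (c⁻¹ * N (c • x)) := by gcongr
        _ = _ := by field_simp)
    (fun x y => by
      have h1 : N (x + y) - N y ≤ N x := le_ciInf fun k => by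
        have h2 : N (x + y) - (P (x + k.1.1) - k.1.2) ≤ N y := le_ciInf fun l => by
          have h3 := hle (x + y) _ (C_add _ k.2 _ l.2)
          have h4 := P_add (x + k.1.1) (y + l.1.1)
          rw [show x + k.1.1 + (y + l.1.1) = x + y + (k.1 + l.1).1 by
            rw [Prod.fst_add]; abel] at h4
          rw [Prod.snd_add] at h3
          linarith
        linarith
      linarith)
    (fun x => by
      obtain ⟨x, hx⟩ := x
      obtain rfl : x = 0 := (Submodule.mem_bot ℝ).1 hx
      have h1 : (⊥ : E →ₗ.[ℝ] ℝ) ⟨0, hx⟩ = 0 := LinearPMap.map_zero _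
      rw [h1]
      refine le_ciInf fun k => ?_
      have := h k.1 k.2
      rw [zero_add]; linarith)
  refine ⟨L, fun x => (hL x).trans ?_, fun k hk => ?_⟩
  · have := hle x _ C_zero
    simpa using this
  · have h1 := (hL (-k.1)).trans (hle _ k hk)
    have h0 : P 0 ≤ 0 := by
      have := P_smul 2 two_pos 0
      rw [smul_zero] at this; linarith
    rw [neg_add_cancel, map_neg] at h1
    linarith

/-- The Hahn-Banach theorem for a seminorm on a space without a topology. -/
lemma exists_linear_of_seminorm {E : Type*} [AddCommGroup E] [Module ℂ E] (p : Seminorm ℂ E)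
    (x : E) : ∃ F : E →ₗ[ℂ] ℂ, (∀ y, ‖F y‖ ≤ p y) ∧ F x = p x := by
  let _ : SeminormedAddCommGroup E := p.toAddGroupSeminorm.toSeminormedAddCommGroup
  let _ : NormedSpace ℂ E := ⟨fun c y => (map_smul_eq_mul p c y).le⟩
  obtain ⟨g, hg, hgx⟩ := exists_dual_vector'' ℂ x
  exact ⟨g.toLinearMap, fun y => (g.le_opNorm y).trans
    (mul_le_of_le_one_left (norm_nonneg _) hg), hgx⟩

open scoped Matrix ComplexOrder

variable {ι κ : Type} [Fintype ι] [Fintype κ]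

/-- A positive real functional on complex matrices is given on the matrices `α α*` by a positive
matrix. -/
lemma exists_density (L : Matrix ι ι ℂ →ₗ[ℝ] ℝ)
    (hL : ∀ (κ : Type) [Fintype κ] (α : Matrix ι κ ℂ), 0 ≤ L (α * αᴴ)) :
    ∃ ρ : Matrix ι ι ℂ, ρ.PosSemidef ∧ ∀ (κ : Type) [Fintype κ] (α : Matrix ι κ ℂ),
      L (α * αᴴ) = (αᴴ * ρ * α).trace.re := by
  classical
  -- the real functional is `A ↦ Re tr(A ρ₀)`; only the Hermitian part of `ρ₀` matters on `α α*`
  let ρ₀ : Matrix ι ι ℂ := fun j i =>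
    L (Matrix.single i j 1) - Complex.I * L (Matrix.single i j Complex.I)
  have h1 : ∀ i j (a : ℂ), L (Matrix.single i j a) = (a * ρ₀ j i).re := fun i j a => by
    have h : Matrix.single i j a
        = a.re • Matrix.single i j (1 : ℂ) + a.im • Matrix.single i j Complex.I := by
      rw [Matrix.smul_single, Matrix.smul_single, ← Matrix.single_add]
      congr 1
      simp [Complex.re_add_im]
    rw [h, map_add, map_smul, map_smul]
    simp [ρ₀]
  have h2 : ∀ A : Matrix ι ι ℂ, L A = (A * ρ₀).trace.re := fun A => by
    conv_lhs => rw [Matrix.matrix_eq_sum_single A]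
    simp only [map_sum, h1, Matrix.trace, Matrix.diag, Matrix.mul_apply, Complex.re_sum]
  let ρ : Matrix ι ι ℂ := (2⁻¹ : ℂ) • (ρ₀ + ρ₀ᴴ)
  have hρ : ρ.IsHermitian := by
    rw [Matrix.IsHermitian, Matrix.conjTranspose_smul, Matrix.conjTranspose_add,
      Matrix.conjTranspose_conjTranspose, add_comm]
    simp [ρ]
  have h3 : ∀ (κ : Type) [Fintype κ] (α : Matrix ι κ ℂ),
      L (α * αᴴ) = (αᴴ * ρ * α).trace.re := by
    intro κ _ α
    have h4 : (α * αᴴ * ρ₀ᴴ).trace.re = (α * αᴴ * ρ₀).trace.re := by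
      have : (α * αᴴ * ρ₀)ᴴ = ρ₀ᴴ * (α * αᴴ) := by
        rw [Matrix.conjTranspose_mul, Matrix.conjTranspose_mul, Matrix.conjTranspose_conjTranspose]
      rw [Matrix.trace_mul_comm, ← this, Matrix.trace_conjTranspose]
      simp
    rw [Matrix.trace_mul_comm, ← Matrix.mul_assoc, h2]
    simp only [ρ, Matrix.mul_smul, Matrix.mul_add, Matrix.trace_smul, Matrix.trace_add]
    have h5 : ∀ z : ℂ, ((2⁻¹ : ℂ) • z).re = 2⁻¹ * z.re := fun z => by
      rw [smul_eq_mul, show (2⁻¹ : ℂ) = ((2⁻¹ : ℝ) : ℂ) by push_cast; rfl, Complex.re_ofReal_mul]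
    rw [h5, Complex.add_re, h4]
    ring
  refine ⟨ρ, Matrix.PosSemidef.of_dotProduct_mulVec_nonneg hρ fun x => ?_, h3⟩
  have h4 := hL Unit (Matrix.replicateCol Unit x)
  rw [h3] at h4
  have h5 : ((Matrix.replicateCol Unit x)ᴴ * ρ * Matrix.replicateCol Unit x).trace
      = star x ⬝ᵥ ρ.mulVec x := by
    rw [Matrix.mul_assoc]
    simp [Matrix.trace, Matrix.mul_apply, dotProduct, Matrix.mulVec]
  rw [h5] at h4
  rw [Complex.le_def]
  refine ⟨h4, ?_⟩
  have h6 : star (star x ⬝ᵥ ρ.mulVec x) = star x ⬝ᵥ ρ.mulVec x := by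
    conv_rhs => rw [Matrix.star_dotProduct, Matrix.star_mulVec, hρ.eq, ← Matrix.dotProduct_mulVec]
  have h7 := congrArg Complex.im h6
  simp only [Complex.star_def, Complex.conj_im] at h7
  simp only [Complex.zero_im]; linarith

open scoped MatrixOrder in
lemma exists_isUnit_factor [DecidableEq ι] {ρ : Matrix ι ι ℂ} (h : ρ.PosDef) :
    ∃ B : Matrix ι ι ℂ, IsUnit B ∧ ρ = Bᴴ * B := by
  obtain ⟨B, hB⟩ := CStarAlgebra.nonneg_iff_eq_star_mul_self.1
    (Matrix.nonneg_iff_posSemidef.2 h.posSemidef)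
  refine ⟨B, ?_, hB⟩
  have h1 := h.isUnit
  rw [hB, Matrix.isUnit_iff_isUnit_det, Matrix.det_mul] at h1
  rw [Matrix.isUnit_iff_isUnit_det]
  exact isUnit_of_mul_isUnit_right h1

lemma scalarNorm_mul_conjTranspose (α : Matrix ι κ ℂ) :
    scalarNorm (α * αᴴ) = scalarNorm α ^ 2 := by
  classical
  rw [← scalarNorm_conjTranspose α]
  have h := Matrix.l2_opNorm_conjTranspose_mul_self (𝕜 := ℂ) αᴴ
  rw [Matrix.conjTranspose_conjTranspose] at h
  rw [sq]; exact h

/-- A matrix with `2 Re ⟨η, A ξ⟩ ≤ ‖η‖² + ‖ξ‖²` is a contraction. -/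
lemma scalarNorm_le_one_of_re {A : Matrix ι κ ℂ}
    (h : ∀ (η : ι → ℂ) (ξ : κ → ℂ), 2 * (∑ i, ∑ j, (starRingEnd ℂ) (η i) * A i j * ξ j).re
      ≤ ∑ i, ‖η i‖ ^ 2 + ∑ j, ‖ξ j‖ ^ 2) : scalarNorm A ≤ 1 := by
  refine scalarNorm_le_of_sum_sq zero_le_one fun ξ => ?_
  have h1 := h (A.mulVec ξ) ξ
  have h2 : ∑ i, ∑ j, (starRingEnd ℂ) (A.mulVec ξ i) * A i j * ξ j
      = ((∑ i, ‖A.mulVec ξ i‖ ^ 2 : ℝ) : ℂ) := by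
    push_cast
    refine Finset.sum_congr rfl fun i _ => ?_
    rw [← Complex.conj_mul', Matrix.mulVec, dotProduct, Finset.mul_sum]
    exact Finset.sum_congr rfl fun j _ => mul_assoc _ _ _
  rw [h2, Complex.ofReal_re] at h1
  linarith

lemma norm_sum_conj_mul_le (A : Matrix ι κ ℂ) (η : ι → ℂ) (ξ : κ → ℂ) :
    ‖∑ i, ∑ j, (starRingEnd ℂ) (η i) * A i j * ξ j‖
      ≤ √(∑ i, ‖η i‖ ^ 2) * scalarNorm A * √(∑ j, ‖ξ j‖ ^ 2) := by
  have h1 : ∀ i, ∑ j, (starRingEnd ℂ) (η i) * A i j * ξ j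
      = (starRingEnd ℂ) (η i) * A.mulVec ξ i := fun i => by
    rw [Matrix.mulVec, dotProduct, Finset.mul_sum]
    exact Finset.sum_congr rfl fun j _ => mul_assoc _ _ _
  simp only [h1]
  refine (norm_sum_le _ _).trans ?_
  simp only [norm_mul, RCLike.norm_conj]
  refine (Real.sum_mul_le_sqrt_mul_sqrt _ _ _).trans ?_
  rw [mul_assoc]
  gcongr
  refine Real.sqrt_le_iff.2 ⟨by have := scalarNorm_nonneg A; positivity, ?_⟩
  rw [mul_pow, Real.sq_sqrt (by positivity)]
  exact sum_sq_mulVec_le A ξ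

lemma trace_conjTranspose_mul_self_re (α : Matrix ι κ ℂ) :
    (αᴴ * α).trace.re = ∑ i, ∑ j, ‖α i j‖ ^ 2 := by
  rw [Finset.sum_comm]
  simp only [Matrix.trace, Matrix.diag, Matrix.mul_apply, Matrix.conjTranspose_apply,
    Complex.re_sum]
  refine Finset.sum_congr rfl fun j _ => Finset.sum_congr rfl fun i _ => ?_
  rw [Complex.star_def, Complex.conj_mul']
  norm_cast

/-- A contractive functional `F` on the `ι × ι` matrices over `V` is dominated by positive matrices
`ρ` and `σ` of trace at most one: `2 Re F(α v β) ≤ tr(α* ρ α) + tr(β σ β*)` whenever `‖v‖ ≤ 1`.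
The functional is separated from the cone of the triples `(α α*, β* β, 2 Re F(α v β))`. -/
lemma exists_dominating_densities [DecidableEq ι] {V : Type*} [AddCommGroup V] [Module ℂ V]
    (M : MatNorm V) (F : Matrix ι ι V →ₗ[ℂ] ℂ) (hF : ∀ v, ‖F v‖ ≤ M.N v) :
    ∃ ρ σ : Matrix ι ι ℂ, ρ.PosSemidef ∧ σ.PosSemidef ∧ ρ.trace.re ≤ 1 ∧ σ.trace.re ≤ 1 ∧
      ∀ (κ : Type) [Fintype κ] (α : Matrix ι κ ℂ) (v : Matrix κ κ V) (β : Matrix κ ι ℂ),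
        M.N v ≤ 1 → 2 * (F (matMul α v β)).re
          ≤ (αᴴ * ρ * α).trace.re + (β * σ * βᴴ).trace.re := by
  let C : Set ((Matrix ι ι ℂ × Matrix ι ι ℂ) × ℝ) := {k | ∃ (κ : Type) (_ : Fintype κ)
    (α : Matrix ι κ ℂ) (v : Matrix κ κ V) (β : Matrix κ ι ℂ), M.N v ≤ 1 ∧
    k = ((α * αᴴ, βᴴ * β), 2 * (F (matMul α v β)).re)}
  have hone : scalarNorm (1 : Matrix ι ι ℂ) ≤ 1 := by
    simpa using scalarNorm_smul_one_le (n := ι) 1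
  obtain ⟨L, hLP, hLC⟩ := exists_linear_between
    (fun x : Matrix ι ι ℂ × Matrix ι ι ℂ => scalarNorm x.1 + scalarNorm x.2)
    (fun c hc x => by
      have h : ∀ A : Matrix ι ι ℂ, scalarNorm (c • A) = c * scalarNorm A := fun A => by
        have h1 := scalarNorm_smul (c : ℂ) A
        rw [Complex.norm_real, Real.norm_of_nonneg hc.le] at h1
        rw [← h1]; congr 1
      rw [Prod.smul_fst, Prod.smul_snd, h, h, mul_add])
    (fun x y => by
      have h1 := scalarNorm_add_le x.1 y.1
      have h2 := scalarNorm_add_le x.2 y.2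
      rw [Prod.fst_add, Prod.snd_add]; linarith) C
    (by
      refine ⟨Unit, inferInstance, 0, 0, 0, by rw [M.N_zero]; exact zero_le_one, ?_⟩
      have h : matMul (0 : Matrix ι Unit ℂ) (0 : Matrix Unit Unit V) (0 : Matrix Unit ι ℂ) = 0 := by
        ext; simp [matMul]
      rw [h, map_zero]
      simp only [Matrix.zero_mul, Matrix.mul_zero, Complex.zero_re, mul_zero]
      rfl)
    (by
      rintro _ ⟨κ, _, α, v, β, hv, rfl⟩ _ ⟨κ', _, α', v', β', hv', rfl⟩
      refine ⟨κ ⊕ κ', inferInstance, Matrix.fromCols α α', Matrix.fromBlocks v 0 0 v',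
        Matrix.fromRows β β', (M.blocks_le v v').trans (max_le hv hv'), ?_⟩
      rw [matMul_fromCols, map_add, Complex.add_re,
        Matrix.conjTranspose_fromCols_eq_fromRows_conjTranspose,
        Matrix.conjTranspose_fromRows_eq_fromCols_conjTranspose, Matrix.fromCols_mul_fromRows,
        Matrix.fromCols_mul_fromRows, mul_add]
      rfl)
    (by
      rintro c hc _ ⟨κ, _, α, v, β, hv, rfl⟩
      have hs : ((√c : ℝ) : ℂ) * ((√c : ℝ) : ℂ) = c := by
        rw [← Complex.ofReal_mul, Real.mul_self_sqrt hc.le]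
      refine ⟨κ, inferInstance, ((√c : ℝ) : ℂ) • α, v, ((√c : ℝ) : ℂ) • β, hv, ?_⟩
      have h1 : matMul (((√c : ℝ) : ℂ) • α) v (((√c : ℝ) : ℂ) • β) = (c : ℂ) • matMul α v β := by
        ext i j
        simp only [matMul, Matrix.smul_apply, smul_eq_mul, Finset.smul_sum, smul_smul]
        refine Finset.sum_congr rfl fun k _ => Finset.sum_congr rfl fun l _ => ?_
        rw [← hs]; congr 1; ring
      have h2 : ∀ A : Matrix ι ι ℂ, (c : ℂ) • A = c • A := fun A => by ext; simp
      rw [h1, map_smul, smul_eq_mul, Complex.re_ofReal_mul, Matrix.conjTranspose_smul,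
        Matrix.conjTranspose_smul, Matrix.smul_mul, Matrix.smul_mul, Matrix.mul_smul,
        Matrix.mul_smul, smul_smul, smul_smul, Complex.star_def, Complex.conj_ofReal, hs, h2, h2]
      simp only [Prod.smul_mk, smul_eq_mul]
      congr 1; ring)
    (by
      rintro _ ⟨κ, _, α, v, β, hv, rfl⟩
      have h1 : 2 * (F (matMul α v β)).re ≤ 2 * (scalarNorm α * scalarNorm β) := by
        have h2 := (Complex.re_le_norm _).trans ((hF _).trans (M.mul_le α v β))
        have h3 : scalarNorm α * M.N v * scalarNorm β ≤ scalarNorm α * 1 * scalarNorm β := by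
          gcongr
          · exact scalarNorm_nonneg _
          · exact scalarNorm_nonneg _
        linarith
      have h4 := scalarNorm_mul_conjTranspose α
      have h5 := scalarNorm_mul_conjTranspose βᴴ
      rw [Matrix.conjTranspose_conjTranspose, scalarNorm_conjTranspose] at h5
      change _ ≤ scalarNorm (α * αᴴ) + scalarNorm (βᴴ * β)
      rw [h4, h5]
      linarith [sq_nonneg (scalarNorm α - scalarNorm β)])
  let L₁ : Matrix ι ι ℂ →ₗ[ℝ] ℝ := L ∘ₗ LinearMap.inl ℝ _ _
  let L₂ : Matrix ι ι ℂ →ₗ[ℝ] ℝ := L ∘ₗ LinearMap.inr ℝ _ _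
  have hL : ∀ A B, L (A, B) = L₁ A + L₂ B := fun A B => by
    have : (A, B) = (A, 0) + (0, B) := by simp
    rw [this, map_add]; rfl
  have key : ∀ (κ : Type) [Fintype κ] (α : Matrix ι κ ℂ) (v : Matrix κ κ V) (β : Matrix κ ι ℂ),
      M.N v ≤ 1 → 2 * (F (matMul α v β)).re ≤ L₁ (α * αᴴ) + L₂ (βᴴ * β) :=
    fun κ _ α v β hv => by
      rw [← hL]; exact hLC _ ⟨κ, inferInstance, α, v, β, hv, rfl⟩
  have hz : ∀ (κ : Type) [Fintype κ] (α : Matrix ι κ ℂ) (β : Matrix κ ι ℂ),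
      0 ≤ L₁ (α * αᴴ) + L₂ (βᴴ * β) := fun κ _ α β => by
    have h := key κ α 0 β (by rw [M.N_zero]; exact zero_le_one)
    have h0 : matMul α (0 : Matrix κ κ V) β = 0 := by ext; simp [matMul]
    rw [h0, map_zero] at h
    simpa using h
  obtain ⟨ρ, hρ, hρL⟩ := exists_density L₁ fun κ _ α => by simpa using hz κ α 0
  obtain ⟨σ, hσ, hσL⟩ := exists_density L₂ fun κ _ α => by simpa using hz κ 0 αᴴ
  refine ⟨ρ, σ, hρ, hσ, ?_, ?_, fun κ _ α v β hv => ?_⟩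
  · have h1 := hρL ι 1
    have h2 := hLP (1, 0)
    rw [hL, map_zero, add_zero] at h2
    simp only [Matrix.conjTranspose_one, one_mul, mul_one] at h1
    rw [← h1]
    simp only [scalarNorm_zero] at h2
    linarith
  · have h1 := hσL ι 1
    have h2 := hLP (0, 1)
    rw [hL, map_zero, zero_add] at h2
    simp only [Matrix.conjTranspose_one, one_mul, mul_one] at h1
    rw [← h1]
    simp only [scalarNorm_zero] at h2
    linarith
  · have h1 := key κ α v β hv
    have h2 := hσL κ βᴴ
    rw [Matrix.conjTranspose_conjTranspose] at h2
    rwa [hρL, h2] at h1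

/-- A positive matrix of trace at most one is dominated by `B* B` for an invertible matrix `B` of
Hilbert-Schmidt norm close to one: add a small multiple of the identity. -/
lemma exists_isUnit_dominating [DecidableEq ι] {ρ : Matrix ι ι ℂ} (hρ : ρ.PosSemidef)
    (ht : ρ.trace.re ≤ 1) {δ : ℝ} (hδ : 0 < δ) :
    ∃ B : Matrix ι ι ℂ, IsUnit B ∧ ∑ i, ∑ j, ‖B i j‖ ^ 2 ≤ 1 + δ ∧
      ∀ (κ : Type) [Fintype κ] (α : Matrix ι κ ℂ),
        (αᴴ * ρ * α).trace.re ≤ ∑ i, ∑ j, ‖(B * α) i j‖ ^ 2 := by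
  let ε : ℝ := δ / (Fintype.card ι + 1)
  have hε : 0 < ε := by positivity
  have hεδ : ε * Fintype.card ι ≤ δ := by
    have h1 : ε * (Fintype.card ι + 1) = δ := by
      have : (Fintype.card ι + 1 : ℝ) ≠ 0 := by positivity
      simp only [ε]; field_simp
    linarith
  have hε' : ((ε : ℂ) • (1 : Matrix ι ι ℂ)).PosDef :=
    Matrix.PosDef.smul Matrix.PosDef.one (by exact_mod_cast hε)
  obtain ⟨B, hB, hBρ⟩ := exists_isUnit_factor (hε'.add_posSemidef hρ)
  refine ⟨B, hB, ?_, fun κ _ α => ?_⟩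
  · rw [← trace_conjTranspose_mul_self_re, ← hBρ, Matrix.trace_add, Matrix.trace_smul,
      Matrix.trace_one, smul_eq_mul, Complex.add_re, Complex.re_ofReal_mul, Complex.natCast_re]
    linarith
  · have h1 : (B * α)ᴴ * (B * α) = (ε : ℂ) • (αᴴ * α) + αᴴ * ρ * α := by
      rw [Matrix.conjTranspose_mul, Matrix.mul_assoc, ← Matrix.mul_assoc Bᴴ, ← hBρ,
        Matrix.add_mul, Matrix.mul_add, Matrix.smul_mul, Matrix.one_mul, Matrix.mul_smul,
        Matrix.mul_assoc αᴴ ρ]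
    rw [← trace_conjTranspose_mul_self_re, h1, Matrix.trace_add, Matrix.trace_smul, smul_eq_mul,
      Complex.add_re, Complex.re_ofReal_mul, trace_conjTranspose_mul_self_re]
    have : 0 ≤ ε * ∑ i, ∑ j, ‖α i j‖ ^ 2 := by positivity
    linarith

lemma map_matMul_eq_sum [DecidableEq ι] {V : Type*} [AddCommGroup V] [Module ℂ V]
    (G : Matrix ι ι V →ₗ[ℂ] ℂ) (γ : Matrix ι κ ℂ) (v : Matrix κ κ V) (δ : Matrix κ ι ℂ) :
    G (matMul γ v δ) = ∑ p : κ × ι, ∑ q : κ × ι,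
      γ p.2 p.1 * G (Matrix.single p.2 q.2 (v p.1 q.1)) * δ q.1 q.2 := by
  let g : ι → ι → V →ₗ[ℂ] ℂ := fun i j => G ∘ₗ Matrix.singleLinearMap ℂ i j
  have h : ∀ w, G w = ∑ i, ∑ j, g i j (w i j) := fun w => by
    conv_lhs => rw [Matrix.matrix_eq_sum_single w]
    simp only [map_sum]
    rfl
  simp only [h, matMul, map_sum, map_smul, Fintype.sum_prod_type]
  rw [sum4_comm]
  refine Finset.sum_congr rfl fun k _ => ?_
  rw [Finset.sum_comm]
  refine Finset.sum_congr rfl fun a _ => Finset.sum_congr rfl fun l _ =>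
    Finset.sum_congr rfl fun b _ => ?_
  rw [← h, smul_eq_mul]
  change _ = γ a k * g a b (v k l) * δ l b
  ring

/-- The matrix norms of an operator space are determined by the completely contractive maps into
matrices: an operator space embeds completely isometrically into its bidual. Conjugation by the
inverse square roots of the dominating densities turns a norming functional into such a map. -/
theorem exists_dual_matrix (X : OpSpace.{u}) (v₀ : Matrix ι ι X) {δ : ℝ} (hδ : 0 < δ) :
    ∃ φ : Matrix ι ι (X →ₗ[ℂ] OpSpace.complex), IsMatCBBound φ 1 ∧
      X.mnorm v₀ ≤ (1 + δ) * OpSpace.complex.mnorm (bigAmp φ v₀) := by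
  classical
  let p : Seminorm ℂ (Matrix ι ι X) := Seminorm.of X.mnorm (X.mn.add_le) (X.mn.N_smul)
  obtain ⟨F, hF, hFv⟩ := exists_linear_of_seminorm p v₀
  obtain ⟨ρ, σ, hρ, hσ, hρt, hσt, hdom⟩ := exists_dominating_densities X.mn F hF
  obtain ⟨B, hB, hBt, hBρ⟩ := exists_isUnit_dominating hρ hρt hδ
  obtain ⟨D, hD, hDt, hDσ⟩ := exists_isUnit_dominating hσ hσt hδ
  have hB1 : B * B⁻¹ = 1 := Matrix.mul_nonsing_inv B ((Matrix.isUnit_iff_isUnit_det B).1 hB)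
  have hB2 : B⁻¹ * B = 1 := Matrix.nonsing_inv_mul B ((Matrix.isUnit_iff_isUnit_det B).1 hB)
  have hD1 : D * D⁻¹ = 1 := Matrix.mul_nonsing_inv D ((Matrix.isUnit_iff_isUnit_det D).1 hD)
  -- `2 Re G(γ v ζ) ≤ ‖γ‖₂² + ‖ζ‖₂²` in Hilbert-Schmidt norms if `‖v‖ ≤ 1`, so the entries of `G`
  -- form a complete contraction
  let G : Matrix ι ι X →ₗ[ℂ] ℂ :=
    { toFun := fun w => F (matMul B⁻¹ w (D⁻¹)ᴴ)
      map_add' := fun x y => by rw [matMul_add, map_add]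
      map_smul' := fun c x => by
        have : matMul B⁻¹ (c • x) (D⁻¹)ᴴ = c • matMul B⁻¹ x (D⁻¹)ᴴ := by
          ext i j
          simp only [matMul, Matrix.smul_apply, Finset.smul_sum]
          refine Finset.sum_congr rfl fun k _ => Finset.sum_congr rfl fun l _ => ?_
          rw [smul_comm]
        rw [this, map_smul, RingHom.id_apply] }
  have hG : ∀ (κ : Type) [Fintype κ] (γ : Matrix ι κ ℂ) (v : Matrix κ κ X) (ξ : Matrix κ ι ℂ),
      G (matMul γ v ξ) = F (matMul (B⁻¹ * γ) v (ξ * (D⁻¹)ᴴ)) := fun κ _ γ v ξ => by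
    change F (matMul B⁻¹ (matMul γ v ξ) (D⁻¹)ᴴ) = _
    rw [matMul_matMul]
  let φ : Matrix ι ι (X →ₗ[ℂ] ℂ) := fun a b => G ∘ₗ Matrix.singleLinearMap ℂ a b
  have hφ : ∀ (κ : Type) [Fintype κ] (v : Matrix κ κ X), X.mnorm v ≤ 1 →
      scalarNorm (Matrix.of fun p q : κ × ι => φ p.2 q.2 (v p.1 q.1)) ≤ 1 := by
    intro κ _ v hv
    refine scalarNorm_le_one_of_re fun η ξ => ?_
    let γ : Matrix ι κ ℂ := fun a k => (starRingEnd ℂ) (η (k, a))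
    let ζ : Matrix κ ι ℂ := fun l b => ξ (l, b)
    have h1 := map_matMul_eq_sum G γ v ζ
    have h2 := hdom κ (B⁻¹ * γ) v (ζ * (D⁻¹)ᴴ) hv
    rw [← hG, h1] at h2
    refine h2.trans (add_le_add ?_ ?_)
    · refine (hBρ κ (B⁻¹ * γ)).trans (le_of_eq ?_)
      rw [← Matrix.mul_assoc, hB1, Matrix.one_mul, Fintype.sum_prod_type, Finset.sum_comm]
      simp [γ]
    · have h3 := hDσ κ (ζ * (D⁻¹)ᴴ)ᴴ
      rw [Matrix.conjTranspose_conjTranspose] at h3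
      refine h3.trans (le_of_eq ?_)
      rw [Matrix.conjTranspose_mul, Matrix.conjTranspose_conjTranspose, ← Matrix.mul_assoc, hD1,
        Matrix.one_mul, Fintype.sum_prod_type, Finset.sum_comm]
      exact Finset.sum_congr rfl fun l _ => Finset.sum_congr rfl fun b _ =>
        congrArg (· ^ 2) (norm_star (ξ (l, b)))
  refine ⟨φ, ⟨zero_le_one, fun n x => ?_⟩, ?_⟩
  · rw [one_mul, ← X.mnorm_fin]
    rcases (X.mn.N_nonneg x).eq_or_lt with h0 | h0
    · have hx : x = 0 := X.eq_zero_of_matNorm n x (by rw [← X.mnorm_fin]; exact h0.symm)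
      have : bigAmp (Y := OpSpace.complex) φ x = 0 := by
        ext i j; rw [hx]; exact map_zero (φ i.2 j.2)
      rw [this, OpSpace.mnorm, MatNorm.N_zero]
      exact X.mn.N_nonneg x
    · have h1 := hφ _ ((((X.mn.N x)⁻¹ : ℝ) : ℂ) • x) (by
        rw [OpSpace.mnorm, MatNorm.N_smul, Complex.norm_real, Real.norm_of_nonneg (by positivity),
          inv_mul_cancel₀ h0.ne'])
      have h2 : (Matrix.of fun p q : Fin n × ι =>
          φ p.2 q.2 (((((X.mn.N x)⁻¹ : ℝ) : ℂ) • x) p.1 q.1))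
          = (((X.mn.N x)⁻¹ : ℝ) : ℂ) • (Matrix.of fun p q : Fin n × ι => φ p.2 q.2 (x p.1 q.1)) := by
        ext p q
        simp only [Matrix.of_apply, Matrix.smul_apply, map_smul]
      rw [h2, scalarNorm_smul, Complex.norm_real, Real.norm_of_nonneg (by positivity),
        inv_mul_le_iff₀ h0, mul_one] at h1
      exact (OpSpace.ofMatNorm_mnorm _ _ _ _).trans_le h1
  -- `F(v₀) = G(B v₀ D*)` is the pairing of `φ(v₀)` with vectors of square norm at most `1 + δ`
  · have h1 := map_matMul_eq_sum G B v₀ Dᴴ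
    have h2 : matMul (B⁻¹ * B) v₀ (Dᴴ * (D⁻¹)ᴴ) = v₀ := by
      rw [hB2, ← Matrix.conjTranspose_mul, Matrix.nonsing_inv_mul D
        ((Matrix.isUnit_iff_isUnit_det D).1 hD), Matrix.conjTranspose_one]
      have := matMul_smul_one (1 : ℂ) v₀
      rwa [one_smul, one_smul] at this
    rw [hG, h2, hFv] at h1
    have h3 := norm_sum_conj_mul_le (Matrix.of fun p q : ι × ι => φ p.2 q.2 (v₀ p.1 q.1))
      (fun p => (starRingEnd ℂ) (B p.2 p.1)) (fun q => Dᴴ q.1 q.2)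
    simp only [Complex.conj_conj] at h3
    have h4 : ‖((p v₀ : ℝ) : ℂ)‖ ≤ _ := (congrArg norm h1).trans_le h3
    have hp : p v₀ = X.mnorm v₀ := rfl
    rw [Complex.norm_real, hp, Real.norm_of_nonneg (show 0 ≤ X.mnorm v₀ from X.mn.N_nonneg v₀)] at h4
    refine h4.trans ?_
    have h5 : √(∑ p : ι × ι, ‖(starRingEnd ℂ) (B p.2 p.1)‖ ^ 2) ≤ √(1 + δ) := by
      refine Real.sqrt_le_sqrt (le_trans (le_of_eq ?_) hBt)
      rw [Fintype.sum_prod_type, Finset.sum_comm]; simp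
    have h6 : √(∑ p : ι × ι, ‖Dᴴ p.1 p.2‖ ^ 2) ≤ √(1 + δ) := by
      refine Real.sqrt_le_sqrt (le_trans (le_of_eq ?_) hDt)
      rw [Fintype.sum_prod_type, Finset.sum_comm]; simp
    have h7 : OpSpace.complex.mnorm (bigAmp (Y := OpSpace.complex) φ v₀)
        = scalarNorm (Matrix.of fun p q : ι × ι => φ p.2 q.2 (v₀ p.1 q.1)) :=
      OpSpace.ofMatNorm_mnorm _ _ _ _
    rw [h7]
    have h8 := scalarNorm_nonneg (Matrix.of fun p q : ι × ι => φ p.2 q.2 (v₀ p.1 q.1))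
    calc _ ≤ √(1 + δ) * scalarNorm (Matrix.of fun p q : ι × ι => φ p.2 q.2 (v₀ p.1 q.1))
          * √(1 + δ) := by gcongr
      _ = (√(1 + δ) * √(1 + δ))
          * scalarNorm (Matrix.of fun p q : ι × ι => φ p.2 q.2 (v₀ p.1 q.1)) := by ring
      _ = _ := by rw [Real.mul_self_sqrt (by positivity)]

end Duality

/-! ### Rank one operators span the trace-class operators -/

section RankOne

open InnerProductSpace

variable {H : Type u} [NormedAddCommGroup H] [InnerProductSpace ℂ H] [CompleteSpace H]

lemma finBound_rankOne (x y : H) : FinBound (rankOne ℂ x y) (‖x‖ * ‖y‖) := by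
  refine ⟨by positivity, fun σ s a b => ?_⟩
  have h : ∑ i ∈ s, ⟪b i, rankOne ℂ x y (a i)⟫_ℂ = ⟪y, finRank s a b x⟫_ℂ := by
    rw [finRank_apply, inner_sum]
    refine Finset.sum_congr rfl fun i _ => ?_
    rw [rankOne_apply, inner_smul_right, inner_smul_right, mul_comm]
  rw [h]
  calc _ ≤ ‖y‖ * (‖finRank s a b‖ * ‖x‖) := (norm_inner_le_norm _ _).trans (by
        gcongr; exact ContinuousLinearMap.le_opNorm _ _)
    _ = _ := by ring

/-- The rank one operator `z ↦ ⟨y, z⟩ x` as a trace-class operator. -/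
def rankOneTC (x y : H) : TraceClass H := TraceClass.mk _ (finBound_rankOne x y).isTraceClass

lemma toOp_rankOneTC (x y : H) : (rankOneTC x y).toOp = rankOne ℂ x y := rfl

lemma norm_rankOneTC_le (x y : H) : ‖rankOneTC x y‖ ≤ ‖x‖ * ‖y‖ :=
  (finBound_rankOne x y).traceNorm_le

lemma rankOneTC_add_left (x x' y : H) :
    rankOneTC (x + x') y = rankOneTC x y + rankOneTC x' y :=
  TraceClass.toOp_injective (by simp [toOp_rankOneTC])

lemma rankOneTC_add_right (x y y' : H) :
    rankOneTC x (y + y') = rankOneTC x y + rankOneTC x y' :=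
  TraceClass.toOp_injective (by simp [toOp_rankOneTC])

lemma rankOneTC_smul_left (c : ℂ) (x y : H) : rankOneTC (c • x) y = c • rankOneTC x y :=
  TraceClass.toOp_injective (by simp [toOp_rankOneTC])

lemma rankOneTC_smul_right (c : ℂ) (x y : H) :
    rankOneTC x (c • y) = (starRingEnd ℂ) c • rankOneTC x y :=
  TraceClass.toOp_injective (by simp [toOp_rankOneTC])

lemma continuous_rankOneTC_left (y : H) : Continuous fun x : H => rankOneTC x y :=
  AddMonoidHomClass.continuous_of_bound
    (AddMonoidHom.mk' (fun x : H => rankOneTC x y) fun x x' => rankOneTC_add_left x x' y) ‖y‖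
    fun x => (norm_rankOneTC_le x y).trans (mul_comm _ _).le

lemma continuous_rankOneTC_right (x : H) : Continuous fun y : H => rankOneTC x y :=
  AddMonoidHomClass.continuous_of_bound
    (AddMonoidHom.mk' (fun y : H => rankOneTC x y) fun y y' => rankOneTC_add_right x y y') ‖x‖
    fun y => norm_rankOneTC_le x y

lemma trace_rankOne_mul (x y : H) (b : H →L[ℂ] H) : trace (rankOne ℂ x y * b) = ⟪y, b x⟫_ℂ := by
  have h := (stdBasis H).hasSum_inner_mul_inner (ContinuousLinearMap.adjoint b y) x
  rw [ContinuousLinearMap.adjoint_inner_left] at h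
  refine HasSum.tsum_eq (h.congr_fun fun k => ?_)
  rw [mul_apply_eq_comp, rankOne_apply, inner_smul_right, ContinuousLinearMap.adjoint_inner_left]

/-- Trace-class operators are sums of rank one operators that converge in the trace norm: with
`A = √|T|` and the polar decomposition `T = U A²`, one has `T = ∑ |U A e⟩⟨A e|`. -/
lemma TraceClass.exists_hasSum_rankOneTC (t : TraceClass H) :
    ∃ x y : basisSet H → H, HasSum (fun k => rankOneTC (x k) (y k)) t := by
  obtain ⟨U, hU, hUT, -⟩ := exists_polar t.toOp
  set A := CFC.sqrt (CFC.abs t.toOp) with hA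
  have hsa : IsSelfAdjoint A := IsSelfAdjoint.of_nonneg (CFC.sqrt_nonneg _)
  have hAA : ∀ x, A (A x) = CFC.abs t.toOp x := fun x =>
    congrArg (fun B : H →L[ℂ] H => B x)
      (CFC.sqrt_mul_sqrt_self (CFC.abs t.toOp) (CFC.abs_nonneg t.toOp))
  have hAin : ∀ x y, ⟪A x, y⟫_ℂ = ⟪x, A y⟫_ℂ := fun x y => by
    rw [← ContinuousLinearMap.adjoint_inner_left, hsa.adjoint_eq]
  let e := stdBasis H
  have hs : Summable fun k => rankOneTC (U (A (e k))) (A (e k)) := by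
    have ht : IsTraceClass t.toOp := t.2
    refine Summable.of_norm_bounded ht fun k => ?_
    have h5 : (⟪e k, CFC.abs t.toOp (e k)⟫_ℂ).re = ‖A (e k)‖ ^ 2 := by
      rw [← hAA, ← hAin]
      exact inner_self_eq_norm_sq (𝕜 := ℂ) _
    refine (norm_rankOneTC_le _ _).trans ?_
    calc ‖U (A (e k))‖ * ‖A (e k)‖ ≤ (1 * ‖A (e k)‖) * ‖A (e k)‖ := by
          gcongr; exact (U.le_opNorm _).trans (by gcongr)
      _ = _ := by rw [one_mul, ← sq]; exact h5.symm
  refine ⟨fun k => U (A (e k)), fun k => A (e k), ?_⟩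
  have hsum := hs.hasSum
  convert hsum using 1
  refine TraceClass.toOp_injective (ContinuousLinearMap.ext fun z => ext_inner_left ℂ fun w => ?_)
  have hcont : Continuous fun s : TraceClass H => ⟪w, s.toOp z⟫_ℂ := by
    refine AddMonoidHomClass.continuous_of_bound (AddMonoidHom.mk'
      (fun s : TraceClass H => ⟪w, s.toOp z⟫_ℂ) fun s s' => by simp)
      (‖w‖ * ‖z‖) fun s => ?_
    calc _ ≤ ‖w‖ * (‖s‖ * ‖z‖) := (norm_inner_le_norm _ _).trans (by
          gcongr
          exact (ContinuousLinearMap.le_opNorm _ _).trans (by gcongr; exact s.finBound.norm_le))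
      _ = _ := by ring
  have h1 := hsum.map (AddMonoidHom.mk' (fun s : TraceClass H => ⟪w, s.toOp z⟫_ℂ)
    fun s s' => by simp) hcont
  have h2 := e.hasSum_inner_mul_inner (A (ContinuousLinearMap.adjoint U w)) (A z)
  have h3 : ⟪A (ContinuousLinearMap.adjoint U w), A z⟫_ℂ = ⟪w, t.toOp z⟫_ℂ := by
    rw [hAin, hAA, ContinuousLinearMap.adjoint_inner_left, ← hUT]
  rw [h3] at h2
  refine h2.unique (h1.congr_fun fun k => ?_)
  change _ = ⟪w, (rankOneTC (U (A (e k))) (A (e k))).toOp z⟫_ℂ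
  simp only [toOp_rankOneTC, rankOne_apply, inner_smul_right, hAin,
    ContinuousLinearMap.adjoint_inner_left]
  rw [mul_comm]

/-- A closed subspace of `T(H)` that contains the rank one operators between the vectors of a total
set is everything. -/
lemma TraceClass.eq_top_of_rankOneTC_mem {p : Submodule ℂ (TraceClass H)}
    (hp : IsClosed (p : Set (TraceClass H))) {D : Set H}
    (hD : (Submodule.span ℂ D).topologicalClosure = ⊤)
    (h : ∀ x ∈ D, ∀ y ∈ D, rankOneTC x y ∈ p) : p = ⊤ := by
  have h1 : ∀ y ∈ D, ∀ x, rankOneTC x y ∈ p := fun y hy => by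
    let q : Submodule ℂ H :=
      { carrier := {x | rankOneTC x y ∈ p}
        add_mem' := fun {a b} ha hb => by
          change rankOneTC (a + b) y ∈ p
          rw [rankOneTC_add_left]; exact p.add_mem ha hb
        zero_mem' := by
          have := rankOneTC_smul_left 0 0 y
          rw [zero_smul, zero_smul] at this
          change rankOneTC 0 y ∈ p
          rw [this]; exact p.zero_mem
        smul_mem' := fun c a ha => by
          change rankOneTC (c • a) y ∈ p
          rw [rankOneTC_smul_left]; exact p.smul_mem c ha }
    have hq : IsClosed (q : Set H) := hp.preimage (continuous_rankOneTC_left y)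
    have h2 : (Submodule.span ℂ D).topologicalClosure ≤ q :=
      Submodule.topologicalClosure_minimal _ (Submodule.span_le.2 fun x hx => h x hx y hy) hq
    rw [hD] at h2
    exact fun x => h2 trivial
  have h2 : ∀ x y, rankOneTC x y ∈ p := fun x => by
    let q : Submodule ℂ H :=
      { carrier := {y | rankOneTC x y ∈ p}
        add_mem' := fun {a b} ha hb => by
          change rankOneTC x (a + b) ∈ p
          rw [rankOneTC_add_right]; exact p.add_mem ha hb
        zero_mem' := by
          have := rankOneTC_smul_right 0 x 0
          rw [zero_smul, map_zero, zero_smul] at this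
          change rankOneTC x 0 ∈ p
          rw [this]; exact p.zero_mem
        smul_mem' := fun c a ha => by
          change rankOneTC x (c • a) ∈ p
          rw [rankOneTC_smul_right]; exact p.smul_mem _ ha }
    have hq : IsClosed (q : Set H) := hp.preimage (continuous_rankOneTC_right x)
    have h2 : (Submodule.span ℂ D).topologicalClosure ≤ q :=
      Submodule.topologicalClosure_minimal _ (Submodule.span_le.2 fun y hy => h1 y hy x) hq
    rw [hD] at h2
    exact fun x => h2 trivial
  refine eq_top_iff.2 fun t _ => ?_
  obtain ⟨x, y, hxy⟩ := t.exists_hasSum_rankOneTC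
  exact hp.mem_of_tendsto hxy (Filter.Eventually.of_forall fun s => p.sum_mem fun k _ => h2 _ _)

/-- Bounded bilinear forms on trace-class operators are determined by their values on the matrix
units. -/
lemma TraceClass.bilin_ext {K : Type v} [NormedAddCommGroup K] [InnerProductSpace ℂ K]
    [CompleteSpace K] {f g : TraceClass H →ₗ[ℂ] TraceClass K →ₗ[ℂ] ℂ} {C D : ℝ}
    (hf : ∀ s t, ‖f s t‖ ≤ C * ‖s‖ * ‖t‖) (hg : ∀ s t, ‖g s t‖ ≤ D * ‖s‖ * ‖t‖)
    (h : ∀ k k' l l', f (rankOneTC (stdBasis H k) (stdBasis H k'))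
        (rankOneTC (stdBasis K l) (stdBasis K l'))
      = g (rankOneTC (stdBasis H k) (stdBasis H k')) (rankOneTC (stdBasis K l) (stdBasis K l'))) :
    f = g := by
  have hb : ∀ s t, ‖(f - g) s t‖ ≤ (C + D) * ‖s‖ * ‖t‖ := fun s t => by
    refine (norm_sub_le (f s t) (g s t)).trans ?_
    have := hf s t
    have := hg s t
    linarith
  rw [← sub_eq_zero]
  have h1 : ∀ k k', (f - g) (rankOneTC (stdBasis H k) (stdBasis H k')) = 0 := fun k k' => by
    set φ := (f - g) (rankOneTC (stdBasis H k) (stdBasis H k')) with hφ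
    have hc : Continuous φ := AddMonoidHomClass.continuous_of_bound φ _ (hb _)
    have := TraceClass.eq_top_of_rankOneTC_mem (p := LinearMap.ker φ) (isClosed_singleton.preimage hc)
      (stdBasis K).dense_span (by
        rintro _ ⟨l, rfl⟩ _ ⟨l', rfl⟩
        exact sub_eq_zero.2 (h k k' l l'))
    exact LinearMap.ker_eq_top.1 this
  ext s t
  set φ : TraceClass H →ₗ[ℂ] ℂ := (f - g).flip t with hφ
  have hc : Continuous φ := AddMonoidHomClass.continuous_of_bound φ ((C + D) * ‖t‖) fun s =>
    (hb s t).trans (le_of_eq (by ring))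
  have := TraceClass.eq_top_of_rankOneTC_mem (p := LinearMap.ker φ) (isClosed_singleton.preimage hc)
    (stdBasis H).dense_span (by
      rintro _ ⟨l, rfl⟩ _ ⟨l', rfl⟩
      exact LinearMap.congr_fun (h1 l l') t)
  exact LinearMap.congr_fun (LinearMap.ker_eq_top.1 this) s

end RankOne

/-! ### Matrices of operators and their compressions -/

section Compression

open InnerProductSpace

variable {H : Type u} [NormedAddCommGroup H] [InnerProductSpace ℂ H]
variable {L : Type v} [NormedAddCommGroup L] [InnerProductSpace ℂ L]
variable {ι P : Type} [Fintype ι] [Fintype P]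

lemma norm_sum_smul_sq {e : P → H} (he : Orthonormal ℂ e) (c : P → ℂ) :
    ‖∑ p, c p • e p‖ ^ 2 = ∑ p, ‖c p‖ ^ 2 := by
  have h := he.inner_sum c c Finset.univ
  rw [inner_self_eq_norm_sq_to_K] at h
  have h2 : ∀ p, (starRingEnd ℂ) (c p) * c p = ((‖c p‖ ^ 2 : ℝ) : ℂ) := fun p => by
    rw [Complex.conj_mul']; simp
  simp only [h2] at h
  exact Complex.ofReal_injective (by push_cast at h ⊢; exact h)

/-- The compression of a matrix of operators to the span of a finite orthonormal family. -/
lemma scalarNorm_inner_le {e : P → H} (he : Orthonormal ℂ e) (A : Matrix ι ι (H →L[ℂ] H)) :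
    scalarNorm (Matrix.of fun p q : ι × P => ⟪e p.2, A p.1 q.1 (e q.2)⟫_ℂ) ≤ ‖opMat A‖ := by
  refine scalarNorm_le_of_sum_sq (norm_nonneg (opMat A)) fun ξ => ?_
  let z : ι → H := fun j => ∑ q, ξ (j, q) • e q
  have h1 : ∀ p : ι × P, (Matrix.of fun p q : ι × P => ⟪e p.2, A p.1 q.1 (e q.2)⟫_ℂ).mulVec ξ p
      = ⟪e p.2, ∑ j, A p.1 j (z j)⟫_ℂ := fun p => by
    simp only [Matrix.mulVec, dotProduct, Matrix.of_apply, Fintype.sum_prod_type, z, map_sum,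
      map_smul, inner_sum, inner_smul_right]
    exact Finset.sum_congr rfl fun _ _ => Finset.sum_congr rfl fun _ _ => mul_comm _ _
  have h2 := opMat_sq_le A z
  have h3 : ∑ j, ‖z j‖ ^ 2 = ∑ q, ‖ξ q‖ ^ 2 := by
    rw [Fintype.sum_prod_type]
    exact Finset.sum_congr rfl fun j _ => norm_sum_smul_sq he _
  rw [h3] at h2
  refine le_trans ?_ h2
  rw [Fintype.sum_prod_type]
  refine Finset.sum_le_sum fun i _ => ?_
  simp only [h1]
  exact he.sum_inner_products_le _ (s := Finset.univ)

/-- The compression of a matrix of operators along isometries with orthogonal ranges. -/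
lemma norm_opMat_adjoint_le [CompleteSpace H] [CompleteSpace L] {W : P → H →L[ℂ] L}
    (hW : ∀ p x y, ⟪W p x, W p y⟫_ℂ = ⟪x, y⟫_ℂ) (hW' : ∀ p q, p ≠ q → ∀ x y, ⟪W p x, W q y⟫_ℂ = 0)
    (A : Matrix ι ι (L →L[ℂ] L)) :
    ‖opMat (Matrix.of fun p q : ι × P =>
      ContinuousLinearMap.adjoint (W p.2) ∘L A p.1 q.1 ∘L W q.2)‖ ≤ ‖opMat A‖ := by
  classical
  have hnorm : ∀ x : P → H, ‖∑ p, W p (x p)‖ ^ 2 = ∑ p, ‖x p‖ ^ 2 := fun x => by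
    have h : ((‖∑ p, W p (x p)‖ ^ 2 : ℝ) : ℂ) = ((∑ p, ‖x p‖ ^ 2 : ℝ) : ℂ) := by
      have h1 := inner_self_eq_norm_sq_to_K (𝕜 := ℂ) (∑ p, W p (x p))
      push_cast at h1 ⊢
      refine h1.symm.trans ?_
      rw [sum_inner]
      refine Finset.sum_congr rfl fun p _ => ?_
      rw [inner_sum, Finset.sum_eq_single p (fun q _ hq => hW' p q hq.symm _ _) (by simp), hW,
        inner_self_eq_norm_sq_to_K]
      rfl
    exact_mod_cast h
  have hbessel : ∀ y : L, ∑ p, ‖ContinuousLinearMap.adjoint (W p) y‖ ^ 2 ≤ ‖y‖ ^ 2 := fun y => by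
    set κ := ∑ p, W p (ContinuousLinearMap.adjoint (W p) y) with hκ
    have h1 : ‖κ‖ ^ 2 = ∑ p, ‖ContinuousLinearMap.adjoint (W p) y‖ ^ 2 := hnorm _
    have h2 : ⟪κ, y⟫_ℂ = ((∑ p, ‖ContinuousLinearMap.adjoint (W p) y‖ ^ 2 : ℝ) : ℂ) := by
      rw [hκ, sum_inner]
      push_cast
      refine Finset.sum_congr rfl fun p _ => ?_
      rw [← ContinuousLinearMap.adjoint_inner_right, inner_self_eq_norm_sq_to_K]
      rfl
    have h3 := norm_inner_le_norm (𝕜 := ℂ) κ y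
    rw [h2, ← h1, Complex.norm_real, Real.norm_of_nonneg (by positivity)] at h3
    rw [← h1]
    nlinarith [norm_nonneg κ, norm_nonneg y]
  refine norm_opMat_le (norm_nonneg (opMat A)) fun ξ => ?_
  let z : ι → L := fun j => ∑ q, W q (ξ (j, q))
  have h1 : ∀ p : ι × P, ∑ q, (Matrix.of fun p q : ι × P =>
      ContinuousLinearMap.adjoint (W p.2) ∘L A p.1 q.1 ∘L W q.2) p q (ξ q)
      = ContinuousLinearMap.adjoint (W p.2) (∑ j, A p.1 j (z j)) := fun p => by
    simp only [Matrix.of_apply, Fintype.sum_prod_type, z, map_sum, ContinuousLinearMap.comp_apply]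
  have h2 := opMat_sq_le A z
  have h3 : ∑ j, ‖z j‖ ^ 2 = ∑ q, ‖ξ q‖ ^ 2 := by
    rw [Fintype.sum_prod_type]
    exact Finset.sum_congr rfl fun j _ => hnorm _
  rw [h3] at h2
  refine le_trans ?_ h2
  simp only [h1, Fintype.sum_prod_type]
  exact Finset.sum_le_sum fun i _ => hbessel _

variable {I : Type*}

lemma hasSum_norm_inner_sq (b : HilbertBasis I ℂ H) (x : H) :
    HasSum (fun k => ‖⟪b k, x⟫_ℂ‖ ^ 2) (‖x‖ ^ 2) := by
  have h := Complex.hasSum_re (b.hasSum_inner_mul_inner x x)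
  have h1 : (⟪x, x⟫_ℂ).re = ‖x‖ ^ 2 := inner_self_eq_norm_sq (𝕜 := ℂ) x
  rw [h1] at h
  refine h.congr_fun fun k => ?_
  rw [← inner_conj_symm x, Complex.conj_mul']
  norm_cast

lemma norm_sq_le_of_sum_norm_inner_sq_le (b : HilbertBasis I ℂ H) {x : H} {M : ℝ}
    (h : ∀ s : Finset I, ∑ k ∈ s, ‖⟪b k, x⟫_ℂ‖ ^ 2 ≤ M) : ‖x‖ ^ 2 ≤ M :=
  le_of_tendsto (hasSum_norm_inner_sq b x) (Filter.Eventually.of_forall h)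

/-- An infinite matrix whose finite sections are bounded by `C` is the matrix of an operator. -/
lemma exists_operator_of_sections [CompleteSpace L] (w : HilbertBasis I ℂ L) (m : I → I → ℂ)
    {C : ℝ} (hC : 0 ≤ C) (hm : ∀ (s : Finset I) (ξ : I → ℂ),
      ∑ p ∈ s, ‖∑ q ∈ s, m p q * ξ q‖ ^ 2 ≤ C ^ 2 * ∑ q ∈ s, ‖ξ q‖ ^ 2) :
    ∃ b : L →L[ℂ] L, ∀ p q, ⟪w p, b (w q)⟫_ℂ = m p q := by
  classical
  -- rectangular sections are bounded as well
  have hm' : ∀ (s t : Finset I) (ξ : I → ℂ),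
      ∑ p ∈ s, ‖∑ q ∈ t, m p q * ξ q‖ ^ 2 ≤ C ^ 2 * ∑ q ∈ t, ‖ξ q‖ ^ 2 := fun s t ξ => by
    have h := hm (s ∪ t) fun q => if q ∈ t then ξ q else 0
    have h1 : ∀ p, ∑ q ∈ s ∪ t, m p q * (if q ∈ t then ξ q else 0) = ∑ q ∈ t, m p q * ξ q :=
      fun p => by
        simp only [mul_ite, mul_zero, ← Finset.sum_filter]
        congr 1; ext; simp +contextual
    have h2 : ∑ q ∈ s ∪ t, ‖if q ∈ t then ξ q else 0‖ ^ 2 = ∑ q ∈ t, ‖ξ q‖ ^ 2 := by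
      have : ∀ q, ‖if q ∈ t then ξ q else 0‖ ^ 2 = if q ∈ t then ‖ξ q‖ ^ 2 else 0 := fun q => by
        split_ifs <;> simp
      simp only [this, ← Finset.sum_filter]
      congr 1; ext; simp +contextual
    simp only [h1, h2] at h
    exact (Finset.sum_le_sum_of_subset_of_nonneg Finset.subset_union_left
      fun _ _ _ => by positivity).trans h
  have hcol : ∀ q, Memℓp (fun p => m p q) 2 := fun q => by
    refine memℓp_gen' (C := C ^ 2) fun s => ?_
    have h := hm' s {q} 1
    simpa using h
  let col : I → L := fun q => w.repr.symm ⟨fun p => m p q, hcol q⟩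
  have hcol' : ∀ p q, ⟪w p, col q⟫_ℂ = m p q := fun p q => by
    rw [← w.repr_apply_apply]; simp [col]
  -- the operator is bounded on the dense range of `E`, the finite combinations of basis vectors
  let T : (I →₀ ℂ) →ₗ[ℂ] L := Finsupp.linearCombination ℂ col
  let E : (I →₀ ℂ) →ₗ[ℂ] L := Finsupp.linearCombination ℂ w
  have hE : ∀ d, ‖E d‖ ^ 2 = ∑ q ∈ d.support, ‖d q‖ ^ 2 := fun d => by
    have h := w.orthonormal.inner_sum d d d.support
    have h0 : E d = ∑ q ∈ d.support, d q • w q := Finsupp.linearCombination_apply ℂ d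
    rw [← h0, inner_self_eq_norm_sq_to_K] at h
    have h2 : ∀ p, (starRingEnd ℂ) (d p) * d p = ((‖d p‖ ^ 2 : ℝ) : ℂ) := fun p => by
      rw [Complex.conj_mul']; simp
    simp only [h2] at h
    exact Complex.ofReal_injective (by push_cast at h ⊢; exact h)
  have hTE : ∀ d, ‖T d‖ ≤ C * ‖E d‖ := fun d => by
    refine le_of_sq_le_sq ?_ (by positivity)
    rw [mul_pow, hE]
    refine norm_sq_le_of_sum_norm_inner_sq_le w fun s => ?_
    have h : ∀ p, ⟪w p, T d⟫_ℂ = ∑ q ∈ d.support, m p q * d q := fun p => by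
      have h0 : T d = ∑ q ∈ d.support, d q • col q := Finsupp.linearCombination_apply ℂ d
      rw [h0, inner_sum]
      refine Finset.sum_congr rfl fun q _ => ?_
      rw [inner_smul_right, hcol', mul_comm]
    simp only [h]
    exact hm' s d.support d
  have hd : DenseRange E := by
    have h := w.dense_span
    rw [← Finsupp.range_linearCombination, ← Submodule.dense_iff_topologicalClosure_eq_top] at h
    exact h
  refine ⟨T.extendOfNorm E, fun p q => ?_⟩
  have h1 : w q = E (Finsupp.single q 1) := by simp [E]
  rw [h1, LinearMap.extendOfNorm_eq hd ⟨C, hTE⟩]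
  simp [T, hcol']

/-- A matrix over `B(L)` may be given by its matrix coefficients in an orthonormal basis, provided
that its finite sections are bounded by `C`. -/
lemma exists_operator_matrix [CompleteSpace L] (w : HilbertBasis I ℂ L) (m : ι → ι → I → I → ℂ)
    {C : ℝ} (hC : 0 ≤ C) (hm : ∀ (d : ℕ) (f : Fin d → I), Function.Injective f →
      scalarNorm (Matrix.of fun p q : ι × Fin d => m p.1 q.1 (f p.2) (f q.2)) ≤ C) :
    ∃ b : Matrix ι ι (L →L[ℂ] L), (∀ i j p q, ⟪w p, b i j (w q)⟫_ℂ = m i j p q) ∧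
      ‖opMat b‖ ≤ C := by
  classical
  have hs : ∀ (s : Finset I) (ξ : ι → I → ℂ), ∑ i, ∑ p ∈ s, ‖∑ j, ∑ q ∈ s, m i j p q * ξ j q‖ ^ 2
      ≤ C ^ 2 * ∑ j, ∑ q ∈ s, ‖ξ j q‖ ^ 2 := fun s ξ => by
    let f : Fin s.card → I := fun k => s.equivFin.symm k
    have hf : Function.Injective f := Subtype.val_injective.comp s.equivFin.symm.injective
    have hsum : ∀ {A : Type} [AddCommMonoid A] (g : I → A), ∑ p ∈ s, g p = ∑ k, g (f k) :=
      fun g => by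
        rw [← Finset.sum_coe_sort, ← s.equivFin.symm.sum_comp]
    have h := sum_sq_mulVec_le (Matrix.of fun p q : ι × Fin s.card =>
      m p.1 q.1 (f p.2) (f q.2)) fun q => ξ q.1 (f q.2)
    simp only [hsum]
    simp only [Fintype.sum_prod_type, Matrix.mulVec, dotProduct, Matrix.of_apply] at h
    refine h.trans ?_
    have := hm _ f hf
    have := scalarNorm_nonneg (Matrix.of fun p q : ι × Fin s.card => m p.1 q.1 (f p.2) (f q.2))
    gcongr
  have hex : ∀ i j, ∃ b : L →L[ℂ] L, ∀ p q, ⟪w p, b (w q)⟫_ℂ = m i j p q := fun i j => by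
    refine exists_operator_of_sections w (m i j) hC fun s ξ => ?_
    have h := hs s fun j' q => if j' = j then ξ q else 0
    have h1 : ∀ i p, ∑ j', ∑ q ∈ s, m i j' p q * (if j' = j then ξ q else 0)
        = ∑ q ∈ s, m i j p q * ξ q := fun i p => by
      rw [Finset.sum_eq_single j] <;> simp +contextual
    have h2 : ∑ j', ∑ q ∈ s, ‖if j' = j then ξ q else 0‖ ^ 2 = ∑ q ∈ s, ‖ξ q‖ ^ 2 := by
      rw [Finset.sum_eq_single j] <;> simp +contextual
    simp only [h1, h2] at h
    exact (Finset.single_le_sum (f := fun i => ∑ p ∈ s, ‖∑ q ∈ s, m i j p q * ξ q‖ ^ 2)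
      (fun _ _ => by positivity) (Finset.mem_univ i)).trans h
  choose b hb using hex
  refine ⟨b, hb, norm_opMat_le hC fun ξ => ?_⟩
  -- the vectors are approximated by their finite partial sums, to which the sections apply
  let ξs : Finset I → ι → L := fun s j => ∑ q ∈ s, ⟪w q, ξ j⟫_ℂ • w q
  have hlim : ∀ j, Filter.Tendsto (fun s => ξs s j) Filter.atTop (nhds (ξ j)) := fun j => by
    have h := w.hasSum_repr (ξ j)
    simp only [w.repr_apply_apply] at h
    exact h
  have h1 : ∀ s t : Finset I, t ⊆ s → ∑ i, ∑ p ∈ t, ‖⟪w p, ∑ j, b i j (ξs s j)⟫_ℂ‖ ^ 2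
      ≤ C ^ 2 * ∑ j, ‖ξ j‖ ^ 2 := fun s t hts => by
    have h2 : ∀ i p, ⟪w p, ∑ j, b i j (ξs s j)⟫_ℂ = ∑ j, ∑ q ∈ s, m i j p q * ⟪w q, ξ j⟫_ℂ :=
      fun i p => by
        simp only [ξs, map_sum, map_smul, inner_sum, inner_smul_right, hb]
        exact Finset.sum_congr rfl fun _ _ => Finset.sum_congr rfl fun _ _ => mul_comm _ _
    simp only [h2]
    calc _ ≤ ∑ i, ∑ p ∈ s, ‖∑ j, ∑ q ∈ s, m i j p q * ⟪w q, ξ j⟫_ℂ‖ ^ 2 :=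
          Finset.sum_le_sum fun i _ => Finset.sum_le_sum_of_subset_of_nonneg hts
            fun _ _ _ => by positivity
      _ ≤ _ := hs s fun j q => ⟪w q, ξ j⟫_ℂ
      _ ≤ _ := by
          gcongr with j
          exact w.orthonormal.sum_inner_products_le (ξ j)
  have h2 : ∀ t : Finset I, ∑ i, ∑ p ∈ t, ‖⟪w p, ∑ j, b i j (ξ j)⟫_ℂ‖ ^ 2
      ≤ C ^ 2 * ∑ j, ‖ξ j‖ ^ 2 := fun t => by
    refine le_of_tendsto (f := fun s => ∑ i, ∑ p ∈ t, ‖⟪w p, ∑ j, b i j (ξs s j)⟫_ℂ‖ ^ 2)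
      (x := Filter.atTop) ?_ (Filter.eventually_atTop.2 ⟨t, fun s hs => h1 s t hs⟩)
    refine tendsto_finsetSum _ fun i _ => tendsto_finsetSum _ fun p _ => ?_
    refine (Filter.Tendsto.norm ?_).pow 2
    refine Filter.Tendsto.inner tendsto_const_nhds ?_
    exact tendsto_finsetSum _ fun j _ => ((b i j).continuous.tendsto _).comp (hlim j)
  refine le_of_tendsto (f := fun t : Finset I => ∑ i, ∑ p ∈ t, ‖⟪w p, ∑ j, b i j (ξ j)⟫_ℂ‖ ^ 2)
    (x := Filter.atTop) ?_ (Filter.Eventually.of_forall h2)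
  exact tendsto_finsetSum _ fun i _ => hasSum_norm_inner_sq w _

end Compression

/-! ### Matrices of trace-class operators -/

section TraceMatrix

open InnerProductSpace

variable {H : Type u} [NormedAddCommGroup H] [InnerProductSpace ℂ H] [CompleteSpace H]
variable {ι κ P : Type} [Fintype ι] [Fintype κ] [Fintype P]

lemma complex_mnorm (A : Matrix ι ι ℂ) : OpSpace.complex.mnorm A = scalarNorm A :=
  OpSpace.ofMatNorm_mnorm _ _ _ _

lemma B_mnorm (A : Matrix ι ι (H →L[ℂ] H)) : (OpSpace.B H).mnorm A = ‖opMat A‖ :=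
  OpSpace.ofMatNorm_mnorm _ _ _ _

lemma T_mnorm (t : Matrix ι ι (TraceClass H)) :
    (OpSpace.T H).mnorm t = matCBNorm ((t.map (traceEmbedding H)).map
      (cbSubmodule (OpSpace.B H) OpSpace.complex).subtype) :=
  (OpSpace.mnorm_comap (OpSpace.cb (OpSpace.B H) OpSpace.complex) (TraceClass H)
    (traceEmbedding H) t).trans (OpSpace.cb_mnorm (t.map (traceEmbedding H)))

/-- The norm of a matrix over `T(H)` bounds its pairing with the matrices over `B(H)`. -/
lemma scalarNorm_trace_le (t : Matrix κ κ (TraceClass H)) (X : Matrix ι ι (H →L[ℂ] H)) :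
    scalarNorm (Matrix.of fun p q : ι × κ => trace ((t p.2 q.2).toOp * X p.1 q.1))
      ≤ (OpSpace.T H).mnorm t * ‖opMat X‖ := by
  have h1 := CB.isMatCBBound (X := OpSpace.B H) (Y := OpSpace.complex)
    (t.map (traceEmbedding H))
  have h2 := h1.le X
  rw [T_mnorm]
  exact (complex_mnorm _).ge.trans (h2.trans
    (mul_le_mul_of_nonneg_left (B_mnorm X).le (matCBNorm_nonneg _)))

lemma T_mnorm_le {t : Matrix κ κ (TraceClass H)} {C : ℝ} (hC : 0 ≤ C)
    (h : ∀ (n : ℕ) (X : Matrix (Fin n) (Fin n) (H →L[ℂ] H)),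
      scalarNorm (Matrix.of fun p q : Fin n × κ => trace ((t p.2 q.2).toOp * X p.1 q.1))
        ≤ C * ‖opMat X‖) : (OpSpace.T H).mnorm t ≤ C := by
  rw [T_mnorm]
  refine IsMatCBBound.norm_le ⟨hC, fun n X => ?_⟩
  exact (complex_mnorm _).le.trans (h n X)

/-- The matrix units of a finite orthonormal family form a contraction over `T(H)`: pairing with it
is compression to the span of the family. -/
lemma T_mnorm_rankOneTC_le {e : P → H} (he : Orthonormal ℂ e) :
    (OpSpace.T H).mnorm (Matrix.of fun p q => rankOneTC (e q) (e p)) ≤ 1 := by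
  refine T_mnorm_le zero_le_one fun n X => ?_
  rw [one_mul]
  refine le_trans (le_of_eq ?_) (scalarNorm_inner_le he X)
  congr 1
  ext p q
  exact trace_rankOne_mul _ _ _

lemma TraceClass.norm_trace_mul_le (t : TraceClass H) (b : H →L[ℂ] H) :
    ‖trace (t.toOp * b)‖ ≤ ‖t‖ * ‖b‖ := t.finBound.norm_trace_le b

lemma eq_of_inner_stdBasis {A B : H →L[ℂ] H}
    (h : ∀ k l, ⟪stdBasis H k, A (stdBasis H l)⟫_ℂ = ⟪stdBasis H k, B (stdBasis H l)⟫_ℂ) :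
    A = B := by
  have hd : Dense (Submodule.span ℂ (Set.range (stdBasis H)) : Set H) :=
    Submodule.dense_iff_topologicalClosure_eq_top.2 (stdBasis H).dense_span
  have h1 : ∀ l, A (stdBasis H l) = B (stdBasis H l) := fun l => by
    refine (stdBasis H).repr.injective (lp.ext (funext fun k => ?_))
    rw [(stdBasis H).repr_apply_apply, (stdBasis H).repr_apply_apply, h]
  refine ContinuousLinearMap.ext_on hd ?_
  rintro _ ⟨l, rfl⟩
  exact h1 l

/-- Bounded operators are separated by trace-class operators. -/
lemma eq_of_trace_mul {A B : H →L[ℂ] H}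
    (h : ∀ t : TraceClass H, trace (t.toOp * A) = trace (t.toOp * B)) : A = B :=
  eq_of_inner_stdBasis fun k l => by
    simpa only [toOp_rankOneTC, trace_rankOne_mul] using
      h (rankOneTC (stdBasis H l) (stdBasis H k))

lemma norm_opMat_single (A : H →L[ℂ] H) : ‖opMat (Matrix.of fun _ _ : Unit => A)‖ = ‖A‖ := by
  rw [← B_mnorm]
  exact (OpSpace.B H).nrm_eq A

lemma T_mnorm_single (t : TraceClass H) :
    (OpSpace.T H).mnorm (Matrix.of fun _ _ : Unit => t) = ‖t‖ := (OpSpace.T H).nrm_eq t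

end TraceMatrix

/-! ### Slice maps -/

section Slice

open InnerProductSpace

variable {H : Type u} [NormedAddCommGroup H] [InnerProductSpace ℂ H] [CompleteSpace H]
variable {K : Type v} [NormedAddCommGroup K] [InnerProductSpace ℂ K] [CompleteSpace K]
variable {L : Type w} [NormedAddCommGroup L] [InnerProductSpace ℂ L] [CompleteSpace L]
variable {ι κ : Type} [Fintype ι] [Fintype κ]

/-- Bilinear maps that multiply inner products, as `(x, y) ↦ x ⊗ y` does. Stated for an arbitrary
bilinear map so that it can be used for both orders of the factors. -/
def IsInnerMul (τ : H →ₗ[ℂ] K →ₗ[ℂ] L) : Prop :=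
  ∀ x x' y y', ⟪τ x y, τ x' y'⟫_ℂ = ⟪x, x'⟫_ℂ * ⟪y, y'⟫_ℂ

variable {τ : H →ₗ[ℂ] K →ₗ[ℂ] L}

lemma IsInnerMul.flip (hτ : IsInnerMul τ) : IsInnerMul τ.flip := fun x x' y y' =>
  (hτ y y' x x').trans (mul_comm _ _)

lemma IsInnerMul.norm_eq (hτ : IsInnerMul τ) (x : H) (y : K) : ‖τ x y‖ = ‖x‖ * ‖y‖ := by
  have h := hτ x x y y
  simp only [inner_self_eq_norm_sq_to_K] at h
  have h1 : ‖τ x y‖ ^ 2 = (‖x‖ * ‖y‖) ^ 2 := Complex.ofReal_injective (by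
    push_cast; rw [mul_pow]; exact h)
  exact (sq_eq_sq₀ (norm_nonneg _) (by positivity)).1 h1

/-- The operator `y ↦ x ⊗ y`. -/
def leg (hτ : IsInnerMul τ) (x : H) : K →L[ℂ] L :=
  (τ x).mkContinuous ‖x‖ fun y => (hτ.norm_eq x y).le

lemma leg_apply (hτ : IsInnerMul τ) (x : H) (y : K) : leg hτ x y = τ x y := rfl

/-- The slices of a matrix over `B(L)` by a matrix over `T(K)` form a matrix over `B(H)`. -/
lemma exists_slice (hτ : IsInnerMul τ) (b : Matrix ι ι (L →L[ℂ] L)) (t : Matrix κ κ (TraceClass K)) :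
    ∃ c : Matrix (ι × κ) (ι × κ) (H →L[ℂ] H), (∀ p q k l,
      ⟪stdBasis H k, c p q (stdBasis H l)⟫_ℂ = trace ((t p.2 q.2).toOp *
        (ContinuousLinearMap.adjoint (leg hτ (stdBasis H k)) ∘L b p.1 q.1 ∘L
          leg hτ (stdBasis H l)))) ∧
      ‖opMat c‖ ≤ ‖opMat b‖ * (OpSpace.T K).mnorm t := by
  have hn : 0 ≤ (OpSpace.T K).mnorm t := (OpSpace.T K).mn.N_nonneg t
  refine exists_operator_matrix (stdBasis H) (fun (p q : ι × κ) k l => trace ((t p.2 q.2).toOp *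
    (ContinuousLinearMap.adjoint (leg hτ (stdBasis H k)) ∘L b p.1 q.1 ∘L leg hτ (stdBasis H l))))
    (mul_nonneg (norm_nonneg (opMat b)) hn) fun d f hf => ?_
  have he : Orthonormal ℂ (stdBasis H ∘ f) := (stdBasis H).orthonormal.comp f hf
  have h1 := norm_opMat_adjoint_le (W := fun k => leg hτ (stdBasis H (f k)))
    (fun p x y => by
      have h : ⟪stdBasis H (f p), stdBasis H (f p)⟫_ℂ = 1 := by
        rw [inner_self_eq_norm_sq_to_K, (stdBasis H).orthonormal.norm_eq_one]; simp
      rw [leg_apply, leg_apply, hτ, h, one_mul])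
    (fun p q hpq x y => by
      have h : ⟪stdBasis H (f p), stdBasis H (f q)⟫_ℂ = 0 := he.inner_eq_zero hpq
      rw [leg_apply, leg_apply, hτ, h, zero_mul]) b
  have h2 := scalarNorm_trace_le t (Matrix.of fun p q : ι × Fin d =>
    ContinuousLinearMap.adjoint (leg hτ (stdBasis H (f p.2))) ∘L b p.1 q.1 ∘L
      leg hτ (stdBasis H (f q.2)))
  rw [mul_comm ‖opMat b‖]
  refine le_trans (le_of_eq ?_) (h2.trans (mul_le_mul_of_nonneg_left h1 hn))
  let e : (ι × κ) × Fin d ≃ (ι × Fin d) × κ :=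
    ((Equiv.prodAssoc _ _ _).trans ((Equiv.refl _).prodCongr (Equiv.prodComm _ _))).trans
      (Equiv.prodAssoc _ _ _).symm
  rw [← scalarNorm_submatrix_equiv _ e e]
  rfl

/-- The slice `(id ⊗ tr(t ·))(b)` of an operator `b` on the tensor product. -/
def slice (hτ : IsInnerMul τ) (b : L →L[ℂ] L) (t : TraceClass K) : H →L[ℂ] H :=
  (exists_slice hτ (Matrix.of fun _ _ : Unit => b) (Matrix.of fun _ _ : Unit => t)).choose
    ((), ()) ((), ())

lemma inner_slice (hτ : IsInnerMul τ) (b : L →L[ℂ] L) (t : TraceClass K) (k l : basisSet H) :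
    ⟪stdBasis H k, slice hτ b t (stdBasis H l)⟫_ℂ = trace (t.toOp *
      (ContinuousLinearMap.adjoint (leg hτ (stdBasis H k)) ∘L b ∘L leg hτ (stdBasis H l))) :=
  (exists_slice hτ (Matrix.of fun _ _ : Unit => b) (Matrix.of fun _ _ : Unit => t)).choose_spec.1
    ((), ()) ((), ()) k l

lemma norm_opMat_slice_le (hτ : IsInnerMul τ) (b : Matrix ι ι (L →L[ℂ] L))
    (t : Matrix κ κ (TraceClass K)) :
    ‖opMat (Matrix.of fun p q : ι × κ => slice hτ (b p.1 q.1) (t p.2 q.2))‖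
      ≤ ‖opMat b‖ * (OpSpace.T K).mnorm t := by
  obtain ⟨c, hc, hcn⟩ := exists_slice hτ b t
  have h : (Matrix.of fun p q : ι × κ => slice hτ (b p.1 q.1) (t p.2 q.2)) = c := by
    ext1 p q
    exact eq_of_inner_stdBasis fun k l => (inner_slice hτ _ _ k l).trans (hc p q k l).symm
  rwa [h]

lemma norm_slice_le (hτ : IsInnerMul τ) (b : L →L[ℂ] L) (t : TraceClass K) :
    ‖slice hτ b t‖ ≤ ‖b‖ * ‖t‖ := by
  have h := norm_opMat_slice_le hτ (Matrix.of fun _ _ : Unit => b) (Matrix.of fun _ _ : Unit => t)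
  have h1 : ‖opMat (Matrix.of fun _ _ : Unit × Unit => slice hτ b t)‖ = ‖slice hτ b t‖ :=
    ((bhMatNorm H).N_submatrix_equiv (Equiv.prodPUnit Unit)
      (Matrix.of fun _ _ : Unit => slice hτ b t)).trans (norm_opMat_single _)
  rw [norm_opMat_single] at h
  exact h1.ge.trans (h.trans (le_of_eq (congrArg _ (T_mnorm_single t))))

lemma slice_add_left (hτ : IsInnerMul τ) (b c : L →L[ℂ] L) (t : TraceClass K) :
    slice hτ (b + c) t = slice hτ b t + slice hτ c t :=
  eq_of_inner_stdBasis fun k l => by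
    rw [add_apply, inner_add_right, inner_slice, inner_slice, inner_slice,
      ContinuousLinearMap.add_comp, ContinuousLinearMap.comp_add, t.finBound.trace_mul_add]

lemma slice_smul_left (hτ : IsInnerMul τ) (c : ℂ) (b : L →L[ℂ] L) (t : TraceClass K) :
    slice hτ (c • b) t = c • slice hτ b t :=
  eq_of_inner_stdBasis fun k l => by
    rw [smul_apply, inner_smul_right, inner_slice, inner_slice,
      ContinuousLinearMap.smul_comp, ContinuousLinearMap.comp_smul, t.finBound.trace_mul_smul]

lemma slice_add_right (hτ : IsInnerMul τ) (b : L →L[ℂ] L) (s t : TraceClass K) :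
    slice hτ b (s + t) = slice hτ b s + slice hτ b t :=
  eq_of_inner_stdBasis fun k l => by
    rw [add_apply, inner_add_right, inner_slice, inner_slice, inner_slice, map_add,
      s.finBound.trace_add_mul t.finBound]

lemma slice_smul_right (hτ : IsInnerMul τ) (c : ℂ) (b : L →L[ℂ] L) (t : TraceClass K) :
    slice hτ b (c • t) = c • slice hτ b t :=
  eq_of_inner_stdBasis fun k l => by
    rw [smul_apply, inner_smul_right, inner_slice, inner_slice, map_smul,
      t.finBound.trace_smul_mul]

/-- The slice map `T(K) → B(H)` of an operator on the tensor product. -/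
def sliceMap (hτ : IsInnerMul τ) (b : L →L[ℂ] L) : OpSpace.T K →ₗ[ℂ] OpSpace.B H :=
  ({ toFun := slice hτ b
     map_add' := slice_add_right hτ b
     map_smul' := fun c t => slice_smul_right hτ c b t } : TraceClass K →ₗ[ℂ] (H →L[ℂ] H))

/-- The bilinear form `(s, t) ↦ tr(s (id ⊗ tr(t ·))(b))`. -/
def sliceForm (hτ : IsInnerMul τ) (b : L →L[ℂ] L) : TraceClass H →ₗ[ℂ] TraceClass K →ₗ[ℂ] ℂ :=
  LinearMap.mk₂ ℂ (fun s t => trace (s.toOp * slice hτ b t))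
    (fun s s' t => by rw [map_add, s.finBound.trace_add_mul s'.finBound])
    (fun c s t => by rw [map_smul, s.finBound.trace_smul_mul, smul_eq_mul])
    (fun s t t' => by rw [slice_add_right, s.finBound.trace_mul_add])
    (fun c s t => by rw [slice_smul_right, s.finBound.trace_mul_smul, smul_eq_mul])

lemma sliceForm_apply (hτ : IsInnerMul τ) (b : L →L[ℂ] L) (s : TraceClass H) (t : TraceClass K) :
    sliceForm hτ b s t = trace (s.toOp * slice hτ b t) := rfl

lemma norm_sliceForm_le (hτ : IsInnerMul τ) (b : L →L[ℂ] L) (s : TraceClass H)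
    (t : TraceClass K) : ‖sliceForm hτ b s t‖ ≤ ‖b‖ * ‖s‖ * ‖t‖ := by
  refine (s.norm_trace_mul_le _).trans ?_
  calc _ ≤ ‖s‖ * (‖b‖ * ‖t‖) := by gcongr; exact norm_slice_le hτ b t
    _ = _ := by ring

/-- On matrix units, the slice form reads off the matrix coefficients of the operator. -/
lemma sliceForm_rankOneTC (hτ : IsInnerMul τ) (b : L →L[ℂ] L) (k k' : basisSet H) (y y' : K) :
    sliceForm hτ b (rankOneTC (stdBasis H k) (stdBasis H k')) (rankOneTC y y')
      = ⟪τ (stdBasis H k') y', b (τ (stdBasis H k) y)⟫_ℂ := by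
  rw [sliceForm_apply, toOp_rankOneTC, trace_rankOne_mul, inner_slice, toOp_rankOneTC,
    trace_rankOne_mul, ContinuousLinearMap.comp_apply, ContinuousLinearMap.adjoint_inner_right]
  rfl

/-- The two slice maps of an operator represent the same bilinear form. -/
lemma sliceForm_flip (hτ : IsInnerMul τ) (b : L →L[ℂ] L) (s : TraceClass H) (t : TraceClass K) :
    sliceForm hτ.flip b t s = sliceForm hτ b s t := by
  have h := TraceClass.bilin_ext (f := (sliceForm hτ.flip b).flip) (g := sliceForm hτ b)
    (C := ‖b‖) (D := ‖b‖)
    (fun s t => (norm_sliceForm_le hτ.flip b t s).trans (le_of_eq (by ring)))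
    (norm_sliceForm_le hτ b) fun k k' l l' => by
      rw [LinearMap.flip_apply, sliceForm_rankOneTC, sliceForm_rankOneTC]
      rfl
  exact LinearMap.congr_fun (LinearMap.congr_fun h s) t

lemma isMatCBBound_sliceMap (hτ : IsInnerMul τ) (b : Matrix ι ι (L →L[ℂ] L)) :
    IsMatCBBound (Matrix.of fun i j => sliceMap hτ (b i j)) ‖opMat b‖ := by
  refine ⟨norm_nonneg (opMat b), fun n x => ?_⟩
  rw [← OpSpace.mnorm_fin]
  refine le_trans (le_of_eq ?_) (norm_opMat_slice_le hτ b x)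
  exact (B_mnorm _).trans ((bhMatNorm H).N_submatrix_equiv (Equiv.prodComm (Fin n) ι)
    (Matrix.of fun p q : ι × Fin n => slice hτ (b p.1 q.1) (x p.2 q.2)))

/-- The slice map of an operator, as a completely bounded map. -/
def sliceCB (hτ : IsInnerMul τ) :
    (L →L[ℂ] L) →ₗ[ℂ] CB (OpSpace.T K) (OpSpace.B H) where
  toFun b := ⟨sliceMap hτ b, _, (isMatCBBound_one _ _).1
    (isMatCBBound_sliceMap hτ (Matrix.of fun _ _ : Unit => b))⟩
  map_add' b c := Subtype.ext (LinearMap.ext fun t => slice_add_left hτ b c t)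
  map_smul' c b := Subtype.ext (LinearMap.ext fun t => slice_smul_left hτ c b t)

lemma mnorm_sliceCB_le (hτ : IsInnerMul τ) (b : Matrix ι ι (L →L[ℂ] L)) :
    (OpSpace.cb (OpSpace.T K) (OpSpace.B H)).mnorm (b.map (sliceCB hτ)) ≤ ‖opMat b‖ :=
  (OpSpace.cb_mnorm (b.map (sliceCB hτ))).le.trans (isMatCBBound_sliceMap hτ b).norm_le

end Slice

/-! ### The Hilbert space tensor product -/

section HilbertTensorProduct

open InnerProductSpace UniformSpace

variable {H : Type u} [NormedAddCommGroup H] [InnerProductSpace ℂ H] [CompleteSpace H]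
variable {K : Type v} [NormedAddCommGroup K] [InnerProductSpace ℂ K] [CompleteSpace K]

variable (H K) in
/-- The bilinear map `(x, y) ↦ x ⊗ y` into the Hilbert space tensor product. -/
def elemTensor : H →ₗ[ℂ] K →ₗ[ℂ] HilbertTensor H K :=
  (TensorProduct.mk ℂ H K).compr₂ (Completion.toComplL (𝕜 := ℂ) (E := H ⊗[ℂ] K)).toLinearMap

lemma isInnerMul_elemTensor : IsInnerMul (elemTensor H K) := fun _ _ _ _ =>
  (Completion.inner_coe _ _).trans (TensorProduct.inner_tmul ..)

lemma opTensor_elemTensor (a : H →L[ℂ] H) (b : K →L[ℂ] K) (x : H) (y : K) :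
    opTensor a b (elemTensor H K x y) = elemTensor H K (a x) (b y) := opTensor_tmul a b x y

lemma eq_top_of_elemTensor_mem {p : Submodule ℂ (HilbertTensor H K)}
    (hp : IsClosed (p : Set (HilbertTensor H K))) (h : ∀ x y, elemTensor H K x y ∈ p) : p = ⊤ := by
  have h1 : p.comap (Completion.toComplL (𝕜 := ℂ) (E := H ⊗[ℂ] K)).toLinearMap = ⊤ := by
    rw [eq_top_iff, ← TensorProduct.span_tmul_eq_top, Submodule.span_le]
    rintro _ ⟨x, y, rfl⟩
    exact h x y
  refine Submodule.eq_top_iff'.2 fun z => ?_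
  refine Completion.induction_on z hp fun v => ?_
  have : v ∈ p.comap (Completion.toComplL (𝕜 := ℂ) (E := H ⊗[ℂ] K)).toLinearMap := by
    rw [h1]; trivial
  exact this

lemma ext_elemTensor {F : Type*} [NormedAddCommGroup F] [NormedSpace ℂ F]
    {f g : HilbertTensor H K →L[ℂ] F}
    (h : ∀ x y, f (elemTensor H K x y) = g (elemTensor H K x y)) : f = g := by
  have h1 : LinearMap.ker ((f - g : HilbertTensor H K →L[ℂ] F) : HilbertTensor H K →ₗ[ℂ] F) = ⊤ :=
    eq_top_of_elemTensor_mem (f - g).isClosed_ker fun x y => by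
      rw [LinearMap.mem_ker]
      exact sub_eq_zero.2 (h x y)
  refine ContinuousLinearMap.ext fun z => sub_eq_zero.1 ?_
  have : z ∈ LinearMap.ker ((f - g : HilbertTensor H K →L[ℂ] F) :
      HilbertTensor H K →ₗ[ℂ] F) := by rw [h1]; trivial
  exact this

variable (H K) in
/-- The Hilbert basis `eₖ ⊗ fₗ` of the Hilbert space tensor product. -/
lemma exists_tensorBasis : ∃ w : HilbertBasis (basisSet H × basisSet K) ℂ (HilbertTensor H K),
    ∀ p, w p = elemTensor H K (stdBasis H p.1) (stdBasis K p.2) := by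
  classical
  let w : basisSet H × basisSet K → HilbertTensor H K := fun p =>
    elemTensor H K (stdBasis H p.1) (stdBasis K p.2)
  have ho : Orthonormal ℂ w := by
    rw [orthonormal_iff_ite]
    rintro ⟨k, l⟩ ⟨k', l'⟩
    rw [isInnerMul_elemTensor, orthonormal_iff_ite.1 (stdBasis H).orthonormal,
      orthonormal_iff_ite.1 (stdBasis K).orthonormal]
    simp only [Prod.mk.injEq]
    split_ifs <;> simp_all
  have hs : (Submodule.span ℂ (Set.range w)).topologicalClosure = ⊤ := by
    set p := (Submodule.span ℂ (Set.range w)).topologicalClosure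
    have hp : IsClosed (p : Set (HilbertTensor H K)) := Submodule.isClosed_topologicalClosure _
    have h1 : ∀ k y, elemTensor H K (stdBasis H k) y ∈ p := fun k y => by
      let q : Submodule ℂ K := p.comap (leg isInnerMul_elemTensor (stdBasis H k)).toLinearMap
      have hq : IsClosed (q : Set K) :=
        hp.preimage (leg isInnerMul_elemTensor (stdBasis H k)).continuous
      have h2 : (Submodule.span ℂ (Set.range (stdBasis K))).topologicalClosure ≤ q := by
        refine Submodule.topologicalClosure_minimal _ (Submodule.span_le.2 ?_) hq
        rintro _ ⟨l, rfl⟩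
        exact Submodule.le_topologicalClosure _ (Submodule.subset_span ⟨(k, l), rfl⟩)
      rw [(stdBasis K).dense_span] at h2
      exact h2 trivial
    refine eq_top_of_elemTensor_mem hp fun x y => ?_
    let q : Submodule ℂ H := p.comap (leg isInnerMul_elemTensor.flip y).toLinearMap
    have hq : IsClosed (q : Set H) := hp.preimage (leg isInnerMul_elemTensor.flip y).continuous
    have h2 : (Submodule.span ℂ (Set.range (stdBasis H))).topologicalClosure ≤ q := by
      refine Submodule.topologicalClosure_minimal _ (Submodule.span_le.2 ?_) hq
      rintro _ ⟨k, rfl⟩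
      exact h1 k y
    rw [(stdBasis H).dense_span] at h2
    exact h2 trivial
  exact ⟨HilbertBasis.mk ho hs.ge, fun p => congrFun (HilbertBasis.coe_mk ho hs.ge) p⟩

lemma norm_opTensor_le (a : H →L[ℂ] H) (b : K →L[ℂ] K) : ‖opTensor a b‖ ≤ ‖a‖ * ‖b‖ := by
  refine ContinuousLinearMap.opNorm_le_bound _ (by positivity) fun z => ?_
  refine Completion.induction_on z (isClosed_le (by fun_prop) (by fun_prop)) fun v => ?_
  have h : opTensor a b (v : HilbertTensor H K) = (TensorProduct.mapL a b v : H ⊗[ℂ] K) :=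
    ContinuousLinearMap.completion_apply_coe _ _
  rw [h, Completion.norm_coe, Completion.norm_coe]
  exact (ContinuousLinearMap.le_opNorm _ _).trans
    (mul_le_mul_of_nonneg_right (TensorProduct.norm_mapL_le a b) (norm_nonneg _))

lemma opTensor_add_left (a a' : H →L[ℂ] H) (b : K →L[ℂ] K) :
    opTensor (a + a') b = opTensor a b + opTensor a' b := ext_elemTensor fun x y => by
  simp only [add_apply, opTensor_elemTensor, map_add, LinearMap.add_apply]

lemma opTensor_add_right (a : H →L[ℂ] H) (b b' : K →L[ℂ] K) :
    opTensor a (b + b') = opTensor a b + opTensor a b' := ext_elemTensor fun x y => by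
  simp only [add_apply, opTensor_elemTensor, map_add]

lemma opTensor_smul_left (c : ℂ) (a : H →L[ℂ] H) (b : K →L[ℂ] K) :
    opTensor (c • a) b = c • opTensor a b := ext_elemTensor fun x y => by
  simp only [smul_apply, opTensor_elemTensor, map_smul, LinearMap.smul_apply]

lemma opTensor_smul_right (c : ℂ) (a : H →L[ℂ] H) (b : K →L[ℂ] K) :
    opTensor a (c • b) = c • opTensor a b := ext_elemTensor fun x y => by
  simp only [smul_apply, opTensor_elemTensor, map_smul]

lemma opTensor_rankOne (x x' : H) (y y' : K) :
    opTensor (rankOne ℂ x x') (rankOne ℂ y y')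
      = rankOne ℂ (elemTensor H K x y) (elemTensor H K x' y') := ext_elemTensor fun z w => by
  rw [opTensor_elemTensor, rankOne_apply, rankOne_apply, rankOne_apply, isInnerMul_elemTensor,
    map_smul, map_smul, LinearMap.smul_apply, smul_smul, mul_comm]

/-! ### Tensor products of trace-class operators -/

/-- The pairings of `s ⊗ t` with finite rank operators are the slice forms of the latter. -/
lemma sum_inner_opTensor {σ : Type*} (S : Finset σ) (x y : σ → HilbertTensor H K)
    (s : TraceClass H) (t : TraceClass K) :
    ∑ i ∈ S, ⟪y i, opTensor s.toOp t.toOp (x i)⟫_ℂ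
      = sliceForm isInnerMul_elemTensor (finRank S x y) s t := by
  let f : TraceClass H →ₗ[ℂ] TraceClass K →ₗ[ℂ] ℂ :=
    LinearMap.mk₂ ℂ (fun s t => ∑ i ∈ S, ⟪y i, opTensor s.toOp t.toOp (x i)⟫_ℂ)
      (fun s s' t => by
        simp only [map_add, opTensor_add_left, add_apply, inner_add_right, Finset.sum_add_distrib])
      (fun c s t => by
        simp only [map_smul, opTensor_smul_left, smul_apply, inner_smul_right, Finset.mul_sum,
          smul_eq_mul])
      (fun s t t' => by
        simp only [map_add, opTensor_add_right, add_apply, inner_add_right,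
          Finset.sum_add_distrib])
      (fun c s t => by
        simp only [map_smul, opTensor_smul_right, smul_apply, inner_smul_right, Finset.mul_sum,
          smul_eq_mul])
  have hf : ∀ s t, ‖f s t‖ ≤ (∑ i ∈ S, ‖y i‖ * ‖x i‖) * ‖s‖ * ‖t‖ := fun s t => by
    rw [mul_assoc, Finset.sum_mul]
    refine norm_sum_le_of_le _ fun i _ => (norm_inner_le_norm _ _).trans ?_
    have h1 := ((opTensor s.toOp t.toOp).le_opNorm (x i)).trans
      (mul_le_mul_of_nonneg_right (norm_opTensor_le s.toOp t.toOp) (norm_nonneg _))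
    have h2 : ‖s.toOp‖ ≤ ‖s‖ := s.finBound.norm_le
    have h3 : ‖t.toOp‖ ≤ ‖t‖ := t.finBound.norm_le
    calc ‖y i‖ * ‖opTensor s.toOp t.toOp (x i)‖ ≤ ‖y i‖ * (‖s‖ * ‖t‖ * ‖x i‖) := by
          gcongr
          exact h1.trans (by gcongr)
      _ = _ := by ring
  have h := TraceClass.bilin_ext hf (norm_sliceForm_le isInnerMul_elemTensor (finRank S x y))
    fun k k' l l' => by
      rw [sliceForm_rankOneTC, finRank_apply, inner_sum]
      refine Finset.sum_congr rfl fun i _ => ?_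
      rw [toOp_rankOneTC, toOp_rankOneTC, opTensor_rankOne, rankOne_apply, inner_smul_right,
        inner_smul_right, mul_comm]
  exact LinearMap.congr_fun (LinearMap.congr_fun h s) t

lemma finBound_opTensor (s : TraceClass H) (t : TraceClass K) :
    FinBound (opTensor s.toOp t.toOp) (‖s‖ * ‖t‖) :=
  ⟨by positivity, fun σ S x y => by
    rw [sum_inner_opTensor]
    exact (norm_sliceForm_le _ _ _ _).trans (le_of_eq (by ring))⟩

/-- The trace-class operator `s ⊗ t`. -/
def tensorTC (s : TraceClass H) (t : TraceClass K) : TraceClass (HilbertTensor H K) :=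
  TraceClass.mk (opTensor s.toOp t.toOp) (finBound_opTensor s t).isTraceClass

lemma toOp_tensorTC (s : TraceClass H) (t : TraceClass K) :
    (tensorTC s t).toOp = opTensor s.toOp t.toOp := rfl

lemma norm_tensorTC_le (s : TraceClass H) (t : TraceClass K) : ‖tensorTC s t‖ ≤ ‖s‖ * ‖t‖ :=
  (finBound_opTensor s t).traceNorm_le

lemma tensorTC_rankOneTC (x x' : H) (y y' : K) :
    tensorTC (rankOneTC x x') (rankOneTC y y')
      = rankOneTC (elemTensor H K x y) (elemTensor H K x' y') :=
  TraceClass.toOp_injective (opTensor_rankOne x x' y y')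

variable (H K) in
/-- The bilinear map `(s, t) ↦ s ⊗ t` on trace-class operators. -/
def tensorTCBilin : TraceClass H →ₗ[ℂ] TraceClass K →ₗ[ℂ] TraceClass (HilbertTensor H K) :=
  LinearMap.mk₂ ℂ tensorTC
    (fun s s' t => TraceClass.toOp_injective (by
      simp only [map_add, toOp_tensorTC, opTensor_add_left]))
    (fun c s t => TraceClass.toOp_injective (by
      simp only [map_smul, toOp_tensorTC, opTensor_smul_left]))
    (fun s t t' => TraceClass.toOp_injective (by
      simp only [map_add, toOp_tensorTC, opTensor_add_right]))
    (fun c s t => TraceClass.toOp_injective (by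
      simp only [map_smul, toOp_tensorTC, opTensor_smul_right]))

/-- The form `(s, t) ↦ tr((s ⊗ t) b)`. -/
def traceForm (b : HilbertTensor H K →L[ℂ] HilbertTensor H K) :
    TraceClass H →ₗ[ℂ] TraceClass K →ₗ[ℂ] ℂ :=
  (tensorTCBilin H K).compr₂
    { toFun := fun r => trace (r.toOp * b)
      map_add' := fun r r' => by rw [map_add, r.finBound.trace_add_mul r'.finBound]
      map_smul' := fun c r => by rw [map_smul, r.finBound.trace_smul_mul]; rfl }

lemma traceForm_apply (b : HilbertTensor H K →L[ℂ] HilbertTensor H K) (s : TraceClass H)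
    (t : TraceClass K) : traceForm b s t = trace (opTensor s.toOp t.toOp * b) := rfl

lemma norm_traceForm_le (b : HilbertTensor H K →L[ℂ] HilbertTensor H K) (s : TraceClass H)
    (t : TraceClass K) : ‖traceForm b s t‖ ≤ ‖b‖ * ‖s‖ * ‖t‖ := by
  refine ((tensorTC s t).norm_trace_mul_le b).trans ?_
  calc _ ≤ ‖s‖ * ‖t‖ * ‖b‖ := by gcongr; exact norm_tensorTC_le s t
    _ = _ := by ring

lemma traceForm_rankOneTC (b : HilbertTensor H K →L[ℂ] HilbertTensor H K) (x x' : H) (y y' : K) :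
    traceForm b (rankOneTC x x') (rankOneTC y y')
      = ⟪elemTensor H K x' y', b (elemTensor H K x y)⟫_ℂ := by
  rw [traceForm_apply, toOp_rankOneTC, toOp_rankOneTC, opTensor_rankOne, trace_rankOne_mul]

lemma trace_opTensor_mul (b : HilbertTensor H K →L[ℂ] HilbertTensor H K) (s : TraceClass H)
    (t : TraceClass K) : trace (opTensor s.toOp t.toOp * b)
      = trace (s.toOp * slice isInnerMul_elemTensor b t) := by
  have h := TraceClass.bilin_ext (norm_traceForm_le b)
    (norm_sliceForm_le isInnerMul_elemTensor b) fun k k' l l' => by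
      rw [sliceForm_rankOneTC, traceForm_rankOneTC]
  exact LinearMap.congr_fun (LinearMap.congr_fun h s) t

lemma trace_opTensor_mul' (b : HilbertTensor H K →L[ℂ] HilbertTensor H K) (s : TraceClass H)
    (t : TraceClass K) : trace (opTensor s.toOp t.toOp * b)
      = trace (t.toOp * slice isInnerMul_elemTensor.flip b s) :=
  (trace_opTensor_mul b s t).trans (sliceForm_flip isInnerMul_elemTensor b s t).symm

variable (H K) in
lemma tensorTCBilin_jcc : IsJCC (X := OpSpace.T H) (Y := OpSpace.T K)
    (Z := OpSpace.T (HilbertTensor H K)) (tensorTCBilin H K) := by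
  intro m n s t
  have hs : 0 ≤ (OpSpace.T H).mnorm s := (OpSpace.T H).mn.N_nonneg s
  have ht : 0 ≤ (OpSpace.T K).mnorm t := (OpSpace.T K).mn.N_nonneg t
  rw [← OpSpace.mnorm_fin, ← OpSpace.mnorm_fin]
  refine T_mnorm_le (mul_nonneg hs ht) fun k X => ?_
  have h1 := scalarNorm_trace_le s (Matrix.of fun p q : Fin k × Fin n =>
    slice isInnerMul_elemTensor (X p.1 q.1) (t p.2 q.2))
  have h2 := h1.trans (mul_le_mul_of_nonneg_left
    (norm_opMat_slice_le isInnerMul_elemTensor X t) hs)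
  refine le_trans (le_of_eq ?_) (h2.trans (le_of_eq (by ring)))
  let e : Fin k × (Fin m × Fin n) ≃ (Fin k × Fin n) × Fin m :=
    ((Equiv.refl _).prodCongr (Equiv.prodComm _ _)).trans (Equiv.prodAssoc _ _ _).symm
  rw [← scalarNorm_submatrix_equiv (Matrix.of fun p q : (Fin k × Fin n) × Fin m => _) e e]
  congr 1
  ext p q
  exact trace_opTensor_mul (X p.1 q.1) (s p.2.1 q.2.1) (t p.2.2 q.2.2)

variable (H K) in
/-- The canonical complete contraction `T(H) ⊗^ T(K) → T(H ⊗₂ K)`. -/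
def tensorMap : CCMap (OpSpace.proj (OpSpace.T H) (OpSpace.T K))
    (OpSpace.T (HilbertTensor H K)) :=
  lift (X := OpSpace.T H) (Y := OpSpace.T K) (Z := OpSpace.T (HilbertTensor H K))
    (tensorTCBilin H K) (tensorTCBilin_jcc H K)

lemma tensorMap_tmul (s : TraceClass H) (t : TraceClass K) :
    tensorMap H K (tmul (X := OpSpace.T H) (Y := OpSpace.T K) s t) = tensorTC s t :=
  lift_tmul _ _ _ _

end HilbertTensorProduct

/-! ### Operators from bounded forms on trace-class operators -/

section Realization

open InnerProductSpace

variable {H : Type u} [NormedAddCommGroup H] [InnerProductSpace ℂ H] [CompleteSpace H]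
variable {K : Type v} [NormedAddCommGroup K] [InnerProductSpace ℂ K] [CompleteSpace K]
variable {ι : Type} [Fintype ι]

/-- A finite family factors through an injective finite family. The index sets of matrices live in
`Type`, so subsets of a basis of `H` have to be enumerated by some `Fin n`. -/
lemma exists_fin_enum {α : Type*} {d : ℕ} (f : Fin d → α) :
    ∃ (n : ℕ) (e : Fin n → α) (g : Fin d → Fin n), Function.Injective e ∧ ∀ a, e (g a) = f a := by
  classical
  let S : Finset α := Finset.univ.image f
  exact ⟨S.card, fun i => (S.equivFin.symm i : α),
    fun a => S.equivFin ⟨f a, Finset.mem_image_of_mem f (Finset.mem_univ a)⟩,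
    Subtype.val_injective.comp S.equivFin.symm.injective, fun a => by simp⟩

/-- A matrix of jointly completely bounded forms on `T(H) × T(K)` comes from a matrix of operators
on `H ⊗₂ K` of the same norm. The matrix coefficients of the operators are the values of the forms
at matrix units; a finite section of them is bounded because a finite set of basis vectors
`eₖ ⊗ fₗ` lies in a product set, and matrix units form a contraction over the trace class. -/
lemma exists_operator_of_forms (φ : Matrix ι ι (TraceClass H →ₗ[ℂ] TraceClass K →ₗ[ℂ] ℂ)) {C : ℝ}
    (hC : 0 ≤ C)
    (hφ : ∀ (m n : ℕ) (x : Matrix (Fin m) (Fin m) (TraceClass H))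
      (y : Matrix (Fin n) (Fin n) (TraceClass K)),
      scalarNorm (Matrix.of fun p q : (Fin m × Fin n) × ι =>
        φ p.2 q.2 (x p.1.1 q.1.1) (y p.1.2 q.1.2))
        ≤ C * (OpSpace.T H).mnorm x * (OpSpace.T K).mnorm y) :
    ∃ b : Matrix ι ι (HilbertTensor H K →L[ℂ] HilbertTensor H K),
      ‖opMat b‖ ≤ C ∧ ∀ i j, φ i j = traceForm (b i j) := by
  obtain ⟨w, hw⟩ := exists_tensorBasis H K
  obtain ⟨b, hb, hbC⟩ := exists_operator_matrix w (fun (i j : ι) p q =>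
    φ i j (rankOneTC (stdBasis H q.1) (stdBasis H p.1))
      (rankOneTC (stdBasis K q.2) (stdBasis K p.2))) hC fun d f hf => by
    -- the section is a submatrix of the value of `φ` at the matrix units of a product set
    obtain ⟨m, e, g, he, hg⟩ := exists_fin_enum fun a => (f a).1
    obtain ⟨n, e', g', he', hg'⟩ := exists_fin_enum fun a => (f a).2
    have h1 : (OpSpace.T H).mnorm (Matrix.of fun p q =>
        rankOneTC (stdBasis H (e q)) (stdBasis H (e p))) ≤ 1 :=
      T_mnorm_rankOneTC_le ((stdBasis H).orthonormal.comp e he)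
    have h2 : (OpSpace.T K).mnorm (Matrix.of fun p q =>
        rankOneTC (stdBasis K (e' q)) (stdBasis K (e' p))) ≤ 1 :=
      T_mnorm_rankOneTC_le ((stdBasis K).orthonormal.comp e' he')
    have h3 := hφ m n (Matrix.of fun p q => rankOneTC (stdBasis H (e q)) (stdBasis H (e p)))
      (Matrix.of fun p q => rankOneTC (stdBasis K (e' q)) (stdBasis K (e' p)))
    have h4 : C * (OpSpace.T H).mnorm (Matrix.of fun p q =>
        rankOneTC (stdBasis H (e q)) (stdBasis H (e p))) * (OpSpace.T K).mnorm (Matrix.of fun p q =>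
        rankOneTC (stdBasis K (e' q)) (stdBasis K (e' p))) ≤ C :=
      (mul_le_of_le_one_right (mul_nonneg hC ((OpSpace.T H).mn.N_nonneg _)) h2).trans
        (mul_le_of_le_one_right hC h1)
    have hr : Function.Injective fun p : ι × Fin d => ((g p.2, g' p.2), p.1) := by
      rintro ⟨i, a⟩ ⟨j, c⟩ h
      simp only [Prod.mk.injEq] at h
      obtain ⟨⟨h5, h6⟩, h7⟩ := h
      refine Prod.ext h7 (hf (Prod.ext ?_ ?_))
      · rw [← hg, ← hg, h5]
      · rw [← hg', ← hg', h6]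
    refine le_trans (le_of_eq ?_)
      ((complexMatNorm.N_submatrix_le _ hr _).trans (h3.trans h4))
    change scalarNorm _ = scalarNorm _
    congr 1
    ext p q
    simp only [Matrix.of_apply, Matrix.submatrix_apply, hg, hg']
  refine ⟨b, hbC, fun i j => ?_⟩
  have h1 : ∀ s t, ‖φ i j s t‖ ≤ C * ‖s‖ * ‖t‖ := fun s t => by
    have h2 := hφ 1 1 (Matrix.of fun _ _ => s) (Matrix.of fun _ _ => t)
    have h3 : (OpSpace.T H).mnorm (Matrix.of fun _ _ : Fin 1 => s) = ‖s‖ :=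
      (OpSpace.mnorm_fin _ _).trans ((OpSpace.T H).matNorm_one s)
    have h4 : (OpSpace.T K).mnorm (Matrix.of fun _ _ : Fin 1 => t) = ‖t‖ :=
      (OpSpace.mnorm_fin _ _).trans ((OpSpace.T K).matNorm_one t)
    exact (norm_entry_le (Matrix.of fun p q : (Fin 1 × Fin 1) × ι => φ p.2 q.2 s t)
      ((0, 0), i) ((0, 0), j)).trans
      (h2.trans (le_of_eq (congrArg₂ (fun a a' => C * a * a') h3 h4)))
  refine TraceClass.bilin_ext h1 (norm_traceForm_le (b i j)) fun k k' l l' => ?_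
  rw [traceForm_rankOneTC]
  have h2 := hb i j (k', l') (k, l)
  rw [hw, hw] at h2
  exact h2.symm

/-! ### The trace class of a tensor product -/

lemma proj_linear_ext {X : OpSpace.{u}} {Y : OpSpace.{v}} {f g : OpSpace.proj X Y →ₗ[ℂ] ℂ}
    (hf : Continuous f) (hg : Continuous g) (h : ∀ x y, f (tmul x y) = g (tmul x y)) : f = g := by
  have h2 : f ∘ₗ toProj X Y = g ∘ₗ toProj X Y := TensorProduct.ext' h
  refine LinearMap.ext fun z => ?_
  exact congrFun ((UniformSpace.Completion.denseRange_coe (α := AlgProj X Y)).equalizer hf hg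
    (funext fun v => LinearMap.congr_fun h2 v)) z

/-- The map `T(H) ⊗^ T(K) → T(H ⊗₂ K)` does not decrease matrix norms: by Ruan's theorem the norm
of a matrix is attained up to `ε` by a matrix of functionals on `T(H) ⊗^ T(K)`, and these
functionals come from operators on `H ⊗₂ K`. -/
lemma mnorm_le_mnorm_tensorMap
    (v : Matrix ι ι (OpSpace.proj (OpSpace.T H) (OpSpace.T K))) :
    (OpSpace.proj (OpSpace.T H) (OpSpace.T K)).mnorm v
      ≤ (OpSpace.T (HilbertTensor H K)).mnorm (v.map (tensorMap H K)) := by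
  set N := (OpSpace.T (HilbertTensor H K)).mnorm (v.map (tensorMap H K))
  have hN : 0 ≤ N := (OpSpace.T (HilbertTensor H K)).mn.N_nonneg _
  have key : ∀ δ : ℝ, 0 < δ →
      (OpSpace.proj (OpSpace.T H) (OpSpace.T K)).mnorm v ≤ (1 + δ) * N := fun δ hδ => by
    obtain ⟨φ, hφ, hv⟩ := exists_dual_matrix _ v hδ
    refine hv.trans (mul_le_mul_of_nonneg_left ?_ (by positivity))
    obtain ⟨b, hb, hφb⟩ := exists_operator_of_forms (H := H) (K := K) (Matrix.of fun i j =>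
      ((mkBilin (OpSpace.T H) (OpSpace.T K)).compr₂ (φ i j) :
        TraceClass H →ₗ[ℂ] TraceClass K →ₗ[ℂ] ℂ)) zero_le_one fun m n x y => by
      have h1 := hφ.le (bilinAmp (fun s t => mkBilin (OpSpace.T H) (OpSpace.T K) s t) x y)
      have h2 := (mkBilin_jcc (X := OpSpace.T H) (Y := OpSpace.T K)).le x y
      rw [one_mul] at h1 ⊢
      exact (complex_mnorm _).ge.trans (h1.trans h2)
    have hφz : ∀ i j z, φ i j z = trace ((tensorMap H K z : TraceClass _).toOp * b i j) := by
      intro i j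
      let g : OpSpace.proj (OpSpace.T H) (OpSpace.T K) →ₗ[ℂ] ℂ :=
        { toFun := fun z => trace ((tensorMap H K z : TraceClass _).toOp * b i j)
          map_add' := fun z z' => by
            have h := congrArg TraceClass.toOp ((tensorMap H K).toLinearMap.map_add z z')
            rw [h]
            exact (TraceClass.finBound _).trace_add_mul (TraceClass.finBound _) _
          map_smul' := fun c z => by
            have h := congrArg TraceClass.toOp ((tensorMap H K).toLinearMap.map_smul c z)
            rw [h]
            exact (TraceClass.finBound _).trace_smul_mul c _ }
      have hg : Continuous g := by
        refine AddMonoidHomClass.continuous_of_bound g ‖b i j‖ fun z => ?_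
        refine (TraceClass.norm_trace_mul_le _ _).trans ?_
        rw [mul_comm]
        exact mul_le_mul_of_nonneg_left ((tensorMap H K).norm_le z) (norm_nonneg _)
      have hf : Continuous (φ i j) := by
        refine AddMonoidHomClass.continuous_of_bound (φ i j) 1 fun z => ?_
        have h1 := hφ.le (Matrix.of fun _ _ : Unit => z)
        have h2 := OpSpace.complex.mn.entry_le (bigAmp φ (Matrix.of fun _ _ : Unit => z))
          ((), i) ((), j)
        rw [OpSpace.nrm_eq] at h2
        exact h2.trans (h1.trans (le_of_eq (congrArg _ (OpSpace.nrm_eq _ z))))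
      have h : φ i j = g := proj_linear_ext hf hg fun s t => by
        have h1 := LinearMap.congr_fun (LinearMap.congr_fun (hφb i j) s) t
        have h2 := congrArg TraceClass.toOp (tensorMap_tmul s t)
        exact h1.trans ((traceForm_apply _ _ _).trans
          (congrArg (fun A => trace (A * b i j)) h2).symm)
      exact fun z => LinearMap.congr_fun h z
    have h3 := scalarNorm_trace_le (v.map (tensorMap H K)) b
    have h4 := h3.trans (mul_le_of_le_one_right hN hb)
    refine le_trans (le_of_eq ?_) h4
    refine (complex_mnorm _).trans ?_
    rw [← scalarNorm_submatrix_equiv _ (Equiv.prodComm ι ι) (Equiv.prodComm ι ι)]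
    congr 1
    ext p q
    exact hφz _ _ _
  refine le_of_forall_pos_le_add fun ε hε => ?_
  have h := key (ε / (N + 1)) (by positivity)
  have h1 : ε / (N + 1) * N ≤ ε := by
    rw [div_mul_eq_mul_div, div_le_iff₀ (by positivity)]
    nlinarith
  linarith

variable (H K) in
lemma isCompletelyIsometricIso_tensorMap : (tensorMap H K).IsCompletelyIsometricIso := by
  have hiso : ∀ (n : ℕ) (x : Matrix (Fin n) (Fin n) (OpSpace.proj (OpSpace.T H) (OpSpace.T K))),
      (OpSpace.T (HilbertTensor H K)).matNorm n (x.map (tensorMap H K))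
        = (OpSpace.proj (OpSpace.T H) (OpSpace.T K)).matNorm n x := fun n x => by
    refine le_antisymm ((tensorMap H K).contractive n x) ?_
    rw [← OpSpace.mnorm_fin, ← OpSpace.mnorm_fin]
    exact mnorm_le_mnorm_tensorMap x
  refine ⟨?_, hiso⟩
  have h1 : Isometry (tensorMap H K).toLinearMap :=
    AddMonoidHomClass.isometry_of_norm _ fun z => by
      rw [← OpSpace.matNorm_one, ← OpSpace.matNorm_one]
      exact hiso 1 (Matrix.of fun _ _ => z)
  have h2 : IsClosed (LinearMap.range (tensorMap H K).toLinearMap :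
      Set (OpSpace.T (HilbertTensor H K))) := by
    rw [LinearMap.coe_range]
    exact h1.isClosedEmbedding.isClosed_range
  let D : Set (HilbertTensor H K) := Set.range fun p : H × K => elemTensor H K p.1 p.2
  have hD : (Submodule.span ℂ D).topologicalClosure = ⊤ :=
    eq_top_of_elemTensor_mem (Submodule.isClosed_topologicalClosure _) fun x y =>
      Submodule.le_topologicalClosure _ (Submodule.subset_span ⟨(x, y), rfl⟩)
  have h3 : LinearMap.range (tensorMap H K).toLinearMap = ⊤ :=
    TraceClass.eq_top_of_rankOneTC_mem (H := HilbertTensor H K) h2 hD (by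
      rintro _ ⟨⟨x, y⟩, rfl⟩ _ ⟨⟨x', y'⟩, rfl⟩
      exact ⟨_, (tensorMap_tmul (rankOneTC x x') (rankOneTC y y')).trans
        (tensorTC_rankOneTC x x' y y')⟩)
  exact LinearMap.range_eq_top.1 h3

/-! ### The spatial tensor product of the full operator algebras -/

/-- Operators that commute with all `a ⊗ b` are scalars: they commute with the rank one operators
between elementary tensors. -/
lemma exists_eq_smul_one_of_commute {Z : HilbertTensor H K →L[ℂ] HilbertTensor H K}
    (h : ∀ a b, opTensor a b * Z = Z * opTensor a b) : ∃ c : ℂ, Z = c • 1 := by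
  -- if the space is zero, every operator is the scalar `0`
  by_cases h0 : ∀ x y, elemTensor H K x y = 0
  · exact ⟨0, ext_elemTensor fun x y => by rw [h0, map_zero, map_zero]⟩
  push Not at h0
  obtain ⟨x₀, y₀, h0⟩ := h0
  set u := elemTensor H K x₀ y₀
  have hu : ⟪u, u⟫_ℂ ≠ 0 := inner_self_ne_zero.2 h0
  refine ⟨(⟪u, u⟫_ℂ)⁻¹ * ⟪u, Z u⟫_ℂ, ext_elemTensor fun x y => ?_⟩
  have h1 := congrArg (fun A => A u) (h (rankOne ℂ x x₀) (rankOne ℂ y y₀))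
  simp only [opTensor_rankOne, mul_apply_eq_comp, rankOne_apply, map_smul] at h1
  rw [smul_apply, mul_smul, one_apply_eq_self, h1, inv_smul_smul₀ hu]

variable (H K) in
lemma mem_spatialTensor_full (T : HilbertTensor H K →L[ℂ] HilbertTensor H K) :
    T ∈ spatialTensor (fullVNA H) (fullVNA K) := by
  have h : T ∈ (spatialTensor (fullVNA H) (fullVNA K) :
      Set (HilbertTensor H K →L[ℂ] HilbertTensor H K)) := by
    rw [spatialTensor, coe_generatedVNA]
    intro Z hZ
    obtain ⟨c, rfl⟩ := exists_eq_smul_one_of_commute fun a b =>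
      hZ _ (Or.inl ⟨a, trivial, b, trivial, rfl⟩)
    rw [smul_mul_assoc, mul_smul_comm, one_mul, mul_one]
  exact h

lemma mnorm_ofSubmodule (X : OpSpace.{u}) (S : Submodule ℂ X) (hS : IsClosed (S : Set X))
    (x : Matrix ι ι (X.ofSubmodule S hS)) :
    (X.ofSubmodule S hS).mnorm x = X.mnorm (x.map S.subtype) :=
  have := hS.completeSpace_coe
  X.mnorm_comap S S.subtypeₗᵢ x

variable (H K) in
lemma isCompletelyIsometricIso_vnaInclusion :
    (vnaInclusion (spatialTensor (fullVNA H) (fullVNA K))).IsCompletelyIsometricIso :=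
  ⟨fun T => ⟨⟨T, mem_spatialTensor_full H K T⟩, rfl⟩, fun n x => by
    refine le_antisymm (CCMap.contractive _ n x) ?_
    rw [← OpSpace.mnorm_fin, ← OpSpace.mnorm_fin]
    exact (mnorm_ofSubmodule _ _ _ x).le⟩

end Realization

/-! ### Completely isometric isomorphisms -/

section CompletelyIsometric

variable {X : OpSpace.{u}} {Y : OpSpace.{v}} {Z : OpSpace.{w}}

lemma CCMap.IsCompletelyIsometricIso.comp {g : CCMap Y Z} {f : CCMap X Y}
    (hg : g.IsCompletelyIsometricIso) (hf : f.IsCompletelyIsometricIso) :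
    (g.comp f).IsCompletelyIsometricIso :=
  ⟨hg.1.comp hf.1, fun n x => (hg.2 n (x.map f)).trans (hf.2 n x)⟩

lemma CCMap.IsCompletelyIsometricIso.exists_inverse {f : CCMap X Y}
    (hf : f.IsCompletelyIsometricIso) :
    ∃ g : CCMap Y X, g.comp f = CCMap.id X ∧ f.comp g = CCMap.id Y := by
  have hi : Function.Injective f.toLinearMap := by
    refine (injective_iff_map_eq_zero f.toLinearMap).2 fun x hx => ?_
    have h := hf.2 1 (Matrix.of fun _ _ => x)
    have h1 : (Matrix.of fun _ _ : Fin 1 => x).map f = Matrix.of fun _ _ => (0 : Y) := by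
      ext; exact hx
    rw [h1, OpSpace.matNorm_one, OpSpace.matNorm_one, norm_zero] at h
    exact norm_eq_zero.1 h.symm
  let e : X ≃ₗ[ℂ] Y := LinearEquiv.ofBijective f.toLinearMap ⟨hi, hf.1⟩
  refine ⟨⟨e.symm.toLinearMap, fun n y => ?_⟩, ?_, ?_⟩
  · have h := hf.2 n (y.map e.symm)
    have h1 : (y.map e.symm).map f = y := by ext i j; exact e.apply_symm_apply _
    rw [h1] at h
    exact h.ge
  · exact CCMap.ext (LinearMap.ext fun x => e.symm_apply_apply x)
  · exact CCMap.ext (LinearMap.ext fun y => e.apply_symm_apply y)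

end CompletelyIsometric

/-! ### The monoidal product of two trace pairings -/

section ChuTensor

open InnerProductSpace

variable {H : Type u} [NormedAddCommGroup H] [InnerProductSpace ℂ H] [CompleteSpace H]
variable {K : Type u} [NormedAddCommGroup K] [InnerProductSpace ℂ K] [CompleteSpace K]
variable {ι : Type} [Fintype ι]

lemma tr_pair (t : TraceClass H) (b : H →L[ℂ] H) :
    (QObj.tr H).pair t b = trace (t.toOp * b) := trPairing_tmul H t b

lemma prod_mnorm {X : OpSpace.{u}} {Y : OpSpace.{v}} (x : Matrix ι ι (X × Y)) :
    (OpSpace.prod X Y).mnorm x = max (X.mnorm (x.map Prod.fst)) (Y.mnorm (x.map Prod.snd)) :=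
  OpSpace.ofMatNorm_mnorm _ _ (fun v => by
    rw [Prod.norm_def, ← X.nrm_eq, ← Y.nrm_eq]; rfl) _

lemma tensorY_mnorm (A B : QObj.{u}) (p : Matrix ι ι (QObj.tensorY A B)) :
    (QObj.tensorY A B).mnorm p
      = max ((OpSpace.cb A.X B.Y).mnorm
          ((p.map (QObj.tensorSubmodule A B).subtype).map Prod.fst))
        ((OpSpace.cb B.X A.Y).mnorm
          ((p.map (QObj.tensorSubmodule A B).subtype).map Prod.snd)) :=
  (mnorm_ofSubmodule _ _ _ p).trans
    (prod_mnorm (X := OpSpace.cb A.X B.Y) (Y := OpSpace.cb B.X A.Y) _)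

variable (H K) in
/-- An operator on `H ⊗₂ K` yields the pair of its two slice maps. -/
def slicePair : (HilbertTensor H K →L[ℂ] HilbertTensor H K) →ₗ[ℂ]
    QObj.tensorY (QObj.tr H) (QObj.tr K) :=
  LinearMap.codRestrict (QObj.tensorSubmodule (QObj.tr H) (QObj.tr K))
    ((sliceCB (isInnerMul_elemTensor (H := H) (K := K)).flip).prod
      (sliceCB (isInnerMul_elemTensor (H := H) (K := K)))) fun b s t =>
    (tr_pair _ _).trans ((sliceForm_flip isInnerMul_elemTensor b s t).trans (tr_pair _ _).symm)

variable (H K) in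
/-- The complete contraction that sends an operator to the pair of its slice maps. -/
def slicePairMap : CCMap (OpSpace.B (HilbertTensor H K))
    (QObj.tensorY (QObj.tr H) (QObj.tr K)) :=
  ⟨slicePair H K, fun n b => by
    rw [← OpSpace.mnorm_fin, ← OpSpace.mnorm_fin, tensorY_mnorm]
    exact (max_le (mnorm_sliceCB_le _ b) (mnorm_sliceCB_le _ b)).trans (B_mnorm b).ge⟩

/-- Operators on `H ⊗₂ K` are separated by the operators `s ⊗ t`. -/
lemma eq_of_traceForm {b b' : HilbertTensor H K →L[ℂ] HilbertTensor H K}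
    (h : traceForm b = traceForm b') : b = b' := by
  obtain ⟨w, hw⟩ := exists_tensorBasis H K
  refine ext_elemTensor fun x y => w.repr.injective (lp.ext (funext fun p => ?_))
  rw [w.repr_apply_apply, w.repr_apply_apply, hw, ← traceForm_rankOneTC, ← traceForm_rankOneTC, h]

/-- Every matrix of compatible pairs comes from a matrix of operators of at most the same norm. -/
lemma exists_slicePair (p : Matrix ι ι (QObj.tensorY (QObj.tr H) (QObj.tr K))) :
    ∃ b : Matrix ι ι (HilbertTensor H K →L[ℂ] HilbertTensor H K),
      ‖opMat b‖ ≤ (QObj.tensorY (QObj.tr H) (QObj.tr K)).mnorm p ∧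
      ∀ i j, slicePair H K (b i j) = p i j := by
  -- the first component of a pair determines the form, hence the operator
  let q : Matrix ι ι (CB (OpSpace.T H) (OpSpace.B K) × CB (OpSpace.T K) (OpSpace.B H)) :=
    p.map (QObj.tensorSubmodule (QObj.tr H) (QObj.tr K)).subtype
  let F : Matrix ι ι (CB (OpSpace.T H) (OpSpace.B K)) := q.map Prod.fst
  have hF : matCBNorm (F.map (cbSubmodule (OpSpace.T H) (OpSpace.B K)).subtype)
      ≤ (QObj.tensorY (QObj.tr H) (QObj.tr K)).mnorm p := by
    rw [tensorY_mnorm]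
    exact (OpSpace.cb_mnorm F).ge.trans (le_max_left _ _)
  obtain ⟨b, hb, hφ⟩ := exists_operator_of_forms (H := H) (K := K) (Matrix.of fun i j =>
      ((QObj.tr K).pair.flip ∘ₗ (F i j : OpSpace.T H →ₗ[ℂ] OpSpace.B K) :
        TraceClass H →ₗ[ℂ] TraceClass K →ₗ[ℂ] ℂ)) ((matCBNorm_nonneg _).trans hF)
    fun m n x y => by
      have hy : 0 ≤ (OpSpace.T K).mnorm y := (OpSpace.T K).mn.N_nonneg y
      have hx : 0 ≤ (OpSpace.T H).mnorm x := (OpSpace.T H).mn.N_nonneg x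
      have h1 := scalarNorm_trace_le y
        (bigAmp (F.map (cbSubmodule (OpSpace.T H) (OpSpace.B K)).subtype) x)
      have h2 := (B_mnorm _).ge.trans (((CB.isMatCBBound F).le x).trans
        (mul_le_mul_of_nonneg_right hF hx))
      refine le_trans (le_of_eq ?_) ((h1.trans (mul_le_mul_of_nonneg_left h2 hy)).trans
        (le_of_eq (mul_comm _ _)))
      let e : (Fin m × Fin n) × ι ≃ (Fin m × ι) × Fin n :=
        (Equiv.prodAssoc _ _ _).trans (((Equiv.refl _).prodCongr (Equiv.prodComm _ _)).trans
          (Equiv.prodAssoc _ _ _).symm)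
      rw [← scalarNorm_submatrix_equiv (Matrix.of fun p q : (Fin m × ι) × Fin n => _) e e]
      congr 1
      ext p q
      exact tr_pair _ _
  let f : ι → ι → TraceClass H → (K →L[ℂ] K) := fun i j => (F i j : OpSpace.T H →ₗ[ℂ] OpSpace.B K)
  have hf : ∀ i j (s : TraceClass H) (t : TraceClass K),
      trace (t.toOp * f i j s) = traceForm (b i j) s t := fun i j s t =>
    (tr_pair _ _).symm.trans (LinearMap.congr_fun (LinearMap.congr_fun (hφ i j) s) t)
  refine ⟨b, hb, fun i j => Subtype.ext (Prod.ext (Subtype.ext (LinearMap.ext fun s => ?_))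
    (Subtype.ext (LinearMap.ext fun t => ?_)))⟩
  · refine eq_of_trace_mul (H := K) fun t => ?_
    exact (trace_opTensor_mul' (b i j) s t).symm.trans (hf i j s t).symm
  · refine eq_of_trace_mul (H := H) fun s => ?_
    refine (trace_opTensor_mul (b i j) s t).symm.trans ((hf i j s t).symm.trans ?_)
    exact (tr_pair _ _).symm.trans (((p i j).2 s t).trans (tr_pair _ _))

variable (H K) in
lemma isCompletelyIsometricIso_slicePairMap : (slicePairMap H K).IsCompletelyIsometricIso := by
  have hinj : Function.Injective (slicePair H K) := fun b b' h => by
    refine eq_of_traceForm (LinearMap.ext fun s => LinearMap.ext fun t => ?_)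
    have h1 : slice isInnerMul_elemTensor b t = slice isInnerMul_elemTensor b' t :=
      congrArg (fun p : QObj.tensorSubmodule (QObj.tr H) (QObj.tr K) =>
        (cbSubmodule (OpSpace.T K) (OpSpace.B H)).subtype p.1.2 t) h
    rw [traceForm_apply, traceForm_apply, trace_opTensor_mul, trace_opTensor_mul, h1]
  refine ⟨fun p => ?_, fun n b => le_antisymm ((slicePairMap H K).contractive n b) ?_⟩
  · obtain ⟨b, -, hb⟩ := exists_slicePair (Matrix.of fun _ _ : Unit => p)
    exact ⟨b () (), hb () ()⟩
  · obtain ⟨b', hb', h⟩ := exists_slicePair (b.map (slicePairMap H K))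
    have h1 : b' = b := by
      ext1 i j
      exact hinj (h i j)
    rw [h1, OpSpace.mnorm_fin] at hb'
    exact ((OpSpace.mnorm_fin _ _).ge.trans (B_mnorm b).le).trans hb'

variable (H K) in
/-- The object `(T(H) ⊗^ T(K), B(H) ⊗̄ B(K), tr')` of `Q`. -/
def spatialObj : QObj.{u} :=
  ⟨OpSpace.proj (OpSpace.T H) (OpSpace.T K),
    OpSpace.ofVNA (spatialTensor (fullVNA H) (fullVNA K)),
    (trPairing (HilbertTensor H K)).comp
      (CCMap.map (tensorMap H K) (vnaInclusion (spatialTensor (fullVNA H) (fullVNA K))))⟩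

lemma spatialObj_d (z : OpSpace.proj (OpSpace.T H) (OpSpace.T K))
    (y : OpSpace.ofVNA (spatialTensor (fullVNA H) (fullVNA K))) :
    (spatialObj H K).d (tmul (X := (spatialObj H K).X) (Y := (spatialObj H K).Y) z y)
      = trPairing (HilbertTensor H K) (tmul (tensorMap H K z)
        (vnaInclusion (spatialTensor (fullVNA H) (fullVNA K)) y)) :=
  congrArg (trPairing (HilbertTensor H K)) (CCMap.map_tmul (tensorMap H K)
    (vnaInclusion (spatialTensor (fullVNA H) (fullVNA K))) z y)

/-- The slice maps are adjoint to the identity of `T(H) ⊗^ T(K)`. -/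
lemma spatialObj_d_eq (z : OpSpace.proj (OpSpace.T H) (OpSpace.T K))
    (y : OpSpace.ofVNA (spatialTensor (fullVNA H) (fullVNA K))) :
    (spatialObj H K).pair z y = (QObj.tensor (QObj.tr H) (QObj.tr K)).pair z
      (slicePairMap H K (vnaInclusion (spatialTensor (fullVNA H) (fullVNA K)) y)) := by
  set p := slicePairMap H K (vnaInclusion (spatialTensor (fullVNA H) (fullVNA K)) y) with hp
  have hc : ∀ (A : QObj.{u}) (y : A.Y), Continuous (A.pair.flip y) := fun A y =>
    AddMonoidHomClass.continuous_of_bound (A.pair.flip y) ‖y‖ fun z =>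
      (A.norm_pair_le z y).trans (le_of_eq (mul_comm _ _))
  have h : (spatialObj H K).pair.flip y
      = (QObj.tensor (QObj.tr H) (QObj.tr K)).pair.flip p := by
    refine proj_linear_ext (X := OpSpace.T H) (Y := OpSpace.T K) (hc (spatialObj H K) y)
      (hc (QObj.tensor (QObj.tr H) (QObj.tr K)) p) fun s t => ?_
    have h1 := congrArg TraceClass.toOp (tensorMap_tmul s t)
    have h2 := QObj.tensor_d (QObj.tr H) (QObj.tr K) s t p
    refine (spatialObj_d _ y).trans ((trPairing_tmul _ _ _).trans (Eq.trans ?_ h2.symm))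
    refine (congrArg (fun A => trace (A * _)) h1).trans ?_
    exact (trace_opTensor_mul' _ s t).trans (tr_pair t _).symm
  exact LinearMap.congr_fun h z

variable (H K) in
lemma exists_iso_spatialObj :
    ∃ e : QObj.tensor (QObj.tr H) (QObj.tr K) ≅ spatialObj H K, e.hom.f = CCMap.id _ := by
  let G : CCMap (spatialObj H K).Y (QObj.tensor (QObj.tr H) (QObj.tr K)).Y :=
    (slicePairMap H K).comp (vnaInclusion (spatialTensor (fullVNA H) (fullVNA K)))
  have hG : G.IsCompletelyIsometricIso :=
    (isCompletelyIsometricIso_slicePairMap H K).comp (isCompletelyIsometricIso_vnaInclusion H K)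
  obtain ⟨G', h1, h2⟩ := hG.exists_inverse
  have h3 : ∀ p, G (G' p) = p := fun p => congrArg (fun F : CCMap _ _ => F p) h2
  let hom : QHom (QObj.tensor (QObj.tr H) (QObj.tr K)) (spatialObj H K) :=
    ⟨CCMap.id _, G, qhom_comm_iff (A := QObj.tensor (QObj.tr H) (QObj.tr K))
      (B := spatialObj H K) _ _ fun z y => spatialObj_d_eq z y⟩
  let inv : QHom (spatialObj H K) (QObj.tensor (QObj.tr H) (QObj.tr K)) :=
    ⟨CCMap.id _, G', qhom_comm_iff (A := spatialObj H K)
      (B := QObj.tensor (QObj.tr H) (QObj.tr K)) _ _ fun z p =>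
        ((spatialObj_d_eq z (G' p)).trans (congrArg
          ((QObj.tensor (QObj.tr H) (QObj.tr K)).pair z) (h3 p))).symm⟩
  exact ⟨⟨hom, inv, QHom.ext rfl h2, QHom.ext rfl h1⟩, rfl⟩

end ChuTensor

end QOS

end

theorem mainTheorem5
    (H₁ : Type u) [NormedAddCommGroup H₁] [InnerProductSpace ℂ H₁] [CompleteSpace H₁]
    (H₂ : Type u) [NormedAddCommGroup H₂] [InnerProductSpace ℂ H₂] [CompleteSpace H₂] :
    ∃ Φ : QOS.CCMap (QOS.OpSpace.proj (QOS.OpSpace.T H₁) (QOS.OpSpace.T H₂))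
        (QOS.OpSpace.T (QOS.HilbertTensor H₁ H₂)),
      Φ.IsCompletelyIsometricIso ∧
      (∀ (s : QOS.TraceClass H₁) (t : QOS.TraceClass H₂),
        QOS.TraceClass.toOp (Φ (QOS.tmul (X := QOS.OpSpace.T H₁) (Y := QOS.OpSpace.T H₂) s t))
          = QOS.opTensor s.toOp t.toOp) ∧
      (QOS.vnaInclusion
        (QOS.spatialTensor (QOS.fullVNA H₁) (QOS.fullVNA H₂))).IsCompletelyIsometricIso ∧
      ∃ e : QOS.QObj.tensor (QOS.QObj.tr H₁) (QOS.QObj.tr H₂) ≅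
          (⟨QOS.OpSpace.proj (QOS.OpSpace.T H₁) (QOS.OpSpace.T H₂),
            QOS.OpSpace.ofVNA (QOS.spatialTensor (QOS.fullVNA H₁) (QOS.fullVNA H₂)),
            (QOS.trPairing (QOS.HilbertTensor H₁ H₂)).comp
              (QOS.CCMap.map Φ (QOS.vnaInclusion
                (QOS.spatialTensor (QOS.fullVNA H₁) (QOS.fullVNA H₂))))⟩ : QOS.QObj.{u}),
        e.hom.f = QOS.CCMap.id _ :=
  ⟨QOS.tensorMap H₁ H₂, QOS.isCompletelyIsometricIso_tensorMap H₁ H₂,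
    fun s t => congrArg QOS.TraceClass.toOp (QOS.tensorMap_tmul s t),
    QOS.isCompletelyIsometricIso_vnaInclusion H₁ H₂, QOS.exists_iso_spatialObj H₁ H₂⟩
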